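/- **Notation.** For a number field $K$ of degree $d=[K:\mathbb{Q}]$ let $\mathcal{O}_K$ be its ring of integers, $\Delta_K$ the absolute value of its discriminant, $\mu_K$ the group of roots of unity in $K$, $\omega_K=\#\mu_K$, $r_K$ the rank of $\mathcal{O}_K^\times$, $\zeta_K$ the Dedekind zeta function, and $h$ the absolute logarithmic Weil height, $h(\alpha)=\frac1d\sum_v\log\max(1,|\alpha|_v)$ for $\alpha\in K$. Put on $K_\mathbb{R}=K\otimes_\mathbb{Q}\mathbb{R}$ the positive definite quadratic form $\Delta_K^{-1/d}\operatorname{Tr}(x\overline{x})$, on several copies of $K_\mathbb{R}$ the sum of these forms, and on each such space the Lebesgue measure of the form (so that $\mathcal{O}_K$ has covolume $1$; the left side of the inequality below does not depend on the normalisation of the form). Let $V(N)$ be the volume of the unit ball in $\mathbb{R}^N$. For a real $R>0$ let $B\subset K_\mathbb{R}^t$ be the origin-centred ball of radius $R$ and $f(y_1,\dots,y_n)=\prod_{j=1}^n\mathbf 1_B(y_j)$ for $(y_1,\dots,y_n)\in K_\mathbb{R}^{t\times n}$. For $1\le m\le n$ let $A^2_m$ be the set of $D\in M_{m\times n}(K)$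 of rank $m$ in reduced row echelon form with at least one entry not in $\mu_K\cup\{0\}$, and let $\mathfrak{D}(D)$ be the index of $\{C\in M_{1\times m}(\mathcal{O}_K): CD\in M_{1\times n}(\mathcal{O}_K)\}$ in $M_{1\times m}(\mathcal{O}_K)$. Finally put $f_N(x)=\dfrac{e^x+Ne^{-x/N}}{1+N}$. **Theorem.** Let $c_0\ge c_1>0$. Let $\mathcal{S}$ be any family of number fields such that, for all $K\in\mathcal{S}$, $h(\alpha)>c_1$ for all $\alpha\in K^\times\setminus\mu_K$ and $h(\alpha)>c_0$ for all $\alpha\in\mathcal{O}_K\setminus(\mu_K\cup\{0\})$. For integers $2\le m<n$ let $$t_0=2(n-m)\cdot\sup_{K\in\mathcal{S}}\max\left\{m^2+m,\ \frac{r_K(m^2+m)}{d}\cdot\frac{\log(2+12c_0^{-1}+2\log(n-m)\,c_0^{-1})}{\log\left(\min\{\frac{64}{27},e^{\frac13c_1},\cosh^3(c_1)\}\right)},\ \frac{r_K}{d}\cdot\frac{1}{\log_2\left(f_{n-m}(\frac34c_0)\right)}\right\}.$$ 1. For all $2\le m<n$ put $$\varepsilon=\tfrac12\log\left(\min\{\tfrac43,\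 e^{\frac{c_1}{3(m+1)}},\ f_{n-m}(\tfrac34c_1)\}\right).$$ Then $\varepsilon>0$, and there is a constant $C>0$ depending only on $m,n,c_0,c_1$ such that for every such family $\mathcal{S}$, every integer $t>t_0$, every $R>0$ and every $K\in\mathcal{S}$, with $d=[K:\mathbb{Q}]$, $$\frac{1}{V(td)^mR^{mtd}}\sum_{D\in A^2_m}\frac{1}{\mathfrak{D}(D)^t}\int_{K_\mathbb{R}^{t\times m}}f(xD)\,dx\ \le\ C\cdot\omega_K^{m(n-m)}\cdot(td)^{\frac{m-1}{2}}\cdot Z(K,t,n,m)\cdot e^{-\varepsilon d(t-t_0)},$$ where $$Z(K,t,n,m)=\frac{\zeta_K\left(\frac{1}{2(m+1)}t-\frac1e m(n-m)\right)\cdot\zeta_K\left(\frac{t}{4m(n-m)}\right)^{m(n-m)}}{\zeta_K(t-1)}.$$ In particular the sum on the left converges. 2. There is a constant $A>0$ depending only on $c_0,c_1$ such that $t_0\le A\,n^3\log\log n$ for every such family $\mathcal{S}$ and all $2\le m<n$. -/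

import Mathlib

namespace NFMoment

open MeasureTheory NumberField NumberField.InfinitePlace Matrix
open scoped ENNReal

noncomputable section

/-! ### Heights -/

/-- The (absolute, logarithmic) Weil height of `α ∈ K`:
`h(α) = [K : ℚ]⁻¹ ∑_v log max(1, |α|_v)`, the sum running over all places `v` of `K`, with the
normalised absolute values for which the product formula holds (Mathlib's `Height.logHeight₁` is
this sum). It does not depend on the number field `K` that contains `α`. -/
def weilHeight {K : Type*} [Field K] [NumberField K] (α : K) : ℝ :=
  Height.logHeight₁ α / (Module.finrank ℚ K : ℝ)

/-- The height lower bounds for one number field `K`: `h > c₁` on `Kˣ` away from the roots of unity,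
and `h > c₀` on `𝓞 K` away from zero and the roots of unity. -/
def HeightBounds (K : Type*) [Field K] [NumberField K] (c₀ c₁ : ℝ) : Prop :=
  (∀ α : K, α ≠ 0 → ¬ IsOfFinOrder α → c₁ < weilHeight α) ∧
  (∀ α : 𝓞 K, α ≠ 0 → ¬ IsOfFinOrder α → c₀ < weilHeight (α : K))

/-! ### The Euclidean space `K_ℝ^t` -/

/-- The quadratic form `|Δ_K|^{-1/d} Tr(x x̄)` on `K_ℝ = ℝ^{r₁} × ℂ^{r₂}`. Here
`Tr(x x̄) = ∑_w mult(w) |x_w|²` with multiplicity `1` at real and `2` at complex places `w`, and the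
factor in front makes `𝓞 K` a lattice of covolume one. -/
def quadForm (K : Type*) [Field K] [NumberField K] (x : mixedEmbedding.mixedSpace K) : ℝ :=
  |(discr K : ℝ)| ^ (-(1 / (Module.finrank ℚ K : ℝ))) *
    ∑ w : InfinitePlace K, (w.mult : ℝ) * mixedEmbedding.normAtPlace w x ^ 2

/-- The closed origin-centred ball of radius `R` in `K_ℝ^t`, for the sum of the quadratic forms of
the `t` copies of `K_ℝ`. -/
def ball (K : Type*) [Field K] [NumberField K] (t : ℕ) (R : ℝ) :
    Set (Fin t → mixedEmbedding.mixedSpace K) :=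
  {x | Real.sqrt (∑ s, quadForm K (x s)) ≤ R}

open scoped Classical in
/-- The Lebesgue measure on `m × t` copies of `K_ℝ` that belongs to the quadratic form `quadForm`.
On each copy it is `2^{r₂} |Δ_K|^{-1/2}` times the standard Lebesgue measure of `ℝ^{r₁} × ℂ^{r₂}`. -/
def lebesgue (K : Type*) [Field K] [NumberField K] (m t : ℕ) :
    Measure (Fin m → Fin t → mixedEmbedding.mixedSpace K) :=
  (ENNReal.ofReal (2 ^ nrComplexPlaces K / Real.sqrt |(discr K : ℝ)|)) ^ (m * t) • volume

/-- The `j`-th column `∑ᵢ D_{ij} xᵢ ∈ K_ℝ^t` of `x D`, where `x = (x₁, …, x_m)` with `xᵢ ∈ K_ℝ^t`. -/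
def column {K : Type*} [Field K] [NumberField K] {m n t : ℕ} (D : Matrix (Fin m) (Fin n) K)
    (x : Fin m → Fin t → mixedEmbedding.mixedSpace K) (j : Fin n) :
    Fin t → mixedEmbedding.mixedSpace K :=
  fun s => ∑ i, mixedEmbedding K (D i j) * x i s

/-- `∫ f(xD) dx`, where `f(y₁, …, y_n) = ∏ⱼ 1_B(yⱼ)` and `B` is the ball of radius `R`. -/
def ballIntegral {K : Type*} [Field K] [NumberField K] {m n : ℕ} (t : ℕ) (R : ℝ)
    (D : Matrix (Fin m) (Fin n) K) : ℝ≥0∞ :=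
  ∫⁻ x, ∏ j, (ball K t R).indicator (1 : (Fin t → mixedEmbedding.mixedSpace K) → ℝ≥0∞) (column D x j)
    ∂(lebesgue K m t)

/-- `V(N)`, the volume of the unit ball of `ℝ^N`. -/
def unitBallVolume (N : ℕ) : ℝ≥0∞ :=
  volume (Metric.ball (0 : EuclideanSpace ℝ (Fin N)) 1)

/-! ### Matrices -/

/-- The subgroup `{C ∈ (𝓞 K)^m : C D ∈ (𝓞 K)^n}` of `(𝓞 K)^m` (row vectors). -/
def integralRows {K : Type*} [Field K] [NumberField K] {m n : ℕ} (D : Matrix (Fin m) (Fin n) K) :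
    AddSubgroup (Fin m → 𝓞 K) where
  carrier := {C | ∀ j, IsIntegral ℤ (((fun i => (C i : K)) ᵥ* D) j)}
  zero_mem' := by
    intro j
    have h : (fun i => (((0 : Fin m → 𝓞 K) i : 𝓞 K) : K)) = 0 := by ext; simp
    rw [h, Matrix.zero_vecMul]
    exact isIntegral_zero
  add_mem' := by
    intro a b ha hb j
    have h : (fun i => (((a + b) i : 𝓞 K) : K)) =
        (fun i => ((a i : 𝓞 K) : K)) + fun i => ((b i : 𝓞 K) : K) := by ext; simp
    rw [h, Matrix.add_vecMul]
    exact (ha j).add (hb j)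
  neg_mem' := by
    intro a ha j
    have h : (fun i => (((-a) i : 𝓞 K) : K)) = -(fun i => ((a i : 𝓞 K) : K)) := by ext; simp
    rw [h, Matrix.neg_vecMul]
    exact (ha j).neg

/-- `𝔇(D)`, the index of `{C ∈ (𝓞 K)^m : C D ∈ (𝓞 K)^n}` in `(𝓞 K)^m`. -/
def denominatorIndex {K : Type*} [Field K] [NumberField K] {m n : ℕ}
    (D : Matrix (Fin m) (Fin n) K) : ℕ :=
  (integralRows D).index

/-- `A²_m`: the `m × n` matrices over `K` of rank `m` in reduced row echelon form with at least one
entry that is neither zero nor a root of unity. -/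
def setA2 (K : Type*) [Field K] [NumberField K] (m n : ℕ) : Set (Matrix (Fin m) (Fin n) K) :=
  {D | D.IsReducedRowEchelon ∧ D.rank = m ∧ ∃ i j, D i j ≠ 0 ∧ ¬ IsOfFinOrder (D i j)}

/-- `V(td)^{-m} R^{-mtd} ∑_{D ∈ A²_m} 𝔇(D)^{-t} ∫ f(xD) dx`, with values in `[0, ∞]`. -/
def normalizedContribution (K : Type*) [Field K] [NumberField K] (n m t : ℕ) (R : ℝ) : ℝ≥0∞ :=
  (∑' D : setA2 K m n,
      ((denominatorIndex (D : Matrix (Fin m) (Fin n) K) : ℝ≥0∞) ^ t)⁻¹ * ballIntegral t R D.1) /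
    (unitBallVolume (t * Module.finrank ℚ K) ^ m *
      ENNReal.ofReal R ^ (m * t * Module.finrank ℚ K))

/-! ### The explicit quantities -/

/-- `f_N(x) = (e^x + N e^{-x/N}) / (1 + N)`. -/
def fAux (N x : ℝ) : ℝ := (Real.exp x + N * Real.exp (-(x / N))) / (1 + N)

/-- The threshold `t₀` of a family of number fields; `Units.rank K` is the rank `r_K` of the unit
group. -/
def threshold {ι : Type*} (K : ι → Type*) [∀ i, Field (K i)] [∀ i, NumberField (K i)]
    (c₀ c₁ : ℝ) (n m : ℕ) : ℝ :=
  2 * ((n : ℝ) - m) *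
    ⨆ i, max ((m : ℝ) ^ 2 + m)
      (max
        ((Units.rank (K i) : ℝ) * ((m : ℝ) ^ 2 + m) / (Module.finrank ℚ (K i) : ℝ) *
          (Real.log (2 + 12 * c₀⁻¹ + 2 * Real.log ((n : ℝ) - m) * c₀⁻¹) /
            Real.log (min (64 / 27) (min (Real.exp (1 / 3 * c₁)) (Real.cosh c₁ ^ 3)))))
        ((Units.rank (K i) : ℝ) / (Module.finrank ℚ (K i) : ℝ) *
          (Real.logb 2 (fAux ((n : ℝ) - m) (3 / 4 * c₀)))⁻¹))

/-- The exponent `ε = ½ log min {4/3, e^{c₁/(3(m+1))}, f_{n-m}(3c₁/4)}`. -/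
def decayRate (c₁ : ℝ) (n m : ℕ) : ℝ :=
  1 / 2 * Real.log (min (4 / 3) (min (Real.exp (c₁ / (3 * ((m : ℝ) + 1))))
    (fAux ((n : ℝ) - m) (3 * c₁ / 4))))

/-- The Dedekind zeta function `ζ_K(s)` at a real number `s`. -/
def zetaReal (K : Type*) [Field K] [NumberField K] (s : ℝ) : ℝ := (dedekindZeta K (s : ℂ)).re

/-- The zeta factor `Z(K, t, n, m)`. -/
def zetaFactor (K : Type*) [Field K] [NumberField K] (t n m : ℕ) : ℝ :=
  zetaReal K (1 / (2 * ((m : ℝ) + 1)) * t - 1 / Real.exp 1 * (m * ((n : ℝ) - m))) *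
    zetaReal K ((t : ℝ) / (4 * m * ((n : ℝ) - m))) ^ (m * (n - m)) /
      zetaReal K ((t : ℝ) - 1)

end

end NFMoment

/-!
Write `N = n - m` and `d = [K : ℚ]`. A matrix `D` in reduced row echelon form of rank `m` is
determined by its pivot columns and the `m N` entries `α_e` in the other columns. Its term in the
sum is estimated in two factors, one for the ideals of the entries and one for their heights.

*Ideals.* The entries have a common denominator ideal `P` and numerator ideals `A_e`, so that
`α_e 𝓞 K = A_e P⁻¹` and `P` and the `A_e` together generate the unit ideal (`exists_coprimeTuple`).
The index `𝔇(D)` is at least `N(P)` (`absNorm_le_denominatorIndex`), because the annihilator of a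
finite module has norm at most the number of its elements.

*Volumes.* Completing the square places the points of a slice of the domain of integration in an
ellipsoid. This bounds the normalised integral by `∏_v ((1 + |α|_v²) / 2)^{-t d_v / 2}` for every
entry `α` (`HasPivots.ballIntegral_le_entry`), and by
`5 t d ∏_v (4 / 9 (1 + |α|_v² + |β|_v²))^{-t d_v / 2}` for two entries of one column
(`HasPivots.ballIntegral_le_two_entries`). With the product formula and Jensen's inequality for
`log ∘ cosh`, these become bounds `e^{-t d E}` times at most `5 t d`, in which `E` can be

* `(log N(P) + log N(A_e)) / (2 d)` for every `e`;
* `h'(α) - (log 2) / 2` or `log (cosh (2 h'(α))) / 2` for an entry `α ≠ 0`, where `h' ≥ h` is the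
  height with its finite part replaced by `log N(P) / d` (`idealHeight`);
* `log (4 / 3) / 2` if some column has two nonzero entries.

The best exponent is at least the mean of two of them (`le_mul_prod_idealWeight_of_le`). Half of the
first kind yields `N(P)^{-a} ∏ N(A_e)^{-b}`, and the sum of this over coprime tuples of ideals is at
most `2^{m N} ζ(a) ζ(b)^{m N} / ζ(t - 1)`, as every tuple is a unique multiple of a coprime one
(`idealZetaSum_mul_tsum_coprimeTuples_le`).

*Counting.* For fixed ideals the possible values of an entry differ by units. Their logarithms are
separated by the height bound on units, so a packing argument leaves at most `ω_K (1 + 2 Y / c₀)^r`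
values with `h' ≤ Y` (`card_le_of_idealHeight_le`). The matrices are sorted by the integer part `l`
of the largest `h'` of a nonzero entry. For `l ≥ 1` the exponent `h' - (log 2) / 2` outweighs their
number. For `l = 0` there are either two nonzero entries in one column, with exponent
`log (4 / 3) / 2`, or at most `N` nonzero entries, one of which is not a root of unity and has
exponent `log (cosh (2 c₁)) / 2 ≥ 3 log (cosh c₁) / 2`. In each case the first two terms of the
threshold leave a factor `e^{-ε t d}` and a further exponential factor that absorbs `5 t d` and the
sum over `l` (`level_bound`). The heights enter through `c₁ ≤ c₀ < h(2) ≤ log 2`.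

The growth of the threshold follows from `r_K ≤ d` and `f_N(x) ≥ 1 + x² / (2 (1 + N))`
(`exists_threshold_le`).
-/

/-! ### Volumes in `K_ℝ^t` -/

namespace NFMoment

open MeasureTheory NumberField NumberField.InfinitePlace Matrix
open scoped ENNReal Pointwise

section Volume

variable {K : Type*} [Field K] [NumberField K]

instance borelSpace_mixedSpace : BorelSpace (mixedEmbedding.mixedSpace K) := Prod.borelSpace

instance borelSpace_pi_mixedSpace (t : ℕ) :
    BorelSpace (Fin t → mixedEmbedding.mixedSpace K) := Pi.borelSpace

instance measurableAdd_mixedSpace : MeasurableAdd (mixedEmbedding.mixedSpace K) := inferInstance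

open scoped Classical in
instance isAddHaarMeasure_pi_mixedSpace (t : ℕ) :
    Measure.IsAddHaarMeasure (volume : Measure (Fin t → mixedEmbedding.mixedSpace K)) :=
  Measure.pi.isAddHaarMeasure _

open scoped Classical in
instance sigmaFinite_pi_mixedSpace (t : ℕ) :
    SigmaFinite (volume : Measure (Fin t → mixedEmbedding.mixedSpace K)) :=
  Measure.pi.sigmaFinite _

/-- The weighted form `|Δ_K|^{-1/d} ∑ₛ ∑_v mult(v) w_v |x_{s,v}|²` on `K_ℝ^t`; the weight `w = 1`
gives the form that defines `ball`. -/
noncomputable def weightedForm {t : ℕ} (w : InfinitePlace K → ℝ)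
    (x : Fin t → mixedEmbedding.mixedSpace K) : ℝ :=
  |(discr K : ℝ)| ^ (-(1 / (Module.finrank ℚ K : ℝ))) *
    ∑ s, ∑ v : InfinitePlace K, (v.mult : ℝ) * (w v * mixedEmbedding.normAtPlace v (x s) ^ 2)

lemma sum_quadForm {t : ℕ} (x : Fin t → mixedEmbedding.mixedSpace K) :
    ∑ s, quadForm K (x s) = weightedForm 1 x := by
  simp [quadForm, weightedForm, Finset.mul_sum]

lemma mem_ball_iff {t : ℕ} {R : ℝ} (hR : 0 ≤ R) (x : Fin t → mixedEmbedding.mixedSpace K) :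
    x ∈ ball K t R ↔ weightedForm 1 x ≤ R ^ 2 := by
  simp only [ball, sum_quadForm, Set.mem_ofPred_eq]
  rw [Real.sqrt_le_left hR]

lemma weightedForm_nonneg {t : ℕ} {w : InfinitePlace K → ℝ} (hw : ∀ v, 0 ≤ w v)
    (x : Fin t → mixedEmbedding.mixedSpace K) : 0 ≤ weightedForm w x := by
  unfold weightedForm
  refine mul_nonneg (by positivity) (Finset.sum_nonneg fun s _ => Finset.sum_nonneg fun v _ => ?_)
  have := hw v
  positivity

lemma continuous_weightedForm {t : ℕ} (w : InfinitePlace K → ℝ) :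
    Continuous (weightedForm (t := t) w) := by
  unfold weightedForm
  refine continuous_const.mul (continuous_finsetSum _ fun s _ => continuous_finsetSum _ fun v _ => ?_)
  have := (mixedEmbedding.continuous_normAtPlace (K := K) v).comp
    (continuous_apply (A := fun _ : Fin t => mixedEmbedding.mixedSpace K) s)
  simp only [Function.comp_def] at this
  fun_prop

lemma measurableSet_ball (t : ℕ) (R : ℝ) : MeasurableSet (ball K t R) := by
  have : ball K t R = {x | Real.sqrt (weightedForm 1 x) ≤ R} := by
    ext x; simp [ball, sum_quadForm]
  rw [this]
  exact (isClosed_le (Real.continuous_sqrt.comp (continuous_weightedForm 1))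
    continuous_const).measurableSet

/-- Multiplication by the real number `s v` at each place `v`. -/
noncomputable def placeScale (s : InfinitePlace K → ℝ) :
    mixedEmbedding.mixedSpace K →ₗ[ℝ] mixedEmbedding.mixedSpace K :=
  LinearMap.prodMap
    (LinearMap.pi fun v => (s v.1 • LinearMap.id : ℝ →ₗ[ℝ] ℝ).comp (LinearMap.proj v))
    (LinearMap.pi fun v => (s v.1 • LinearMap.id : ℂ →ₗ[ℝ] ℂ).comp (LinearMap.proj v))

omit [NumberField K] in
lemma normAtPlace_placeScale (s : InfinitePlace K → ℝ) (x : mixedEmbedding.mixedSpace K)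
    (v : InfinitePlace K) :
    mixedEmbedding.normAtPlace v (placeScale s x) = |s v| * mixedEmbedding.normAtPlace v x := by
  rcases v.isReal_or_isComplex with hv | hv
  · simp [mixedEmbedding.normAtPlace_apply_of_isReal hv, placeScale]
  · simp [mixedEmbedding.normAtPlace_apply_of_isComplex hv, placeScale]

lemma det_placeScale (s : InfinitePlace K → ℝ) :
    LinearMap.det (placeScale s) = ∏ v, s v ^ v.mult := by
  classical
  unfold placeScale
  rw [LinearMap.det_prodMap, LinearMap.det_pi, LinearMap.det_pi]
  simp only [LinearMap.det_smul, LinearMap.det_id, mul_one, Module.finrank_self,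
    Complex.finrank_real_complex, pow_one]
  rw [← Fintype.prod_subtype_mul_prod_subtype (fun v : InfinitePlace K => IsReal v)
    (fun v => s v ^ v.mult)]
  congr 1
  · exact Finset.prod_congr rfl fun v _ => by simp [mult_isReal]
  · refine Fintype.prod_equiv (Equiv.subtypeEquivRight fun v => not_isReal_iff_isComplex.symm) _ _
      fun v => ?_
    have : IsComplex v.1 := v.2
    simp [InfinitePlace.mult, not_isReal_iff_isComplex.mpr this]

/-- Multiplication by the real number `s v` at each place `v`, on all copies. -/
noncomputable def placeScaleAll (t : ℕ) (s : InfinitePlace K → ℝ) :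
    (Fin t → mixedEmbedding.mixedSpace K) →ₗ[ℝ] (Fin t → mixedEmbedding.mixedSpace K) :=
  LinearMap.pi fun i => (placeScale s).comp (LinearMap.proj i)

lemma det_placeScaleAll (t : ℕ) (s : InfinitePlace K → ℝ) :
    LinearMap.det (placeScaleAll t s) = (∏ v, s v ^ v.mult) ^ t := by
  unfold placeScaleAll
  rw [LinearMap.det_pi]
  simp [det_placeScale]

lemma weightedForm_placeScaleAll {t : ℕ} (w s : InfinitePlace K → ℝ)
    (x : Fin t → mixedEmbedding.mixedSpace K) :
    weightedForm w (placeScaleAll t s x) = weightedForm (fun v => w v * s v ^ 2) x := by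
  unfold weightedForm
  congr 1
  refine Finset.sum_congr rfl fun i _ => Finset.sum_congr rfl fun v _ => ?_
  have : placeScaleAll t s x i = placeScale s (x i) := rfl
  rw [this, normAtPlace_placeScale, mul_pow, sq_abs]
  ring

open scoped Classical in
lemma volume_weightedForm_mul_sq {t : ℕ} (w s : InfinitePlace K → ℝ) (hs : ∀ v, 0 < s v) (ρ : ℝ) :
    volume {x : Fin t → mixedEmbedding.mixedSpace K | weightedForm (fun v => w v * s v ^ 2) x ≤ ρ} =
      ENNReal.ofReal (((∏ v, s v ^ v.mult) ^ t)⁻¹) *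
        volume {x : Fin t → mixedEmbedding.mixedSpace K | weightedForm w x ≤ ρ} := by
  have hpos : 0 < (∏ v, s v ^ v.mult) ^ t :=
    pow_pos (Finset.prod_pos fun v _ => pow_pos (hs v) _) _
  have hdet : LinearMap.det (placeScaleAll t s) ≠ 0 := by
    rw [det_placeScaleAll]; exact hpos.ne'
  have h := Measure.addHaar_preimage_linearMap
    (volume : Measure (Fin t → mixedEmbedding.mixedSpace K)) hdet
    {x | weightedForm w x ≤ ρ}
  rw [det_placeScaleAll, abs_of_pos (inv_pos.mpr hpos)] at h
  rw [← h]
  congr 1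
  ext x
  simp [weightedForm_placeScaleAll]

open scoped Classical in
/-- The volume of a sublevel set of a weighted form, relative to that of the unit ball. -/
lemma volume_weightedForm_le {t : ℕ} (w : InfinitePlace K → ℝ) (hw : ∀ v, 0 < w v)
    (c : Fin t → mixedEmbedding.mixedSpace K) {ρ : ℝ} (hρ : 0 < ρ) :
    volume {x : Fin t → mixedEmbedding.mixedSpace K | weightedForm w (x + c) ≤ ρ ^ 2} =
      ENNReal.ofReal (Real.exp (-(t / 2 * ∑ v : InfinitePlace K, v.mult * Real.log (w v)))) *
        ENNReal.ofReal (ρ ^ (t * Module.finrank ℚ K)) * volume (ball K t 1) := by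
  have h1 : {x : Fin t → mixedEmbedding.mixedSpace K | weightedForm w (x + c) ≤ ρ ^ 2} =
      (fun x => x + c) ⁻¹' {x | weightedForm w x ≤ ρ ^ 2} := rfl
  rw [h1, measure_preimage_add_right]
  have h2 : ∀ x : Fin t → mixedEmbedding.mixedSpace K,
      weightedForm w x = weightedForm (fun v => (1 : InfinitePlace K → ℝ) v * (Real.sqrt (w v)) ^ 2) x := by
    intro x
    congr 1
    ext v
    rw [Real.sq_sqrt (hw v).le]; simp
  simp only [h2]
  rw [volume_weightedForm_mul_sq 1 _ (fun v => Real.sqrt_pos.mpr (hw v)), mul_assoc]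
  congr 2
  · have hp : 0 < ∏ v, Real.sqrt (w v) ^ v.mult :=
      Finset.prod_pos fun v _ => pow_pos (Real.sqrt_pos.mpr (hw v)) _
    rw [← Real.exp_log (inv_pos.mpr (pow_pos hp t))]
    congr 1
    rw [Real.log_inv, Real.log_pow, Real.log_prod fun v _ => (pow_pos (Real.sqrt_pos.mpr (hw v)) _).ne',
      neg_inj, div_mul_eq_mul_div, mul_div_assoc, Finset.sum_div]
    congr 1
    refine Finset.sum_congr rfl fun v _ => ?_
    rw [Real.log_pow, Real.log_sqrt (hw v).le]
    ring
  · have h3 : {x : Fin t → mixedEmbedding.mixedSpace K | weightedForm 1 x ≤ ρ ^ 2} = ball K t ρ := by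
      ext x; rw [mem_ball_iff hρ.le]; rfl
    rw [h3]
    have h4 : ball K t ρ = ρ • ball K t 1 := by
      ext x
      rw [Set.mem_smul_set_iff_inv_smul_mem₀ hρ.ne', mem_ball_iff hρ.le, mem_ball_iff zero_le_one]
      have : weightedForm 1 (ρ⁻¹ • x) = (ρ ^ 2)⁻¹ * weightedForm 1 x := by
        unfold weightedForm
        rw [mul_left_comm]
        congr 1
        rw [Finset.mul_sum]
        refine Finset.sum_congr rfl fun s _ => ?_
        rw [Finset.mul_sum]
        refine Finset.sum_congr rfl fun v _ => ?_
        rw [Pi.smul_apply, mixedEmbedding.normAtPlace_smul, mul_pow, sq_abs, inv_pow]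
        ring
      rw [this, inv_mul_le_iff₀ (by positivity), one_pow, mul_one]
    rw [h4, Measure.addHaar_smul]
    congr 2
    have h5 : Module.finrank ℝ (Fin t → mixedEmbedding.mixedSpace K) =
        t * Module.finrank ℚ K := by
      refine (Module.finrank_pi_fintype ℝ (M := fun _ : Fin t => mixedEmbedding.mixedSpace K)).trans ?_
      rw [Finset.sum_const, mixedEmbedding.finrank K, Finset.card_univ, Fintype.card_fin, smul_eq_mul]
    rw [h5, abs_of_pos (pow_pos hρ _)]

open scoped Classical in
lemma volume_pi_stdBasis (t : ℕ) :
    (volume : Measure (Fin t → mixedEmbedding.mixedSpace K)) =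
      (Pi.basis fun _ : Fin t => mixedEmbedding.stdBasis K).addHaar := by
  symm
  rw [Module.Basis.addHaar_eq_iff, Module.Basis.coe_parallelepiped,
    ← measure_congr (ZSpan.fundamentalDomain_ae_parallelepiped _ volume)]
  have : ZSpan.fundamentalDomain (Pi.basis fun _ : Fin t => mixedEmbedding.stdBasis K) =
      Set.univ.pi fun _ => ZSpan.fundamentalDomain (mixedEmbedding.stdBasis K) := by
    ext x
    simp only [ZSpan.mem_fundamentalDomain, Pi.basis_repr, Set.mem_pi, Set.mem_univ, true_imp_iff,
      Sigma.forall]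
  rw [this, volume_pi, Measure.pi_pi]
  simp [mixedEmbedding.volume_fundamentalDomain_stdBasis]

/-- The flattening of `K_ℝ^t` to a coordinate space. -/
noncomputable def flatten (K : Type*) [Field K] [NumberField K] (t : ℕ) :
    (Fin t → mixedEmbedding.mixedSpace K) ≃L[ℝ]
      ((Σ _ : Fin t, mixedEmbedding.index K) → ℝ) :=
  (Pi.basis fun _ : Fin t => mixedEmbedding.stdBasis K).equivFunL

open scoped Classical in
lemma measurePreserving_flatten (t : ℕ) : MeasurePreserving (flatten K t) where
  measurable := (flatten K t).continuous.measurable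
  map_eq := by
    rw [volume_pi_stdBasis, Module.Basis.map_addHaar, ← addHaarMeasure_eq_volume_pi]
    rw [← Module.Basis.parallelepiped_basisFun, ← Module.Basis.addHaar]
    congr 1
    ext i j
    simp [flatten, Pi.single_apply, Finsupp.single_apply, eq_comm]

open scoped Classical in
lemma sum_flatten_sq (t : ℕ) (x : Fin t → mixedEmbedding.mixedSpace K) :
    ∑ i, flatten K t x i ^ 2 = ∑ s, ∑ v, mixedEmbedding.normAtPlace v (x s) ^ 2 := by
  rw [Fintype.sum_sigma]
  refine Finset.sum_congr rfl fun s _ => ?_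
  have h : ∀ i, flatten K t x ⟨s, i⟩ = (mixedEmbedding.stdBasis K).repr (x s) i := fun i => by
    simp [flatten, Pi.basis_repr]
  simp only [h, Fintype.sum_sum_type, Fintype.sum_prod_type, Fin.sum_univ_two,
    mixedEmbedding.stdBasis_apply_isReal, mixedEmbedding.stdBasis_apply_isComplex_fst,
    mixedEmbedding.stdBasis_apply_isComplex_snd]
  rw [← Fintype.sum_subtype_add_sum_subtype (fun v : InfinitePlace K => IsReal v)
    (fun v => mixedEmbedding.normAtPlace v (x s) ^ 2)]
  congr 1
  · refine Finset.sum_congr rfl fun v _ => ?_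
    simp [mixedEmbedding.normAtPlace_apply_of_isReal v.2]
  · refine Fintype.sum_equiv (Equiv.subtypeEquivRight fun v => not_isReal_iff_isComplex.symm) _ _
      fun v => ?_
    have hv : IsComplex v.1 := v.2
    change _ = mixedEmbedding.normAtPlace v.1 (x s) ^ 2
    rw [mixedEmbedding.normAtPlace_apply_of_isComplex hv, Complex.sq_norm, Complex.normSq_apply]
    simp only [sq]

lemma card_flatten_index (t : ℕ) [Fintype (Σ _ : Fin t, mixedEmbedding.index K)] :
    Fintype.card (Σ _ : Fin t, mixedEmbedding.index K) = t * Module.finrank ℚ K := by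
  classical
  have h1 := Module.finrank_eq_card_basis (Pi.basis fun _ : Fin t => mixedEmbedding.stdBasis K)
  rw [Module.finrank_pi_fintype, Finset.sum_const, mixedEmbedding.finrank] at h1
  simp only [Finset.card_univ, Fintype.card_fin, smul_eq_mul] at h1
  rw [h1]

lemma prod_const_pow_mult (a : ℝ) : ∏ v : InfinitePlace K, a ^ v.mult = a ^ Module.finrank ℚ K := by
  rw [Finset.prod_pow_eq_pow_sum, InfinitePlace.sum_mult_eq]

lemma prod_sqrt_mult_pow_mult :
    ∏ v : InfinitePlace K, Real.sqrt v.mult ^ v.mult = 2 ^ nrComplexPlaces K := by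
  classical
  rw [← Fintype.prod_subtype_mul_prod_subtype (fun v : InfinitePlace K => IsComplex v)]
  have h1 : ∏ v : {v : InfinitePlace K // IsComplex v}, Real.sqrt v.1.mult ^ v.1.mult =
      2 ^ nrComplexPlaces K := by
    rw [Finset.prod_congr rfl (g := fun _ => (2 : ℝ)) fun v _ => ?_]
    · rw [Finset.prod_const, Finset.card_univ]
    · simp [mult_isComplex]
  have h2 : ∏ v : {v : InfinitePlace K // ¬ IsComplex v}, Real.sqrt v.1.mult ^ v.1.mult = 1 := by
    refine Finset.prod_eq_one fun v _ => ?_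
    have hv : IsReal v.1 := not_isComplex_iff_isReal.mp v.2
    simp [InfinitePlace.mult, hv]
  rw [h1, h2, mul_one]

open scoped Classical in
/-- The unit ball of `quadForm` has the volume of a Euclidean unit ball for the measure that gives
`𝓞 K` covolume one. -/
lemma volume_ball_one {t : ℕ} (ht : 0 < t) :
    ENNReal.ofReal (2 ^ nrComplexPlaces K / Real.sqrt |(discr K : ℝ)|) ^ t *
      volume (ball K t 1) = unitBallVolume (t * Module.finrank ℚ K) := by
  have hd : 0 < Module.finrank ℚ K := Module.finrank_pos
  have hD : 0 < |(discr K : ℝ)| := abs_pos.mpr (Int.cast_ne_zero.mpr (discr_ne_zero K))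
  set δ : ℝ := |(discr K : ℝ)| ^ (-(1 / (Module.finrank ℚ K : ℝ))) with hδ
  have hδ0 : 0 < δ := Real.rpow_pos_of_pos hD _
  -- the ball is the preimage of a Euclidean ball under rescaling each place and flattening
  let s : InfinitePlace K → ℝ := fun v => Real.sqrt (δ * v.mult)
  have hs : ∀ v, 0 < s v := fun v => Real.sqrt_pos.mpr (mul_pos hδ0 (Nat.cast_pos.mpr mult_pos))
  have h1 := volume_weightedForm_mul_sq (t := t) (fun v => (δ * v.mult)⁻¹) s hs 1
  have h2 : {x : Fin t → mixedEmbedding.mixedSpace K |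
      weightedForm (fun v => (δ * v.mult)⁻¹ * s v ^ 2) x ≤ 1} = ball K t 1 := by
    ext x
    rw [mem_ball_iff zero_le_one, one_pow, Set.mem_ofPred_eq]
    have : (fun v => (δ * v.mult)⁻¹ * s v ^ 2) = (1 : InfinitePlace K → ℝ) := by
      ext v
      have hp : 0 < δ * v.mult := mul_pos hδ0 (Nat.cast_pos.mpr mult_pos)
      simp only [s, Real.sq_sqrt hp.le, inv_mul_cancel₀ hp.ne', Pi.one_apply]
    rw [this]
  have h3 : {x : Fin t → mixedEmbedding.mixedSpace K |
      weightedForm (fun v => (δ * v.mult)⁻¹) x ≤ 1} =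
      flatten K t ⁻¹' {y | ∑ i, y i ^ 2 ≤ 1} := by
    ext x
    simp only [Set.mem_ofPred_eq, Set.mem_preimage, sum_flatten_sq]
    have : weightedForm (fun v => (δ * v.mult)⁻¹) x =
        ∑ s, ∑ v, mixedEmbedding.normAtPlace v (x s) ^ 2 := by
      unfold weightedForm
      rw [Finset.mul_sum]
      refine Finset.sum_congr rfl fun s _ => ?_
      rw [Finset.mul_sum]
      refine Finset.sum_congr rfl fun v _ => ?_
      have : (v.mult : ℝ) ≠ 0 := by exact_mod_cast mult_ne_zero
      rw [← hδ]
      field_simp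
    rw [this]
  have hmeas : MeasurableSet {y : (Σ _ : Fin t, mixedEmbedding.index K) → ℝ | ∑ i, y i ^ 2 ≤ 1} :=
    (isClosed_le (by fun_prop) continuous_const).measurableSet
  have : Nonempty (Σ _ : Fin t, mixedEmbedding.index K) := by
    rw [← Fintype.card_pos_iff, card_flatten_index]; positivity
  have : Nonempty (Fin (t * Module.finrank ℚ K)) := ⟨⟨0, by positivity⟩⟩
  have h4 : volume {y : (Σ _ : Fin t, mixedEmbedding.index K) → ℝ | ∑ i, y i ^ 2 ≤ 1} =
      unitBallVolume (t * Module.finrank ℚ K) := by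
    have h5 : {y : (Σ _ : Fin t, mixedEmbedding.index K) → ℝ | ∑ i, y i ^ 2 ≤ 1} =
        (WithLp.toLp 2) ⁻¹' Metric.closedBall
          (0 : EuclideanSpace ℝ (Σ _ : Fin t, mixedEmbedding.index K)) 1 := by
      ext y
      simp [EuclideanSpace.norm_eq, Real.sqrt_le_one]
    rw [h5, (PiLp.volume_preserving_toLp _).measure_preimage
      measurableSet_closedBall.nullMeasurableSet, EuclideanSpace.volume_closedBall, unitBallVolume,
      EuclideanSpace.volume_ball, card_flatten_index, Fintype.card_fin]
  rw [h2, h3, (measurePreserving_flatten t).measure_preimage hmeas.nullMeasurableSet, h4] at h1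
  have h6 : ∏ v, s v ^ v.mult = 2 ^ nrComplexPlaces K / Real.sqrt |(discr K : ℝ)| := by
    simp only [s, Real.sqrt_mul hδ0.le, mul_pow, Finset.prod_mul_distrib, prod_const_pow_mult,
      prod_sqrt_mult_pow_mult]
    have : Real.sqrt δ ^ Module.finrank ℚ K = (Real.sqrt |(discr K : ℝ)|)⁻¹ := by
      rw [Real.sqrt_eq_rpow, Real.sqrt_eq_rpow, hδ, ← Real.rpow_mul hD.le, ← Real.rpow_natCast,
        ← Real.rpow_mul hD.le, ← Real.rpow_neg hD.le]
      congr 1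
      have : (Module.finrank ℚ K : ℝ) ≠ 0 := by positivity
      field_simp
    rw [this]; ring
  have h7 : 0 < 2 ^ nrComplexPlaces K / Real.sqrt |(discr K : ℝ)| := by positivity
  rw [h1, h6, ← mul_assoc, ← ENNReal.ofReal_pow h7.le, ← ENNReal.ofReal_mul (by positivity),
    mul_inv_cancel₀ (by positivity), ENNReal.ofReal_one, one_mul]

end Volume

end NFMoment

/-! ### Completing the square -/

namespace NFMoment

open MeasureTheory NumberField NumberField.InfinitePlace Matrix
open scoped ENNReal Pointwise

section Slices

variable {K : Type*} [Field K] [NumberField K]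

lemma weightedForm_const_mul {t : ℕ} (a : ℝ) (w : InfinitePlace K → ℝ)
    (x : Fin t → mixedEmbedding.mixedSpace K) :
    weightedForm (fun v => a * w v) x = a * weightedForm w x := by
  unfold weightedForm
  rw [mul_left_comm]
  congr 1
  rw [Finset.mul_sum]
  refine Finset.sum_congr rfl fun s _ => ?_
  rw [Finset.mul_sum]
  exact Finset.sum_congr rfl fun v _ => by ring

lemma complex_complete_square (b x w : ℂ) {u : ℝ} (hu : 0 ≤ u) :
    ‖x‖ ^ 2 + u * ‖b * x + w‖ ^ 2 =
      (1 + u * ‖b‖ ^ 2) * ‖x + ((u / (1 + u * ‖b‖ ^ 2) : ℝ) : ℂ) * ((starRingEnd ℂ) b * w)‖ ^ 2 +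
        u / (1 + u * ‖b‖ ^ 2) * ‖w‖ ^ 2 := by
  have h : 0 < 1 + u * ‖b‖ ^ 2 := by positivity
  rw [Complex.sq_norm b] at *
  simp only [Complex.sq_norm, Complex.normSq_apply, Complex.add_re, Complex.add_im,
    Complex.mul_re, Complex.mul_im, Complex.ofReal_re, Complex.ofReal_im, Complex.conj_re,
    Complex.conj_im] at *
  field_simp
  ring

lemma real_complete_square (b x w : ℝ) {u : ℝ} (hu : 0 ≤ u) :
    ‖x‖ ^ 2 + u * ‖b * x + w‖ ^ 2 =
      (1 + u * ‖b‖ ^ 2) * ‖x + u / (1 + u * ‖b‖ ^ 2) * (b * w)‖ ^ 2 +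
        u / (1 + u * ‖b‖ ^ 2) * ‖w‖ ^ 2 := by
  have h : 0 < 1 + u * ‖b‖ ^ 2 := by positivity
  simp only [Real.norm_eq_abs, sq_abs] at *
  field_simp
  ring

omit [NumberField K] in
/-- The center `-c` and the remainder do not depend on `x`. -/
lemma exists_normAtPlace_complete_square (b w : mixedEmbedding.mixedSpace K)
    (u : InfinitePlace K → ℝ) (hu : ∀ v, 0 ≤ u v) :
    ∃ c : mixedEmbedding.mixedSpace K, ∀ (x : mixedEmbedding.mixedSpace K) (v : InfinitePlace K),
      mixedEmbedding.normAtPlace v x ^ 2 + u v * mixedEmbedding.normAtPlace v (b * x + w) ^ 2 =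
        (1 + u v * mixedEmbedding.normAtPlace v b ^ 2) *
            mixedEmbedding.normAtPlace v (x + c) ^ 2 +
          u v / (1 + u v * mixedEmbedding.normAtPlace v b ^ 2) *
            mixedEmbedding.normAtPlace v w ^ 2 := by
  refine ⟨(fun v => u v.1 / (1 + u v.1 * ‖b.1 v‖ ^ 2) * (b.1 v * w.1 v),
    fun v => ((u v.1 / (1 + u v.1 * ‖b.2 v‖ ^ 2) : ℝ) : ℂ) *
      ((starRingEnd ℂ) (b.2 v) * w.2 v)), fun x v => ?_⟩
  rcases v.isReal_or_isComplex with hv | hv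
  · simp only [mixedEmbedding.normAtPlace_apply_of_isReal hv]
    exact real_complete_square _ _ _ (hu v)
  · simp only [mixedEmbedding.normAtPlace_apply_of_isComplex hv]
    exact complex_complete_square _ _ _ (hu v)

lemma exists_weightedForm_complete_square {t : ℕ} (b : mixedEmbedding.mixedSpace K)
    (w : Fin t → mixedEmbedding.mixedSpace K)
    (u : InfinitePlace K → ℝ) (hu : ∀ v, 0 ≤ u v) :
    ∃ c : Fin t → mixedEmbedding.mixedSpace K, ∀ x : Fin t → mixedEmbedding.mixedSpace K,
      weightedForm 1 x + weightedForm u (fun s => b * x s + w s) =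
        weightedForm (fun v => 1 + u v * mixedEmbedding.normAtPlace v b ^ 2) (x + c) +
          weightedForm (fun v => u v / (1 + u v * mixedEmbedding.normAtPlace v b ^ 2)) w := by
  choose c hc using fun s => exists_normAtPlace_complete_square b (w s) u hu
  refine ⟨c, fun x => ?_⟩
  unfold weightedForm
  rw [← mul_add, ← mul_add, ← Finset.sum_add_distrib, ← Finset.sum_add_distrib]
  congr 1
  refine Finset.sum_congr rfl fun s _ => ?_
  rw [← Finset.sum_add_distrib, ← Finset.sum_add_distrib]
  refine Finset.sum_congr rfl fun v _ => ?_
  rw [← mul_add, ← mul_add, Pi.add_apply, Pi.one_apply, one_mul, hc s (x s) v]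

lemma weightedForm_le_of_complete_square {t : ℕ} (b : mixedEmbedding.mixedSpace K)
    (w : Fin t → mixedEmbedding.mixedSpace K)
    (u : InfinitePlace K → ℝ) (hu : ∀ v, 0 ≤ u v) :
    ∃ c : Fin t → mixedEmbedding.mixedSpace K, ∀ x : Fin t → mixedEmbedding.mixedSpace K,
      weightedForm (fun v => 1 + u v * mixedEmbedding.normAtPlace v b ^ 2) (x + c) ≤
      weightedForm 1 x + weightedForm u (fun s => b * x s + w s) := by
  obtain ⟨c, hc⟩ := exists_weightedForm_complete_square b w u hu
  refine ⟨c, fun x => ?_⟩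
  rw [hc]
  refine le_add_of_nonneg_right (weightedForm_nonneg (fun v => ?_) _)
  have := hu v
  positivity

open scoped Classical in
/-- The points `x` of the ball with `b x + z` in the ball lie in a translate of an ellipsoid. -/
lemma volume_inter_affine_le {t : ℕ} (b : mixedEmbedding.mixedSpace K)
    (z : Fin t → mixedEmbedding.mixedSpace K) {R : ℝ} (hR : 0 < R) :
    volume {x : Fin t → mixedEmbedding.mixedSpace K |
        x ∈ ball K t R ∧ (fun s => b * x s + z s) ∈ ball K t R} ≤
      ENNReal.ofReal (Real.exp (-(t / 2 * ∑ v : InfinitePlace K,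
          v.mult * Real.log ((1 + mixedEmbedding.normAtPlace v b ^ 2) / 2)))) *
        ENNReal.ofReal (R ^ (t * Module.finrank ℚ K)) * volume (ball K t 1) := by
  obtain ⟨c, hc⟩ := weightedForm_le_of_complete_square b z 1 (fun _ => zero_le_one)
  rw [← volume_weightedForm_le (fun v => (1 + mixedEmbedding.normAtPlace v b ^ 2) / 2)
    (fun v => by positivity) c hR]
  refine measure_mono fun x hx => ?_
  obtain ⟨h1, h2⟩ := hx
  rw [mem_ball_iff hR.le] at h1 h2
  have h3 := hc x
  have h4 : weightedForm (fun v => (1 + mixedEmbedding.normAtPlace v b ^ 2) / 2) (x + c) =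
      1 / 2 * weightedForm (fun v => 1 + (1 : InfinitePlace K → ℝ) v *
        mixedEmbedding.normAtPlace v b ^ 2) (x + c) := by
    rw [← weightedForm_const_mul]
    congr 1
    ext v
    rw [Pi.one_apply]; ring
  rw [Set.mem_ofPred_eq, h4]
  linarith

/-- `((3 + 1/N)/2)^N ≤ (5/3) (3/2)^N`. -/
lemma three_add_inv_div_two_pow_le {N : ℕ} (hN : 0 < N) :
    ((3 + 1 / (N : ℝ)) / 2) ^ N ≤ 5 / 3 * (3 / 2) ^ N := by
  have h1 : (3 + 1 / (N : ℝ)) / 2 = (1 + 1 / (3 * N)) * (3 / 2) := by field_simp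
  rw [h1, mul_pow]
  refine mul_le_mul_of_nonneg_right ?_ (by positivity)
  have h2 : 1 + 1 / (3 * (N : ℝ)) ≤ Real.exp (1 / (3 * N)) := by
    rw [add_comm]; exact Real.add_one_le_exp _
  calc (1 + 1 / (3 * (N : ℝ))) ^ N ≤ Real.exp (1 / (3 * N)) ^ N := by gcongr
    _ = Real.exp (1 / 3) := by rw [← Real.exp_nat_mul]; congr 1; field_simp
    _ ≤ 5 / 3 := by
        have := Real.exp_bound_div_one_sub_of_interval (x := 1 / 3) (by norm_num) (by norm_num)
        linarith

/-- A level `k/N` just below `r`, for `0 ≤ r ≤ 3`. -/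
lemma exists_level {N : ℕ} (hN : 0 < N) {r : ℝ} (h0 : 0 ≤ r) (h3 : r ≤ 3) :
    ∃ k < 3 * N, (k : ℝ) / N ≤ r ∧ r ≤ (k + 1) / N := by
  have hN' : (0 : ℝ) < N := Nat.cast_pos.mpr hN
  have hrN : 0 ≤ r * N := by positivity
  by_cases h : r * N < 3 * N
  · refine ⟨⌊r * N⌋₊, ?_, ?_, ?_⟩
    · rw [Nat.floor_lt hrN]; push_cast; exact h
    · rw [div_le_iff₀ hN']; exact Nat.floor_le hrN
    · rw [le_div_iff₀ hN']; exact (Nat.lt_floor_add_one _).le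
  · refine ⟨3 * N - 1, by omega, ?_, ?_⟩
    · rw [div_le_iff₀ hN', Nat.cast_sub (by omega)]; push_cast; linarith
    · rw [le_div_iff₀ hN', Nat.cast_sub (by omega)]; push_cast; nlinarith

open scoped Classical in
/-- The volume of the pairs `(x₁, x₂)` in the square of the ball with `a x₁ + b x₂ + z` in the
ball. For fixed `x₁` the slice is contained in an ellipsoid whose radius decreases with a
weighted form `ρ(x₁)`; cutting the range of `ρ` into levels of width `R²/(td)` loses only a factor
linear in the dimension `td`. -/
lemma lintegral_inter_affine_two_le {t : ℕ} (ht : 0 < t) (a b : mixedEmbedding.mixedSpace K)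
    (z : Fin t → mixedEmbedding.mixedSpace K) {R : ℝ} (hR : 0 < R) :
    ∫⁻ x₁, volume {x₂ : Fin t → mixedEmbedding.mixedSpace K |
        x₁ ∈ ball K t R ∧ x₂ ∈ ball K t R ∧ (fun s => a * x₁ s + b * x₂ s + z s) ∈ ball K t R} ≤
      ENNReal.ofReal (5 * (t * Module.finrank ℚ K : ℕ) *
          Real.exp (-(t / 2 * ∑ v : InfinitePlace K, v.mult *
            Real.log (4 / 9 * (1 + mixedEmbedding.normAtPlace v a ^ 2 +
              mixedEmbedding.normAtPlace v b ^ 2))))) *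
        (ENNReal.ofReal (R ^ (t * Module.finrank ℚ K)) * volume (ball K t 1)) ^ 2 := by
  set N := t * Module.finrank ℚ K with hNdef
  have hN : 0 < N := Nat.mul_pos ht Module.finrank_pos
  have hN' : (0 : ℝ) < N := Nat.cast_pos.mpr hN
  set wb : InfinitePlace K → ℝ := fun v => 1 + mixedEmbedding.normAtPlace v b ^ 2 with hwb
  have hwb0 : ∀ v, 0 < wb v := fun v => by simp only [hwb]; positivity
  set wa : InfinitePlace K → ℝ := fun v => 1 + 1 / wb v * mixedEmbedding.normAtPlace v a ^ 2
    with hwa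
  have hwa0 : ∀ v, 0 < wa v := fun v => by
    have := hwb0 v
    simp only [hwa]; positivity
  obtain ⟨c₁, hc₁⟩ := weightedForm_le_of_complete_square a z (fun v => 1 / wb v)
    (fun v => (one_div_pos.mpr (hwb0 v)).le)
  let ρ : ℕ → ℝ := fun k => Real.sqrt (3 - k / N) * R
  let σ : ℕ → ℝ := fun k => Real.sqrt ((k + 1) / N) * R
  let Eb : ℝ := Real.exp (-(t / 2 * ∑ v : InfinitePlace K, v.mult * Real.log (wb v)))
  let Ea : ℝ := Real.exp (-(t / 2 * ∑ v : InfinitePlace K, v.mult * Real.log (wa v)))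
  let S : ℕ → Set (Fin t → mixedEmbedding.mixedSpace K) := fun k =>
    {x | weightedForm wa (x + c₁) ≤ σ k ^ 2}
  have hlev : ∀ k < 3 * N, 0 < 3 - (k : ℝ) / N := fun k hk => by
    rw [sub_pos, div_lt_iff₀ hN']
    exact_mod_cast hk
  have hρ : ∀ k < 3 * N, 0 < ρ k := fun k hk => mul_pos (Real.sqrt_pos.mpr (hlev k hk)) hR
  have hσ : ∀ k, 0 < σ k := fun k => mul_pos (Real.sqrt_pos.mpr (by positivity)) hR
  have hslice : ∀ x₁, volume {x₂ : Fin t → mixedEmbedding.mixedSpace K |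
        x₁ ∈ ball K t R ∧ x₂ ∈ ball K t R ∧
          (fun s => a * x₁ s + b * x₂ s + z s) ∈ ball K t R} ≤
      ∑ k ∈ Finset.range (3 * N), (S k).indicator
        (fun _ => ENNReal.ofReal Eb * ENNReal.ofReal (ρ k ^ N) * volume (ball K t 1)) x₁ := by
    intro x₁
    obtain ⟨c₂, hc₂⟩ := exists_weightedForm_complete_square b (fun s => a * x₁ s + z s) 1
      (fun _ => zero_le_one)
    have hmem : ∀ x₂, (x₁ ∈ ball K t R ∧ x₂ ∈ ball K t R ∧
        (fun s => a * x₁ s + b * x₂ s + z s) ∈ ball K t R) →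
        weightedForm wb (x₂ + c₂) + weightedForm wa (x₁ + c₁) ≤ 3 * R ^ 2 := by
      rintro x₂ ⟨h1, h2, h3⟩
      rw [mem_ball_iff hR.le] at h1 h2 h3
      have h4 := hc₂ x₂
      have h5 := hc₁ x₁
      have h6 : (fun s => a * x₁ s + b * x₂ s + z s) =
          fun s => b * x₂ s + (a * x₁ s + z s) := by ext1 s; ring
      rw [h6] at h3
      simp only [Pi.one_apply, one_mul] at h4
      linarith
    rcases Set.eq_empty_or_nonempty {x₂ : Fin t → mixedEmbedding.mixedSpace K |
        x₁ ∈ ball K t R ∧ x₂ ∈ ball K t R ∧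
          (fun s => a * x₁ s + b * x₂ s + z s) ∈ ball K t R} with he | ⟨x₂, hx₂⟩
    · rw [he, measure_empty]; exact zero_le
    have h1 := hmem x₂ hx₂
    have h2 := weightedForm_nonneg (fun v => (hwb0 v).le) (x₂ + c₂)
    have h3 := weightedForm_nonneg (fun v => (hwa0 v).le) (x₁ + c₁)
    obtain ⟨k, hk, hk1, hk2⟩ := exists_level hN (r := weightedForm wa (x₁ + c₁) / R ^ 2)
      (by positivity) (by rw [div_le_iff₀ (by positivity)]; linarith)
    have hxS : x₁ ∈ S k := by
      simp only [S, σ, Set.mem_ofPred_eq, mul_pow]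
      rw [Real.sq_sqrt (by positivity), ← div_le_iff₀ (by positivity)]
      exact hk2
    refine le_trans ?_ (Finset.single_le_sum (fun _ _ => zero_le) (Finset.mem_range.mpr hk))
    rw [Set.indicator_of_mem hxS, ← volume_weightedForm_le wb hwb0 c₂ (hρ k hk)]
    refine measure_mono fun y hy => ?_
    have h4 := hmem y hy
    simp only [ρ, Set.mem_ofPred_eq, mul_pow]
    rw [Real.sq_sqrt (hlev k hk).le, sub_mul]
    have h5 : (k : ℝ) / N * R ^ 2 ≤ weightedForm wa (x₁ + c₁) := by
      rwa [← le_div_iff₀ (by positivity)]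
    linarith
  have hSm : ∀ k, MeasurableSet (S k) := fun k =>
    (isClosed_le ((continuous_weightedForm wa).comp (continuous_id.add continuous_const))
      continuous_const).measurableSet
  -- the product of the two radii is at most `(3 + 1/N)/2 · R²` by AM-GM
  have hρσ : ∀ k < 3 * N, ρ k * σ k ≤ (3 + 1 / N) / 2 * R ^ 2 := by
    intro k hk
    have h1 : ρ k * σ k = Real.sqrt ((3 - k / N) * ((k + 1) / N)) * R ^ 2 := by
      simp only [ρ, σ]
      rw [Real.sqrt_mul (hlev k hk).le]; ring
    rw [h1]
    refine mul_le_mul_of_nonneg_right ?_ (by positivity)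
    refine Real.sqrt_le_iff.mpr ⟨by positivity, ?_⟩
    have h2 : (3 + 1 / (N : ℝ)) / 2 = ((3 - k / N) + (k + 1) / N) / 2 := by ring
    rw [h2]
    nlinarith [sq_nonneg ((3 - (k : ℝ) / N) - (k + 1) / N)]
  calc _ ≤ ∫⁻ x₁, ∑ k ∈ Finset.range (3 * N), (S k).indicator
        (fun _ => ENNReal.ofReal Eb * ENNReal.ofReal (ρ k ^ N) * volume (ball K t 1)) x₁ :=
        lintegral_mono hslice
    _ = ∑ k ∈ Finset.range (3 * N), ENNReal.ofReal (Eb * Ea * (ρ k * σ k) ^ N) *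
          volume (ball K t 1) ^ 2 := by
        rw [lintegral_finsetSum _ fun k _ => measurable_const.indicator (hSm k)]
        refine Finset.sum_congr rfl fun k hk => ?_
        have hk' := Finset.mem_range.mp hk
        rw [lintegral_indicator_const (hSm k)]
        simp only [S]
        have e1 : ENNReal.ofReal ((ρ k * σ k) ^ N) =
            ENNReal.ofReal (ρ k ^ N) * ENNReal.ofReal (σ k ^ N) := by
          rw [mul_pow, ENNReal.ofReal_mul (pow_pos (hρ k hk') _).le]
        have e2 : ENNReal.ofReal (Eb * Ea) = ENNReal.ofReal Eb * ENNReal.ofReal Ea :=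
          ENNReal.ofReal_mul (Real.exp_pos _).le
        rw [volume_weightedForm_le wa hwa0 c₁ (hσ k),
          ENNReal.ofReal_mul (p := Eb * Ea) (by positivity), e1, e2]
        simp only [Ea, hNdef]
        ring
    _ ≤ ∑ k ∈ Finset.range (3 * N), ENNReal.ofReal (Eb * Ea * (5 / 3 * (3 / 2) ^ N * (R ^ N) ^ 2)) *
          volume (ball K t 1) ^ 2 := by
        refine Finset.sum_le_sum fun k hk => ?_
        have hk' := Finset.mem_range.mp hk
        refine mul_le_mul_left (ENNReal.ofReal_le_ofReal ?_) _
        refine mul_le_mul_of_nonneg_left ?_ (by positivity)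
        calc (ρ k * σ k) ^ N ≤ ((3 + 1 / N) / 2 * R ^ 2) ^ N :=
              pow_le_pow_left₀ (mul_nonneg (hρ k hk').le (hσ k).le) (hρσ k hk') _
          _ = ((3 + 1 / N) / 2) ^ N * (R ^ N) ^ 2 := by rw [mul_pow]; ring
          _ ≤ _ := mul_le_mul_of_nonneg_right (three_add_inv_div_two_pow_le hN) (by positivity)
    _ = _ := by
        rw [Finset.sum_const, Finset.card_range, nsmul_eq_mul, mul_pow, ← ENNReal.ofReal_pow
          (by positivity), ← mul_assoc, ← ENNReal.ofReal_natCast,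
          ← ENNReal.ofReal_mul (Nat.cast_nonneg _), ← mul_assoc (ENNReal.ofReal (5 * _ * _)),
          ← ENNReal.ofReal_mul (by positivity)]
        congr 2
        have hexp : Eb * Ea * (3 / 2) ^ N = Real.exp (-(t / 2 * ∑ v : InfinitePlace K, v.mult *
            Real.log (4 / 9 * (1 + mixedEmbedding.normAtPlace v a ^ 2 +
              mixedEmbedding.normAtPlace v b ^ 2)))) := by
          have h1 : ∀ v, Real.log (4 / 9 * (1 + mixedEmbedding.normAtPlace v a ^ 2 +
              mixedEmbedding.normAtPlace v b ^ 2)) =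
              Real.log (wb v) + Real.log (wa v) - 2 * Real.log (3 / 2) := by
            intro v
            have h2 : 4 / 9 * (1 + mixedEmbedding.normAtPlace v a ^ 2 +
              mixedEmbedding.normAtPlace v b ^ 2) = wb v * wa v * ((3 / 2) ^ 2)⁻¹ := by
              have := (hwb0 v).ne'
              simp only [hwa]
              field_simp
              simp only [hwb]
              ring
            rw [h2, Real.log_mul (mul_pos (hwb0 v) (hwa0 v)).ne' (by positivity),
              Real.log_mul (hwb0 v).ne' (hwa0 v).ne', Real.log_inv, Real.log_pow]
            push_cast; ring
          have h3 : ((3 : ℝ) / 2) ^ N = Real.exp (N * Real.log (3 / 2)) := by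
            rw [Real.exp_nat_mul, Real.exp_log (by norm_num)]
          have h4 : (Module.finrank ℚ K : ℝ) = ∑ v : InfinitePlace K, (v.mult : ℝ) := by
            rw [← InfinitePlace.sum_mult_eq (K := K)]; push_cast; rfl
          simp only [Eb, Ea]
          rw [h3, ← Real.exp_add, ← Real.exp_add]
          congr 1
          have h5 : ∑ v : InfinitePlace K, v.mult * Real.log (4 / 9 *
              (1 + mixedEmbedding.normAtPlace v a ^ 2 + mixedEmbedding.normAtPlace v b ^ 2)) =
              ∑ v : InfinitePlace K, v.mult * Real.log (wb v) +
                ∑ v : InfinitePlace K, v.mult * Real.log (wa v) -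
                Module.finrank ℚ K * (2 * Real.log (3 / 2)) := by
            rw [h4, Finset.sum_mul, ← Finset.sum_add_distrib, ← Finset.sum_sub_distrib]
            exact Finset.sum_congr rfl fun v _ => by rw [h1 v]; ring
          rw [h5, hNdef]
          push_cast
          ring
        rw [← hexp]
        push_cast
        ring

end Slices

end NFMoment

/-! ### Volume bounds for a matrix with pivots -/

namespace NFMoment

open MeasureTheory NumberField NumberField.InfinitePlace Matrix
open scoped ENNReal Pointwise

section Fubini

variable {ι E : Type*} [Fintype ι] [DecidableEq ι] [MeasureSpace E]
  [SigmaFinite (volume : Measure E)]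

omit [Fintype ι] in
lemma lmarginal_prod_indicator {B : Set E} (hB : MeasurableSet B) (s : Finset ι) :
    ∀ (A : ℝ≥0∞) (x : ι → E),
      (∫⋯∫⁻_s, (fun y : ι → E => A * ∏ i ∈ s, B.indicator (1 : E → ℝ≥0∞) (y i))) x =
        A * volume B ^ s.card := by
  have hm : ∀ s : Finset ι, Measurable fun y : ι → E => ∏ i ∈ s, B.indicator (1 : E → ℝ≥0∞) (y i) :=
    fun s => Finset.measurable_prod _ fun i _ =>
      (measurable_one.indicator hB).comp (measurable_pi_apply i)
  induction s using Finset.induction_on with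
  | empty => intro A x; simp
  | insert i s hi ih =>
    intro A x
    rw [lmarginal_insert' _ ((hm _).const_mul A) hi]
    have : (fun x : ι → E => ∫⁻ xᵢ, A * ∏ k ∈ insert i s,
        B.indicator (1 : E → ℝ≥0∞) (Function.update x i xᵢ k)) =
        fun x => (A * volume B) * ∏ k ∈ s, B.indicator (1 : E → ℝ≥0∞) (x k) := by
      ext1 y
      have h1 : ∀ xᵢ, A * ∏ k ∈ insert i s,
          B.indicator (1 : E → ℝ≥0∞) (Function.update y i xᵢ k) =
          (A * ∏ k ∈ s, B.indicator (1 : E → ℝ≥0∞) (y k)) * B.indicator 1 xᵢ := by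
        intro xᵢ
        rw [Finset.prod_insert hi, Function.update_self,
          Finset.prod_congr rfl fun k hk => by rw [Function.update_of_ne (ne_of_mem_of_not_mem hk hi)]]
        ring
      simp only [h1]
      rw [lintegral_const_mul _ (measurable_one.indicator hB), lintegral_indicator_one hB]
      ring
    rw [this, ih, Finset.card_insert_of_notMem hi, pow_succ']
    ring

lemma lintegral_pi_le_of_one {B : Set E} (hB : MeasurableSet B) (i₁ : ι) {F : (ι → E) → ℝ≥0∞}
    (hF : Measurable F) {A : ℝ≥0∞}
    (h : ∀ x, ∫⁻ x₁, F (Function.update x i₁ x₁) ≤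
      A * ∏ i ∈ Finset.univ.erase i₁, B.indicator (1 : E → ℝ≥0∞) (x i)) :
    ∫⁻ x, F x ≤ A * volume B ^ (Fintype.card ι - 1) := by
  by_cases hne : Nonempty (ι → E)
  · obtain ⟨x⟩ := hne
    rw [volume_pi, lintegral_eq_lmarginal_univ x, lmarginal_erase' _ hF (Finset.mem_univ i₁)]
    refine (lmarginal_mono h x).trans ?_
    rw [lmarginal_prod_indicator hB, Finset.card_erase_of_mem (Finset.mem_univ _),
      Finset.card_univ]
  · have := not_nonempty_iff.mp hne
    simp

lemma lintegral_pi_le_of_two {B : Set E} (hB : MeasurableSet B) {i₁ i₂ : ι} (hi : i₁ ≠ i₂)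
    {F : (ι → E) → ℝ≥0∞} (hF : Measurable F) {A : ℝ≥0∞}
    (h : ∀ x, ∫⁻ x₁, ∫⁻ x₂, F (Function.update (Function.update x i₁ x₁) i₂ x₂) ≤
      A * ∏ i ∈ (Finset.univ.erase i₂).erase i₁, B.indicator (1 : E → ℝ≥0∞) (x i)) :
    ∫⁻ x, F x ≤ A * volume B ^ (Fintype.card ι - 2) := by
  by_cases hne : Nonempty (ι → E)
  · obtain ⟨x⟩ := hne
    have hm : Measurable fun x : ι → E => ∫⁻ x₂, F (Function.update x i₂ x₂) := by
      exact Measurable.lintegral_prod_right' (f := fun p : (ι → E) × E =>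
        F (Function.update p.1 i₂ p.2)) (hF.comp measurable_update')
    rw [volume_pi, lintegral_eq_lmarginal_univ x, lmarginal_erase' _ hF (Finset.mem_univ i₂),
      lmarginal_erase' _ hm (Finset.mem_erase.mpr ⟨hi, Finset.mem_univ i₁⟩)]
    refine (lmarginal_mono h x).trans ?_
    rw [lmarginal_prod_indicator hB,
      Finset.card_erase_of_mem (Finset.mem_erase.mpr ⟨hi, Finset.mem_univ i₁⟩),
      Finset.card_erase_of_mem (Finset.mem_univ _), Finset.card_univ, Nat.sub_sub]
  · have := not_nonempty_iff.mp hne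
    simp

end Fubini

section BallIntegral

variable {K : Type*} [Field K] [NumberField K]

open scoped Classical in
lemma volume_ball_eq {t : ℕ} {R : ℝ} (hR : 0 < R) :
    volume (ball K t R) =
      ENNReal.ofReal (R ^ (t * Module.finrank ℚ K)) * volume (ball K t 1) := by
  have h := volume_weightedForm_le (K := K) (t := t) 1 (fun _ => one_pos) 0 hR
  simp only [add_zero, Pi.one_apply, Real.log_one, mul_zero, Finset.sum_const_zero, neg_zero,
    Real.exp_zero, ENNReal.ofReal_one, one_mul] at h
  rw [← h]
  congr 1
  ext x
  rw [mem_ball_iff hR.le]; rfl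

lemma measurable_column {m n t : ℕ} (D : Matrix (Fin m) (Fin n) K) (j : Fin n) :
    Measurable fun x : Fin m → Fin t → mixedEmbedding.mixedSpace K => column D x j := by
  refine measurable_pi_lambda _ fun s => ?_
  unfold column
  refine Finset.measurable_sum _ fun i _ => ?_
  have h1 : Measurable fun x : mixedEmbedding.mixedSpace K => mixedEmbedding K (D i j) * x :=
    (continuous_const.mul continuous_id).measurable
  exact h1.comp ((measurable_pi_apply s).comp (measurable_pi_apply i))

/-- The integrand of `ballIntegral`. -/
noncomputable def ballIntegrand {m n : ℕ} (t : ℕ) (R : ℝ) (D : Matrix (Fin m) (Fin n) K)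
    (x : Fin m → Fin t → mixedEmbedding.mixedSpace K) : ℝ≥0∞ :=
  ∏ j, (ball K t R).indicator (1 : (Fin t → mixedEmbedding.mixedSpace K) → ℝ≥0∞) (column D x j)

lemma measurable_ballIntegrand {m n : ℕ} (t : ℕ) (R : ℝ) (D : Matrix (Fin m) (Fin n) K) :
    Measurable (ballIntegrand t R D) :=
  Finset.measurable_prod _ fun j _ =>
    (measurable_one.indicator (measurableSet_ball t R)).comp (measurable_column D j)

/-- The columns of `D` numbered by `p` are the standard basis vectors, in order. -/
def HasPivots {m n : ℕ} (D : Matrix (Fin m) (Fin n) K) (p : Fin m → Fin n) : Prop :=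
  ∀ i k, D i (p k) = if i = k then 1 else 0

lemma HasPivots.column_eq {m n t : ℕ} {D : Matrix (Fin m) (Fin n) K} {p : Fin m → Fin n}
    (h : HasPivots D p) (x : Fin m → Fin t → mixedEmbedding.mixedSpace K) (k : Fin m) :
    column D x (p k) = x k := by
  ext1 s
  simp only [column, h _ k]
  rw [Finset.sum_eq_single k]
  · simp
  · intro i _ hi; simp [hi]
  · simp

lemma HasPivots.injective {m n : ℕ} {D : Matrix (Fin m) (Fin n) K} {p : Fin m → Fin n}
    (h : HasPivots D p) : Function.Injective p := by
  intro i k hik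
  by_contra hne
  have h1 := h i i
  have h2 := h i k
  rw [hik, if_pos rfl] at h1
  rw [h1, if_neg hne] at h2
  exact one_ne_zero h2

lemma HasPivots.ballIntegrand_le {m n t : ℕ} {R : ℝ} {D : Matrix (Fin m) (Fin n) K}
    {p : Fin m → Fin n} (h : HasPivots D p)
    (x : Fin m → Fin t → mixedEmbedding.mixedSpace K) :
    ballIntegrand t R D x ≤
      ∏ k, (ball K t R).indicator (1 : (Fin t → mixedEmbedding.mixedSpace K) → ℝ≥0∞) (x k) := by
  classical
  have h1 : ∏ k, (ball K t R).indicator (1 : (Fin t → mixedEmbedding.mixedSpace K) → ℝ≥0∞) (x k) =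
      ∏ j ∈ Finset.univ.image p, (ball K t R).indicator
        (1 : (Fin t → mixedEmbedding.mixedSpace K) → ℝ≥0∞) (column D x j) := by
    rw [Finset.prod_image fun a _ b _ hab => h.injective hab]
    exact Finset.prod_congr rfl fun k _ => by simp only [h.column_eq]
  rw [h1]
  exact Finset.prod_le_prod_of_subset_of_le_one' (Finset.subset_univ _) fun i _ _ =>
    Set.indicator_le_self' (fun _ _ => zero_le) _

lemma ballIntegrand_eq_zero {m n t : ℕ} {R : ℝ} {D : Matrix (Fin m) (Fin n) K}
    {x : Fin m → Fin t → mixedEmbedding.mixedSpace K} {j : Fin n} (h : column D x j ∉ ball K t R) :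
    ballIntegrand t R D x = 0 :=
  Finset.prod_eq_zero (Finset.mem_univ j) (Set.indicator_of_notMem h _)

lemma column_update {m n t : ℕ} (D : Matrix (Fin m) (Fin n) K)
    (x : Fin m → Fin t → mixedEmbedding.mixedSpace K) (j : Fin n) (i : Fin m)
    (y : Fin t → mixedEmbedding.mixedSpace K) :
    column D (Function.update x i y) j = fun s => mixedEmbedding K (D i j) * y s +
      ∑ k ∈ Finset.univ.erase i, mixedEmbedding K (D k j) * x k s := by
  ext1 s
  rw [column, ← Finset.add_sum_erase _ _ (Finset.mem_univ i), Function.update_self]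
  congr 1
  exact Finset.sum_congr rfl fun k hk => by rw [Function.update_of_ne (Finset.ne_of_mem_erase hk)]

lemma column_update_update {m n t : ℕ} (D : Matrix (Fin m) (Fin n) K)
    (x : Fin m → Fin t → mixedEmbedding.mixedSpace K) (j : Fin n) {i₁ i₂ : Fin m} (hi : i₁ ≠ i₂)
    (y₁ y₂ : Fin t → mixedEmbedding.mixedSpace K) :
    column D (Function.update (Function.update x i₁ y₁) i₂ y₂) j =
      fun s => mixedEmbedding K (D i₁ j) * y₁ s + mixedEmbedding K (D i₂ j) * y₂ s +
      ∑ k ∈ (Finset.univ.erase i₂).erase i₁, mixedEmbedding K (D k j) * x k s := by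
  rw [column_update]
  ext1 s
  rw [← Finset.add_sum_erase _ _ (Finset.mem_erase.mpr ⟨hi, Finset.mem_univ i₁⟩),
    Function.update_self, ← add_assoc, add_comm (_ * y₂ s)]
  congr 1
  exact Finset.sum_congr rfl fun k hk => by rw [Function.update_of_ne (Finset.ne_of_mem_erase hk)]

open scoped Classical in
lemma ballIntegral_eq {m n t : ℕ} (R : ℝ) (D : Matrix (Fin m) (Fin n) K) :
    ballIntegral t R D =
      ENNReal.ofReal (2 ^ nrComplexPlaces K / Real.sqrt |(discr K : ℝ)|) ^ (m * t) *
        ∫⁻ x, ballIntegrand t R D x := by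
  unfold ballIntegral lebesgue
  rw [lintegral_smul_measure, smul_eq_mul]
  rfl

open scoped Classical in
lemma ballIntegral_le_of_lintegral_le {m n t : ℕ} (ht : 0 < t) {R : ℝ} (hR : 0 < R)
    (D : Matrix (Fin m) (Fin n) K) {A : ℝ≥0∞}
    (h : ∫⁻ x, ballIntegrand t R D x ≤ A * volume (ball K t R) ^ m) :
    ballIntegral t R D ≤ A * (unitBallVolume (t * Module.finrank ℚ K) ^ m *
      ENNReal.ofReal R ^ (m * t * Module.finrank ℚ K)) := by
  rw [ballIntegral_eq]
  refine (mul_le_mul_right h _).trans_eq ?_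
  rw [← volume_ball_one ht, volume_ball_eq hR, ENNReal.ofReal_pow hR.le]
  ring

lemma HasPivots.ballIntegral_le {m n t : ℕ} (ht : 0 < t) {R : ℝ} (hR : 0 < R)
    {D : Matrix (Fin m) (Fin n) K} {p : Fin m → Fin n} (h : HasPivots D p) :
    ballIntegral t R D ≤ unitBallVolume (t * Module.finrank ℚ K) ^ m *
      ENNReal.ofReal R ^ (m * t * Module.finrank ℚ K) := by
  classical
  rw [← one_mul (_ * _)]
  refine ballIntegral_le_of_lintegral_le ht hR D ?_
  refine (lintegral_mono h.ballIntegrand_le).trans ?_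
  rw [volume_pi, lintegral_eq_lmarginal_univ 0]
  have := lmarginal_prod_indicator (measurableSet_ball (K := K) t R) Finset.univ 1
    (0 : Fin m → Fin t → mixedEmbedding.mixedSpace K)
  simp only [one_mul, Finset.card_univ, Fintype.card_fin] at this
  rw [this, one_mul]

/-- One entry `α` makes the integral at most
`∏_v ((1 + |α|_v²)/2)^{-t mult(v)/2}` times its trivial bound. -/
lemma HasPivots.ballIntegral_le_entry {m n t : ℕ} (ht : 0 < t) {R : ℝ} (hR : 0 < R)
    {D : Matrix (Fin m) (Fin n) K} {p : Fin m → Fin n} (h : HasPivots D p) (j : Fin n)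
    (i : Fin m) :
    ballIntegral t R D ≤ ENNReal.ofReal (Real.exp (-(t / 2 * ∑ v : InfinitePlace K,
          v.mult * Real.log ((1 + v (D i j) ^ 2) / 2)))) *
      (unitBallVolume (t * Module.finrank ℚ K) ^ m *
        ENNReal.ofReal R ^ (m * t * Module.finrank ℚ K)) := by
  classical
  refine ballIntegral_le_of_lintegral_le ht hR D ?_
  set A := ENNReal.ofReal (Real.exp (-(t / 2 * ∑ v : InfinitePlace K,
          v.mult * Real.log ((1 + v (D i j) ^ 2) / 2))))
  have key := lintegral_pi_le_of_one (measurableSet_ball (K := K) t R) i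
    (measurable_ballIntegrand t R D) (A := A * volume (ball K t R)) ?_
  · refine key.trans_eq ?_
    rw [Fintype.card_fin, mul_assoc, ← pow_succ', Nat.sub_add_cancel (Fin.pos i)]
  · intro x
    set P := ∏ k ∈ Finset.univ.erase i,
      (ball K t R).indicator (1 : (Fin t → mixedEmbedding.mixedSpace K) → ℝ≥0∞) (x k)
    set z : Fin t → mixedEmbedding.mixedSpace K :=
      fun s => ∑ k ∈ Finset.univ.erase i, mixedEmbedding K (D k j) * x k s
    set S : Set (Fin t → mixedEmbedding.mixedSpace K) :=
      {y | y ∈ ball K t R ∧ (fun s => mixedEmbedding K (D i j) * y s + z s) ∈ ball K t R}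
    have hb : ∀ y, ballIntegrand t R D (Function.update x i y) ≤ S.indicator (fun _ => P) y := by
      intro y
      by_cases hy : y ∈ S
      · rw [Set.indicator_of_mem hy]
        refine (h.ballIntegrand_le _).trans ?_
        rw [← Finset.mul_prod_erase _ _ (Finset.mem_univ i), Function.update_self,
          Set.indicator_of_mem hy.1, Pi.one_apply, one_mul]
        exact (Finset.prod_congr rfl fun k hk => by
          rw [Function.update_of_ne (Finset.ne_of_mem_erase hk)]).le
      · rw [Set.indicator_of_notMem hy]
        have hy' : y ∉ ball K t R ∨
            (fun s => mixedEmbedding K (D i j) * y s + z s) ∉ ball K t R := by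
          by_contra hc
          push Not at hc
          exact hy hc
        rcases hy' with hy | hy
        · refine (ballIntegrand_eq_zero (j := p i) ?_).le
          rwa [h.column_eq, Function.update_self]
        · refine (ballIntegrand_eq_zero (j := j) ?_).le
          rwa [column_update]
    refine (lintegral_mono hb).trans ((lintegral_indicator_const_le _ _).trans ?_)
    rw [mul_comm]
    refine mul_le_mul_left ?_ _
    have := volume_inter_affine_le (mixedEmbedding K (D i j)) z hR
    simp only [mixedEmbedding.normAtPlace_apply] at this
    rwa [volume_ball_eq hR, ← mul_assoc]

/-- Two entries `α, β` in one column make the integral at most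
`5 t d ∏_v (4/9 (1 + |α|_v² + |β|_v²))^{-t mult(v)/2}` times its trivial bound. -/
lemma HasPivots.ballIntegral_le_two_entries {m n t : ℕ} (ht : 0 < t) {R : ℝ} (hR : 0 < R)
    {D : Matrix (Fin m) (Fin n) K} {p : Fin m → Fin n} (h : HasPivots D p) (j : Fin n)
    {i₁ i₂ : Fin m} (hi : i₁ ≠ i₂) :
    ballIntegral t R D ≤ ENNReal.ofReal (5 * (t * Module.finrank ℚ K : ℕ) *
        Real.exp (-(t / 2 * ∑ v : InfinitePlace K,
          v.mult * Real.log (4 / 9 * (1 + v (D i₁ j) ^ 2 + v (D i₂ j) ^ 2))))) *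
      (unitBallVolume (t * Module.finrank ℚ K) ^ m *
        ENNReal.ofReal R ^ (m * t * Module.finrank ℚ K)) := by
  classical
  refine ballIntegral_le_of_lintegral_le ht hR D ?_
  set A := ENNReal.ofReal (5 * (t * Module.finrank ℚ K : ℕ) *
        Real.exp (-(t / 2 * ∑ v : InfinitePlace K,
          v.mult * Real.log (4 / 9 * (1 + v (D i₁ j) ^ 2 + v (D i₂ j) ^ 2)))))
  have hm : 2 ≤ m := by
    have h1 := i₁.2
    have h2 := i₂.2
    have h3 : i₁.1 ≠ i₂.1 := fun h => hi (Fin.ext h)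
    omega
  have key := lintegral_pi_le_of_two (measurableSet_ball (K := K) t R) hi
    (measurable_ballIntegrand t R D) (A := A * volume (ball K t R) ^ 2) ?_
  · refine key.trans_eq ?_
    rw [Fintype.card_fin, mul_assoc, ← pow_add, Nat.add_sub_cancel' hm]
  · intro x
    set P := ∏ k ∈ (Finset.univ.erase i₂).erase i₁,
      (ball K t R).indicator (1 : (Fin t → mixedEmbedding.mixedSpace K) → ℝ≥0∞) (x k)
    set z : Fin t → mixedEmbedding.mixedSpace K :=
      fun s => ∑ k ∈ (Finset.univ.erase i₂).erase i₁, mixedEmbedding K (D k j) * x k s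
    let S : (Fin t → mixedEmbedding.mixedSpace K) → Set (Fin t → mixedEmbedding.mixedSpace K) :=
      fun y₁ => {y₂ | y₁ ∈ ball K t R ∧ y₂ ∈ ball K t R ∧
        (fun s => mixedEmbedding K (D i₁ j) * y₁ s + mixedEmbedding K (D i₂ j) * y₂ s + z s) ∈
          ball K t R}
    have hb : ∀ y₁ y₂, ballIntegrand t R D (Function.update (Function.update x i₁ y₁) i₂ y₂) ≤
        (S y₁).indicator (fun _ => P) y₂ := by
      intro y₁ y₂
      by_cases hy : y₂ ∈ S y₁
      · rw [Set.indicator_of_mem hy]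
        refine (h.ballIntegrand_le _).trans ?_
        rw [← Finset.mul_prod_erase _ _ (Finset.mem_univ i₂),
          ← Finset.mul_prod_erase _ _ (Finset.mem_erase.mpr ⟨hi, Finset.mem_univ i₁⟩),
          Function.update_self, Function.update_of_ne hi, Function.update_self,
          Set.indicator_of_mem hy.1, Set.indicator_of_mem hy.2.1, Pi.one_apply, Pi.one_apply,
          one_mul, one_mul]
        exact (Finset.prod_congr rfl fun k hk => by
          rw [Function.update_of_ne (Finset.ne_of_mem_erase (Finset.mem_of_mem_erase hk)),
            Function.update_of_ne (Finset.ne_of_mem_erase hk)]).le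
      · rw [Set.indicator_of_notMem hy]
        have hy' : y₁ ∉ ball K t R ∨ y₂ ∉ ball K t R ∨
            (fun s => mixedEmbedding K (D i₁ j) * y₁ s + mixedEmbedding K (D i₂ j) * y₂ s + z s) ∉
              ball K t R := by
          by_contra hc
          push Not at hc
          exact hy hc
        rcases hy' with hy | hy | hy
        · refine (ballIntegrand_eq_zero (j := p i₁) ?_).le
          rwa [h.column_eq, Function.update_of_ne hi, Function.update_self]
        · refine (ballIntegrand_eq_zero (j := p i₂) ?_).le
          rwa [h.column_eq, Function.update_self]
        · refine (ballIntegrand_eq_zero (j := j) ?_).le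
          rwa [column_update_update D x j hi]
    have hb' : ∀ y₁, ∫⁻ y₂, ballIntegrand t R D
        (Function.update (Function.update x i₁ y₁) i₂ y₂) ≤ P * volume (S y₁) := fun y₁ =>
      (lintegral_mono (hb y₁)).trans (lintegral_indicator_const_le _ _)
    refine (lintegral_mono hb').trans ?_
    have hP : P ≠ ∞ := by
      have : P ≤ 1 := Finset.prod_le_one' fun k _ =>
        Set.indicator_le_self' (fun _ _ => zero_le) (x k)
      exact (this.trans_lt ENNReal.one_lt_top).ne
    rw [lintegral_const_mul' _ _ hP, mul_comm]
    refine mul_le_mul_left ?_ _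
    have := lintegral_inter_affine_two_le ht (mixedEmbedding K (D i₁ j))
      (mixedEmbedding K (D i₂ j)) z hR
    simp only [mixedEmbedding.normAtPlace_apply] at this
    rwa [volume_ball_eq hR]

end BallIntegral

end NFMoment

/-! ### The Dedekind zeta function and coprime tuples of ideals -/

namespace NFMoment

open NumberField
open scoped ENNReal

section Zeta

/-- A product of sums over an index type is the sum over all choice functions. -/
lemma tsum_pi_prod_eq {ι α : Type*} [Fintype ι] (f : ι → α → ℝ≥0∞) :
    ∑' x : ι → α, ∏ i, f i (x i) = ∏ i, ∑' a, f i a := by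
  revert f
  refine Fintype.induction_empty_option (P := fun ι _ => ∀ f : ι → α → ℝ≥0∞,
    ∑' x : ι → α, ∏ i, f i (x i) = ∏ i, ∑' a, f i a) ?_ ?_ ?_ ι
  · intro ι κ _ e ih f
    let _ := Fintype.ofEquiv κ e.symm
    rw [← e.prod_comp (fun i => ∑' a, f i a), ← ih (fun i => f (e i)),
      ← (e.arrowCongr (Equiv.refl α)).tsum_eq]
    refine tsum_congr fun x => ?_
    rw [← e.prod_comp]
    simp
  · intro f
    simp
  · intro ι _ ih f
    rw [Fintype.prod_option, ← ih (fun i => f (some i)), ← ENNReal.tsum_mul_right,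
      ← (Equiv.piOptionEquivProd (β := fun _ : Option ι => α)).symm.tsum_eq, ENNReal.tsum_prod']
    refine tsum_congr fun a => ?_
    rw [← ENNReal.tsum_mul_left]
    refine tsum_congr fun x => ?_
    rw [Fintype.prod_option]
    rfl

variable (K : Type*) [Field K] [NumberField K]

/-- `∑ N(I)^{-s}` over the nonzero ideals `I` of `𝓞 K`. -/
noncomputable def idealZetaSum (s : ℝ) : ℝ≥0∞ :=
  ∑' I : {I : Ideal (𝓞 K) // I ≠ ⊥}, ENNReal.ofReal ((Ideal.absNorm I.1 : ℝ) ^ (-s))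

open Filter in
lemma lseriesSummable_dedekindZeta {s : ℝ} (hs : 1 < s) :
    LSeriesSummable (fun n ↦ ((Nat.card {I : Ideal (𝓞 K) // Ideal.absNorm I = n} : ℝ) : ℂ))
      (s : ℂ) := by
  refine LSeriesSummable_of_sum_norm_bigO_and_nonneg (r := 1) ?_ (fun _ => Nat.cast_nonneg _)
    zero_le_one (by simpa using hs)
  have h := (Ideal.tendsto_norm_le_div_atTop₀ K).comp tendsto_natCast_atTop_atTop
  have h2 := h.isBigO_one ℝ
  have h3 : (fun n : ℕ => ∑ k ∈ Finset.Icc 1 n,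
      (Nat.card {I : Ideal (𝓞 K) // Ideal.absNorm I = k} : ℝ)) =
      fun n : ℕ => (Nat.card {I : nonZeroDivisors (Ideal (𝓞 K)) //
        (Ideal.absNorm (I : Ideal (𝓞 K)) : ℝ) ≤ (n : ℝ)} : ℝ) := by
    ext n
    rw [← Nat.cast_sum]
    simp only [Nat.cast_le]
    congr 1
    rw [← add_left_inj 1, ← Ideal.card_norm_le_eq_card_norm_le_add_one,
      show Finset.Icc 1 n = Finset.Ioc 0 n from Finset.Icc_succ_left_eq_Ioc _ _,
      show 1 = Nat.card {I : Ideal (𝓞 K) // Ideal.absNorm I = 0} by simp [Ideal.absNorm_eq_zero_iff],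
      Finset.sum_Ioc_add_eq_sum_Icc (n.zero_le),
      ← Finset.card_preimage_eq_sum_card_image_eq (fun k _ ↦ Ideal.finite_setOfPred_absNorm_eq k)]
    simp [Set.coe_eq_subtype]
  rw [h3]
  have h4 := h2.mul (Asymptotics.isBigO_refl (fun n : ℕ => (n : ℝ)) atTop)
  refine (h4.congr' ?_ ?_)
  · filter_upwards [eventually_gt_atTop 0] with n hn
    have : (n : ℝ) ≠ 0 := by positivity
    simp [this]
  · filter_upwards with n
    simp

/-- At real `s > 1` the Dedekind zeta function is the sum over the nonzero ideals. -/
lemma idealZetaSum_eq {s : ℝ} (hs : 1 < s) :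
    idealZetaSum K s = ENNReal.ofReal (zetaReal K s) := by
  have hsum := lseriesSummable_dedekindZeta K hs
  set a : ℕ → ℝ := fun n => Nat.card {I : Ideal (𝓞 K) // Ideal.absNorm I = n} with ha
  have hterm : ∀ n, LSeries.term (fun n => ((a n : ℝ) : ℂ)) (s : ℂ) n =
      ((if n = 0 then 0 else a n * (n : ℝ) ^ (-s) : ℝ) : ℂ) := by
    intro n
    rw [LSeries.term_def]
    split_ifs with h
    · simp
    · rw [Complex.ofReal_mul, Complex.ofReal_cpow (Nat.cast_nonneg n), Complex.ofReal_neg,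
        Complex.cpow_neg, Complex.ofReal_natCast]
      rfl
  have hre : zetaReal K s = ∑' n : ℕ, (if n = 0 then 0 else a n * (n : ℝ) ^ (-s)) := by
    have h1 : dedekindZeta K (s : ℂ) =
        ((∑' n : ℕ, (if n = 0 then 0 else a n * (n : ℝ) ^ (-s)) : ℝ) : ℂ) := by
      rw [Complex.ofReal_tsum]
      unfold dedekindZeta LSeries
      exact tsum_congr fun n => by rw [← hterm]; rfl
    rw [zetaReal, h1, Complex.ofReal_re]
  have hS : Summable fun n : ℕ => (if n = 0 then 0 else a n * (n : ℝ) ^ (-s)) := by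
    have h1 : Summable fun n : ℕ =>
        ((if n = 0 then 0 else a n * (n : ℝ) ^ (-s) : ℝ) : ℂ) := by
      refine (show Summable _ from hsum).congr fun n => ?_
      exact hterm n
    exact Complex.summable_ofReal.mp h1
  have hnn : ∀ n : ℕ, 0 ≤ (if n = 0 then 0 else a n * (n : ℝ) ^ (-s)) := by
    intro n
    split_ifs
    · exact le_rfl
    · exact mul_nonneg (Nat.cast_nonneg _) (Real.rpow_nonneg (Nat.cast_nonneg _) _)
  rw [hre, ENNReal.ofReal_tsum_of_nonneg hnn hS, idealZetaSum,
    ← ENNReal.tsum_fiberwise _ (fun I : {I : Ideal (𝓞 K) // I ≠ ⊥} => Ideal.absNorm I.1)]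
  refine tsum_congr fun n => ?_
  rcases eq_or_ne n 0 with hn | hn
  · rw [if_pos hn, ENNReal.ofReal_zero, ENNReal.tsum_eq_zero]
    rintro ⟨I, hI⟩
    exact absurd (Ideal.absNorm_eq_zero_iff.mp (hI.trans hn)) I.2
  · rw [if_neg hn]
    have h1 : ∀ I : ((fun I : {I : Ideal (𝓞 K) // I ≠ ⊥} => Ideal.absNorm I.1) ⁻¹' {n}),
        ENNReal.ofReal ((Ideal.absNorm I.1.1 : ℝ) ^ (-s)) = ENNReal.ofReal ((n : ℝ) ^ (-s)) := by
      rintro ⟨I, hI⟩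
      rw [Set.mem_preimage, Set.mem_singleton_iff] at hI
      simp only [hI]
    rw [tsum_congr h1]
    have e : ((fun I : {I : Ideal (𝓞 K) // I ≠ ⊥} => Ideal.absNorm I.1) ⁻¹' {n}) ≃
        {I : Ideal (𝓞 K) // Ideal.absNorm I = n} :=
      { toFun := fun I => ⟨I.1.1, I.2⟩
        invFun := fun I => ⟨⟨I.1, fun h => hn (by rw [← I.2, h, Ideal.absNorm_bot])⟩, I.2⟩
        left_inv := fun _ => rfl
        right_inv := fun _ => rfl }
    rw [ENNReal.tsum_const, ENat.card_congr e]
    have : Finite {I : Ideal (𝓞 K) // Ideal.absNorm I = n} :=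
      Ideal.finite_setOfPred_absNorm_eq n
    rw [ENNReal.ofReal_mul (Nat.cast_nonneg _), ENat.card_eq_coe_natCard, ENNReal.ofReal_natCast]
    simp

lemma one_le_idealZetaSum (s : ℝ) : 1 ≤ idealZetaSum K s := by
  refine le_trans ?_ (ENNReal.le_tsum ⟨⊤, top_ne_bot⟩)
  simp

lemma one_le_zetaReal {s : ℝ} (hs : 1 < s) : 1 ≤ zetaReal K s := by
  have h := one_le_idealZetaSum K s
  rw [idealZetaSum_eq K hs] at h
  simpa using h

/-- The weight `N(I)^{-s}` of a nonzero ideal; the zero ideal, which stands for a zero entry of a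
matrix, has weight one. -/
noncomputable def idealWeight {K : Type*} [Field K] [NumberField K] (s : ℝ) (I : Ideal (𝓞 K)) :
    ℝ≥0∞ :=
  open scoped Classical in
  if I = ⊥ then 1 else ENNReal.ofReal ((Ideal.absNorm I : ℝ) ^ (-s))

lemma tsum_idealWeight (s : ℝ) : ∑' I : Ideal (𝓞 K), idealWeight s I = 1 + idealZetaSum K s := by
  classical
  rw [← Summable.tsum_add_tsum_compl (s := {⊥}) ENNReal.summable ENNReal.summable]
  congr 1
  · simp [idealWeight]
  · unfold idealZetaSum
    refine tsum_congr fun I => ?_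
    have : I.1 ≠ ⊥ := I.2
    simp only [idealWeight, if_neg this]

lemma rpow_neg_mul_idealWeight_le {K : Type*} [Field K] [NumberField K] {s : ℝ} (hs : 0 ≤ s)
    {G : Ideal (𝓞 K)} (hG : G ≠ ⊥) (I : Ideal (𝓞 K)) :
    ENNReal.ofReal ((Ideal.absNorm G : ℝ) ^ (-s)) * idealWeight s I ≤ idealWeight s (G * I) := by
  classical
  have hN : 1 ≤ (Ideal.absNorm G : ℝ) := by
    exact_mod_cast Nat.one_le_iff_ne_zero.mpr (mt Ideal.absNorm_eq_zero_iff.mp hG)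
  unfold idealWeight
  by_cases hI : I = ⊥
  · rw [if_pos hI, if_pos (by rw [hI, Ideal.mul_bot]), mul_one]
    exact ENNReal.ofReal_le_one.mpr (Real.rpow_le_one_of_one_le_of_nonpos hN (by linarith))
  · rw [if_neg hI, if_neg (by simp [hG, hI]), map_mul, Nat.cast_mul,
      Real.mul_rpow (Nat.cast_nonneg _) (Nat.cast_nonneg _),
      ENNReal.ofReal_mul (Real.rpow_nonneg (Nat.cast_nonneg _) _)]

/-- The tuples of ideals `(P, (A_i))` with `P ≠ 0` that generate the unit ideal. -/
abbrev CoprimeTuples (ι : Type*) : Type _ :=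
  {τ : {I : Ideal (𝓞 K) // I ≠ ⊥} × (ι → Ideal (𝓞 K)) // τ.1.1 ⊔ ⨆ i, τ.2 i = ⊤}

/-- Every tuple `(P, (A_i))` is a unique multiple of a coprime one, which bounds the sum over the
coprime tuples by a quotient of zeta values. -/
lemma idealZetaSum_mul_tsum_coprimeTuples_le {ι : Type*} [Fintype ι] {a b s : ℝ} (hb : 0 ≤ b)
    (hs : a + Fintype.card ι * b ≤ s) :
    idealZetaSum K s * ∑' τ : CoprimeTuples K ι,
        ENNReal.ofReal ((Ideal.absNorm τ.1.1.1 : ℝ) ^ (-a)) * ∏ i, idealWeight b (τ.1.2 i) ≤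
      idealZetaSum K a * (1 + idealZetaSum K b) ^ Fintype.card ι := by
  let φ : {I : Ideal (𝓞 K) // I ≠ ⊥} × (ι → Ideal (𝓞 K)) → ℝ≥0∞ := fun τ =>
    ENNReal.ofReal ((Ideal.absNorm τ.1.1 : ℝ) ^ (-a)) * ∏ i, idealWeight b (τ.2 i)
  let F : {I : Ideal (𝓞 K) // I ≠ ⊥} × CoprimeTuples K ι →
      {I : Ideal (𝓞 K) // I ≠ ⊥} × (ι → Ideal (𝓞 K)) := fun p =>
    (⟨p.1.1 * p.2.1.1.1, mul_ne_zero p.1.2 p.2.1.1.2⟩, fun i => p.1.1 * p.2.1.2 i)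
  have hF : Function.Injective F := by
    rintro ⟨⟨G, hG⟩, ⟨⟨⟨P, hP⟩, A⟩, hτ⟩⟩ ⟨⟨G', hG'⟩, ⟨⟨⟨P', hP'⟩, A'⟩, hτ'⟩⟩ h
    simp only [F, Prod.mk.injEq, Subtype.mk.injEq] at h hτ hτ'
    obtain ⟨h1, h2⟩ := h
    have hGG : G = G' := by
      have e1 : G * P ⊔ ⨆ i, G * A i = G := by
        rw [← Ideal.mul_iSup, ← Ideal.mul_sup, hτ, Ideal.mul_top]
      have e2 : G' * P' ⊔ ⨆ i, G' * A' i = G' := by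
        rw [← Ideal.mul_iSup, ← Ideal.mul_sup, hτ', Ideal.mul_top]
      rw [← e1, ← e2, h1]
      congr 1
      exact iSup_congr fun i => congrFun h2 i
    subst hGG
    have h3 : P = P' := mul_left_cancel₀ hG h1
    have h4 : A = A' := funext fun i => mul_left_cancel₀ hG (congrFun h2 i)
    subst h3 h4
    rfl
  have hle : ∀ p : {I : Ideal (𝓞 K) // I ≠ ⊥} × CoprimeTuples K ι,
      ENNReal.ofReal ((Ideal.absNorm p.1.1 : ℝ) ^ (-s)) *
        (ENNReal.ofReal ((Ideal.absNorm p.2.1.1.1 : ℝ) ^ (-a)) * ∏ i, idealWeight b (p.2.1.2 i)) ≤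
      φ (F p) := by
    rintro ⟨⟨G, hG⟩, τ⟩
    have hN : 1 ≤ (Ideal.absNorm G : ℝ) := by
      exact_mod_cast Nat.one_le_iff_ne_zero.mpr (mt Ideal.absNorm_eq_zero_iff.mp hG)
    have h1 : ENNReal.ofReal ((Ideal.absNorm G : ℝ) ^ (-s)) ≤
        ENNReal.ofReal ((Ideal.absNorm G : ℝ) ^ (-a)) *
          ∏ _i : ι, ENNReal.ofReal ((Ideal.absNorm G : ℝ) ^ (-b)) := by
      rw [Finset.prod_const, ← ENNReal.ofReal_pow (by positivity),
        ← ENNReal.ofReal_mul (by positivity), ← Real.rpow_natCast, ← Real.rpow_mul (by positivity),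
        ← Real.rpow_add (by positivity)]
      refine ENNReal.ofReal_le_ofReal (Real.rpow_le_rpow_of_exponent_le hN ?_)
      rw [Finset.card_univ]
      linarith
    refine (mul_le_mul_left h1 _).trans ?_
    simp only [φ, F]
    rw [map_mul, Nat.cast_mul, Real.mul_rpow (Nat.cast_nonneg _) (Nat.cast_nonneg _),
      ENNReal.ofReal_mul (by positivity), mul_mul_mul_comm, ← Finset.prod_mul_distrib]
    exact mul_le_mul_right (Finset.prod_le_prod' fun i _ =>
      rpow_neg_mul_idealWeight_le hb hG _) _
  calc _ = ∑' p : {I : Ideal (𝓞 K) // I ≠ ⊥} × CoprimeTuples K ι,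
      ENNReal.ofReal ((Ideal.absNorm p.1.1 : ℝ) ^ (-s)) *
        (ENNReal.ofReal ((Ideal.absNorm p.2.1.1.1 : ℝ) ^ (-a)) *
          ∏ i, idealWeight b (p.2.1.2 i)) := by
        rw [idealZetaSum, ENNReal.tsum_prod', ← ENNReal.tsum_mul_right]
        exact tsum_congr fun G => ENNReal.tsum_mul_left.symm
    _ ≤ ∑' p, φ (F p) := ENNReal.tsum_le_tsum hle
    _ ≤ ∑' τ, φ τ := ENNReal.tsum_comp_le_tsum_of_injective hF φ
    _ = _ := by
        rw [ENNReal.tsum_prod']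
        simp only [φ]
        simp_rw [ENNReal.tsum_mul_left]
        rw [ENNReal.tsum_mul_right, tsum_pi_prod_eq (fun _ : ι => idealWeight b),
          Finset.prod_const, tsum_idealWeight, Finset.card_univ]
        rfl

end Zeta

end NFMoment

/-! ### Ideals, heights and the index -/

namespace NFMoment

open NumberField Matrix
open scoped ENNReal

section Ideals

variable {K : Type*} [Field K] [NumberField K]

/-- The fractional ideal `α 𝓞 K` equals `A P⁻¹`; the equation is stated after clearing the
denominator `c` of `α`. -/
def HasIdeals (α : K) (P A : Ideal (𝓞 K)) : Prop :=
  ∃ c x : 𝓞 K, c ≠ 0 ∧ (x : K) = c * α ∧ Ideal.span {x} * P = Ideal.span {c} * A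

lemma HasIdeals.span_mul_eq {α : K} {P A : Ideal (𝓞 K)} (h : HasIdeals α P A) {c x : 𝓞 K}
    (hx : (x : K) = c * α) : Ideal.span {x} * P = Ideal.span {c} * A := by
  obtain ⟨c', x', hc', hx', h⟩ := h
  have h1 : x * c' = x' * c := by
    apply FaithfulSMul.algebraMap_injective (𝓞 K) K
    rw [map_mul, map_mul]
    change (x : K) * (c' : K) = (x' : K) * (c : K)
    rw [hx, hx']
    ring
  have h2 : Ideal.span {c'} ≠ ⊥ := by simpa using hc'
  refine mul_left_cancel₀ h2 ?_
  calc Ideal.span {c'} * (Ideal.span {x} * P) = Ideal.span {x * c'} * P := by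
        rw [← Ideal.span_singleton_mul_span_singleton]; ring
    _ = Ideal.span {c} * (Ideal.span {x'} * P) := by
        rw [h1, ← Ideal.span_singleton_mul_span_singleton]; ring
    _ = _ := by rw [h]; ring

omit [NumberField K] in
lemma HasIdeals.eq_bot_iff {α : K} {P A : Ideal (𝓞 K)} (h : HasIdeals α P A) (hP : P ≠ ⊥) :
    A = ⊥ ↔ α = 0 := by
  obtain ⟨c, x, hc, hx, h⟩ := h
  have hcK : (c : K) ≠ 0 := by exact_mod_cast hc
  constructor
  · rintro rfl
    rw [Ideal.mul_bot, Ideal.mul_eq_bot, or_iff_left hP, Ideal.span_singleton_eq_bot] at h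
    rw [h] at hx
    simpa [hcK] using hx.symm
  · rintro rfl
    have : x = 0 := by
      apply FaithfulSMul.algebraMap_injective (𝓞 K) K
      simpa using hx
    rw [this] at h
    simpa [hc] using h.symm

/-- Elements with the same fractional ideal differ by a unit. -/
lemma HasIdeals.exists_unit_mul {α β : K} {P A : Ideal (𝓞 K)} (hα : HasIdeals α P A)
    (hβ : HasIdeals β P A) (hP : P ≠ ⊥) : ∃ u : (𝓞 K)ˣ, β = (u : K) * α := by
  obtain ⟨c, hc⟩ := IsLocalization.exist_integer_multiples_of_finite
    (nonZeroDivisors (𝓞 K)) ![α, β]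
  obtain ⟨x, hx⟩ := hc 0
  obtain ⟨y, hy⟩ := hc 1
  have hc0 : (c : 𝓞 K) ≠ 0 := nonZeroDivisors.coe_ne_zero c
  have hcK : ((c : 𝓞 K) : K) ≠ 0 := by exact_mod_cast hc0
  have hx' : (x : K) = (c : 𝓞 K) * α := by simpa [Algebra.smul_def] using hx
  have hy' : (y : K) = (c : 𝓞 K) * β := by simpa [Algebra.smul_def] using hy
  have h : Ideal.span {x} = Ideal.span {y} :=
    mul_right_cancel₀ hP ((hα.span_mul_eq hx').trans (hβ.span_mul_eq hy').symm)
  rw [Ideal.span_singleton_eq_span_singleton] at h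
  obtain ⟨u, hu⟩ := h
  refine ⟨u, mul_left_cancel₀ hcK ?_⟩
  rw [← hy', ← hu]
  change (x : K) * ((u : 𝓞 K) : K) = ((c : 𝓞 K) : K) * (((u : 𝓞 K) : K) * α)
  rw [hx']
  ring

/-- The ideals of a finite family: the common denominator `P` and the numerators `A i`, which
together generate the unit ideal. -/
lemma exists_coprimeTuple {ι : Type*} [Finite ι] (α : ι → K) :
    ∃ τ : CoprimeTuples K ι, (∀ i, HasIdeals (α i) τ.1.1.1 (τ.1.2 i)) ∧
      ∀ u : 𝓞 K, (∀ i, IsIntegral ℤ ((u : K) * α i)) → u ∈ τ.1.1.1 := by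
  obtain ⟨c, hc⟩ := IsLocalization.exist_integer_multiples_of_finite
    (nonZeroDivisors (𝓞 K)) α
  choose x hx using hc
  have hc0 : (c : 𝓞 K) ≠ 0 := nonZeroDivisors.coe_ne_zero c
  have hcK : ((c : 𝓞 K) : K) ≠ 0 := by exact_mod_cast hc0
  have hx' : ∀ i, (x i : K) = (c : 𝓞 K) * α i := fun i => by
    simpa [Algebra.smul_def] using hx i
  set S : Ideal (𝓞 K) := Ideal.span {(c : 𝓞 K)} ⊔ ⨆ i, Ideal.span {x i} with hS
  have hS0 : S ≠ ⊥ := by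
    intro h
    have : Ideal.span {(c : 𝓞 K)} ≤ ⊥ := h ▸ le_sup_left
    exact hc0 (by rwa [le_bot_iff, Ideal.span_singleton_eq_bot] at this)
  obtain ⟨P, hP⟩ : S ∣ Ideal.span {(c : 𝓞 K)} := Ideal.dvd_iff_le.mpr le_sup_left
  have hA : ∀ i, S ∣ Ideal.span {x i} := fun i =>
    Ideal.dvd_iff_le.mpr ((le_iSup (fun i => Ideal.span {x i}) i).trans le_sup_right)
  choose A hA using hA
  have hP0 : P ≠ ⊥ := by
    rintro rfl
    rw [Ideal.mul_bot, Ideal.span_singleton_eq_bot] at hP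
    exact hc0 hP
  refine ⟨⟨⟨⟨P, hP0⟩, A⟩, ?_⟩, fun i => ⟨c, x i, hc0, hx' i, ?_⟩, fun u hu => ?_⟩
  · refine mul_left_cancel₀ hS0 ?_
    rw [Ideal.mul_sup, Ideal.mul_iSup, ← hP, Ideal.mul_top]
    simp_rw [← hA]
    exact hS.symm
  · change Ideal.span {x i} * P = Ideal.span {(c : 𝓞 K)} * A i
    rw [hA i, hP]
    ring
  · have h1 : Ideal.span {u} * S ≤ Ideal.span {(c : 𝓞 K)} := by
      rw [hS, Ideal.mul_sup, Ideal.mul_iSup, sup_le_iff, iSup_le_iff]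
      refine ⟨Ideal.mul_le_right, fun i => ?_⟩
      rw [Ideal.span_singleton_mul_span_singleton, Ideal.span_singleton_le_span_singleton]
      refine ⟨⟨_, hu i⟩, ?_⟩
      apply FaithfulSMul.algebraMap_injective (𝓞 K) K
      change (u : K) * (x i : K) = ((c : 𝓞 K) : K) * ((u : K) * α i)
      rw [hx']
      ring
    rw [hP, mul_comm S, ← Ideal.dvd_iff_le, mul_dvd_mul_iff_right hS0, Ideal.dvd_iff_le,
      Ideal.span_singleton_le_iff_mem] at h1
    exact h1

end Ideals

section Height

variable {K : Type*} [Field K] [NumberField K]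

open Real in
/-- The height of `α` with its finite part replaced by the norm of a denominator ideal `P`. -/
noncomputable def idealHeight (P : Ideal (𝓞 K)) (α : K) : ℝ :=
  (log (Ideal.absNorm P) + ∑ v : InfinitePlace K, v.mult * log⁺ (v α)) / Module.finrank ℚ K

lemma one_le_absNorm {P : Ideal (𝓞 K)} (hP : P ≠ ⊥) : 1 ≤ (Ideal.absNorm P : ℝ) := by
  exact_mod_cast Nat.one_le_iff_ne_zero.mpr (mt Ideal.absNorm_eq_zero_iff.mp hP)

/-- The finite part of the height is `N(c) / N((x, c))` for `α = x / c`, and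
`N((x, c)) N(P) = N(c) N(A + P)`. There is equality when `A` and `P` are coprime. -/
lemma weilHeight_le_idealHeight {α : K} {P A : Ideal (𝓞 K)} (h : HasIdeals α P A) (hP : P ≠ ⊥) :
    weilHeight α ≤ idealHeight P α := by
  obtain ⟨c, x, hc, hx, h⟩ := h
  have hcK : (c : K) ≠ 0 := by exact_mod_cast hc
  unfold weilHeight idealHeight
  refine div_le_div_of_nonneg_right ?_ (Nat.cast_nonneg _)
  have hP1 := one_le_absNorm hP
  have hprod : 0 < ∏ v : InfinitePlace K, max (v α) 1 ^ v.mult :=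
    Finset.prod_pos fun v _ => pow_pos (lt_of_lt_of_le one_pos (le_max_right _ _)) _
  have hfin : ∏ᶠ v : FinitePlace K, max (v α) 1 ≤ Ideal.absNorm P := by
    have hne : (![x, c] : Fin 2 → 𝓞 K) ≠ 0 := by
      intro h0
      exact hc (congrFun h0 1)
    have hneK : (![(x : K), (c : K)] : Fin 2 → K) ≠ 0 := by
      intro h0
      exact hcK (congrFun h0 1)
    have e1 := Height.mulHeight₁_div_eq_mulHeight (x : K) (c : K)
    rw [show (x : K) / c = α by rw [hx]; field_simp, NumberField.mulHeight₁_eq,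
      NumberField.mulHeight_eq hneK] at e1
    have e2 := NumberField.absNorm_mul_finprod_finitePlace_eq_one hne
    have e3 : (fun v : FinitePlace K => ⨆ i, v ((![x, c] : Fin 2 → 𝓞 K) i : K)) =
        fun v : FinitePlace K => ⨆ i, v ((![(x : K), (c : K)] : Fin 2 → K) i) := by
      ext v
      congr 1
      ext i
      fin_cases i <;> rfl
    rw [e3] at e2
    set F := ∏ᶠ v : FinitePlace K, ⨆ i, v ((![(x : K), (c : K)] : Fin 2 → K) i)
    have e4 : ∏ v : InfinitePlace K, (⨆ i, v ((![(x : K), (c : K)] : Fin 2 → K) i)) ^ v.mult =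
        |Algebra.norm ℚ (c : K)| * ∏ v : InfinitePlace K, max (v α) 1 ^ v.mult := by
      rw [← InfinitePlace.prod_eq_abs_norm, ← Finset.prod_mul_distrib]
      refine Finset.prod_congr rfl fun v _ => ?_
      rw [← mul_pow, mul_max_of_nonneg _ _ (apply_nonneg v _), mul_one, ← map_mul, ← hx]
      congr 1
      refine le_antisymm (ciSup_le fun i => ?_) (max_le ?_ ?_)
      · fin_cases i
        · exact le_max_left _ _
        · exact le_max_right _ _
      · exact le_ciSup (f := fun i => v ((![(x : K), (c : K)] : Fin 2 → K) i))
          (Set.finite_range _).bddAbove 0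
      · exact le_ciSup (f := fun i => v ((![(x : K), (c : K)] : Fin 2 → K) i))
          (Set.finite_range _).bddAbove 1
    rw [e4, mul_comm (Rat.cast _ : ℝ), mul_assoc] at e1
    have e5 := mul_left_cancel₀ hprod.ne' e1
    have e6 : ((|Algebra.norm ℚ (c : K)| : ℚ) : ℝ) = Ideal.absNorm (Ideal.span {c}) := by
      rw [Ideal.absNorm_span_singleton, ← Algebra.coe_norm_int]
      simp
    have e7 : (Ideal.absNorm (Ideal.span (Set.range ![x, c])) : ℝ) * Ideal.absNorm P =
        Ideal.absNorm (Ideal.span {c}) * Ideal.absNorm (A ⊔ P) := by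
      have : Ideal.span (Set.range ![x, c]) * P = Ideal.span {c} * (A ⊔ P) := by
        rw [Matrix.range_cons, Matrix.range_cons, Matrix.range_empty, Set.union_empty,
          Ideal.span_union, Ideal.sup_mul, h, Ideal.mul_sup]
      rw [← Nat.cast_mul, ← Nat.cast_mul, ← map_mul, ← map_mul, this]
    have e8 : (1 : ℝ) ≤ Ideal.absNorm (A ⊔ P) := one_le_absNorm fun h0 =>
      hP (le_bot_iff.mp (h0 ▸ le_sup_right))
    rw [e5, e6]
    have hF : 0 ≤ F := by
      by_contra hF
      have := mul_nonpos_of_nonneg_of_nonpos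
        (Nat.cast_nonneg (α := ℝ) (Ideal.absNorm (Ideal.span (Set.range ![x, c])))) (not_le.mp hF).le
      linarith
    calc (Ideal.absNorm (Ideal.span {c}) : ℝ) * F
        ≤ Ideal.absNorm (Ideal.span {c}) * Ideal.absNorm (A ⊔ P) * F := by
          gcongr
          exact le_mul_of_one_le_right (Nat.cast_nonneg _) e8
      _ = Ideal.absNorm P * (Ideal.absNorm (Ideal.span (Set.range ![x, c])) * F) := by
          rw [← e7]; ring
      _ = Ideal.absNorm P := by rw [e2, mul_one]
  rw [Height.logHeight₁_eq_log_mulHeight₁, NumberField.mulHeight₁_eq]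
  have hlog : ∑ v : InfinitePlace K, (v.mult : ℝ) * Real.posLog (v α) =
      Real.log (∏ v : InfinitePlace K, max (v α) 1 ^ v.mult) := by
    rw [Real.log_prod fun v _ => (pow_pos (lt_of_lt_of_le one_pos (le_max_right _ _)) _).ne']
    refine Finset.sum_congr rfl fun v _ => ?_
    rw [Real.log_pow, Real.posLog_eq_log_max_one (apply_nonneg v _), max_comm]
  have hfin0 : 0 < ∏ᶠ v : FinitePlace K, max (v α) 1 :=
    lt_of_lt_of_le one_pos (one_le_finprod fun v => le_max_right _ _)
  rw [hlog, Real.log_mul hprod.ne' hfin0.ne', add_comm]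
  gcongr

lemma hasIdeals_top (x : 𝓞 K) : HasIdeals (x : K) ⊤ (Ideal.span {x}) :=
  ⟨1, x, one_ne_zero, by simp, by simp⟩

lemma weilHeight_integer_le (x : 𝓞 K) :
    weilHeight (x : K) ≤
      (∑ v : InfinitePlace K, v.mult * Real.posLog (v (x : K))) / Module.finrank ℚ K := by
  simpa [idealHeight] using weilHeight_le_idealHeight (hasIdeals_top x) top_ne_bot

lemma not_isOfFinOrder_two {R : Type*} [Ring R] [CharZero R] : ¬ IsOfFinOrder (2 : R) := by
  rw [isOfFinOrder_iff_pow_eq_one]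
  rintro ⟨n, hn, h⟩
  have h1 : (2 : ℕ) ^ n = 1 := by exact_mod_cast h
  exact absurd h1 (Nat.one_lt_two_pow hn.ne').ne'

/-- The bound on `c₀` that makes the numerical estimates work: it is tested at the integer `2`. -/
lemma HeightBounds.lt_log_two {c₀ c₁ : ℝ} (h : HeightBounds K c₀ c₁) : c₀ < Real.log 2 := by
  refine (h.2 2 two_ne_zero not_isOfFinOrder_two).trans_le ((weilHeight_integer_le 2).trans ?_)
  have hd : (0 : ℝ) < Module.finrank ℚ K := Nat.cast_pos.mpr Module.finrank_pos
  have h1 : ∀ v : InfinitePlace K, v (((2 : 𝓞 K) : K)) = 2 := fun v => by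
    change v ((2 : K)) = 2
    have := InfinitePlace.norm_embedding_eq v (2 : K)
    rw [← this]
    rw [map_ofNat]
    norm_num
  simp only [h1]
  rw [← Finset.sum_mul, ← Nat.cast_sum, InfinitePlace.sum_mult_eq,
    Real.posLog_eq_log (by norm_num), mul_div_cancel_left₀ _ hd.ne']

/-- The product formula in terms of the ideals of `α`. -/
lemma HasIdeals.sum_mult_mul_log {α : K} {P A : Ideal (𝓞 K)} (h : HasIdeals α P A) (hP : P ≠ ⊥)
    (hα : α ≠ 0) : ∑ v : InfinitePlace K, (v.mult : ℝ) * Real.log (v α) =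
      Real.log (Ideal.absNorm A) - Real.log (Ideal.absNorm P) := by
  have hA : A ≠ ⊥ := fun h0 => hα ((h.eq_bot_iff hP).mp h0)
  obtain ⟨c, x, hc, hx, h⟩ := h
  have hcK : (c : K) ≠ 0 := by exact_mod_cast hc
  have hP1 := one_le_absNorm hP
  have hA1 := one_le_absNorm hA
  have hN : ∀ y : 𝓞 K, ((|Algebra.norm ℚ (y : K)| : ℚ) : ℝ) = Ideal.absNorm (Ideal.span {y}) := by
    intro y
    rw [Ideal.absNorm_span_singleton, ← Algebra.coe_norm_int]
    simp
  have h1 : (∏ v : InfinitePlace K, v α ^ v.mult) * Ideal.absNorm P = Ideal.absNorm A := by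
    rw [InfinitePlace.prod_eq_abs_norm]
    have h2 : (0 : ℝ) < Ideal.absNorm (Ideal.span {c}) :=
      lt_of_lt_of_le one_pos (one_le_absNorm (by simpa using hc))
    refine mul_left_cancel₀ h2.ne' ?_
    rw [← mul_assoc, ← hN c, ← Rat.cast_mul, ← abs_mul, ← map_mul, ← hx, hN, hN,
      ← Nat.cast_mul, ← Nat.cast_mul, ← map_mul, ← map_mul, h]
  rw [← h1, Real.log_mul _ (by positivity), add_sub_cancel_right, Real.log_prod]
  · exact Finset.sum_congr rfl fun v _ => (Real.log_pow _ _).symm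
  · exact fun v _ => pow_ne_zero _ ((map_ne_zero v).mpr hα)
  · exact Finset.prod_ne_zero_iff.mpr fun v _ => pow_ne_zero _ ((map_ne_zero v).mpr hα)

end Height

section Index

/-- By induction on the number of elements: a cyclic submodule `R x` has as many elements as
`R / Ann x`, and `Ann x * Ann (M / R x)` annihilates `M`. -/
lemma absNorm_annihilator_dvd_card {R : Type*} [CommRing R] [IsDedekindDomain R] [Module.Free ℤ R]
    (n : ℕ) :
    ∀ (M : Type*) [AddCommGroup M] [Module R M] [Finite M], Nat.card M ≤ n →
      Ideal.absNorm (Module.annihilator R M) ∣ Nat.card M := by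
  induction n with
  | zero => exact fun M _ _ _ h => absurd Nat.card_pos h.not_gt
  | succ n ih =>
    intro M _ _ _ hM
    rcases subsingleton_or_nontrivial M with hs | hs
    · rw [Module.annihilator_eq_top_iff.mpr hs]
      simp
    obtain ⟨x, hx⟩ := exists_ne (0 : M)
    set S := Submodule.span R {x} with hS
    have : Finite (M ⧸ S) := Finite.of_surjective S.mkQ S.mkQ_surjective
    have hcard : Nat.card M = Nat.card S * Nat.card (M ⧸ S) := S.card_eq_card_quotient_mul_card
    have hS1 : 1 < Nat.card S := by
      have : Nontrivial S := Submodule.nontrivial_span_singleton hx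
      exact Finite.one_lt_card
    have hQ : 0 < Nat.card (M ⧸ S) := Nat.card_pos
    have hlt : Nat.card (M ⧸ S) ≤ n := by nlinarith
    have h1 : Ideal.absNorm (Ideal.torsionOf R M x) = Nat.card S := by
      rw [Ideal.absNorm_apply, Submodule.cardQuot_apply]
      exact Nat.card_congr (Ideal.quotTorsionOfEquivSpanSingleton R M x).toEquiv
    have h2 : Ideal.torsionOf R M x * Module.annihilator R (M ⧸ S) ≤ Module.annihilator R M := by
      rw [Ideal.mul_le]
      intro a ha b hb
      rw [Module.mem_annihilator] at hb ⊢
      intro y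
      have hy := hb (Submodule.Quotient.mk y)
      rw [← Submodule.Quotient.mk_smul, Submodule.Quotient.mk_eq_zero, hS,
        Submodule.mem_span_singleton] at hy
      obtain ⟨r, hr⟩ := hy
      rw [mul_smul, ← hr, smul_comm, (Ideal.mem_torsionOf_iff x a).mp ha, smul_zero]
    rw [hcard, ← h1]
    refine (Ideal.absNorm_dvd_absNorm_of_le h2).trans ?_
    rw [map_mul]
    exact mul_dvd_mul_left _ (ih (M ⧸ S) hlt)

variable {K : Type*} [Field K] [NumberField K] {m n : ℕ}

/-- `integralRows D` as an `𝓞 K`-submodule. -/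
def integralRowsSubmodule (D : Matrix (Fin m) (Fin n) K) : Submodule (𝓞 K) (Fin m → 𝓞 K) :=
  { integralRows D with
    smul_mem' := by
      intro a C hC j
      have h : (fun i => (((a • C) i : 𝓞 K) : K)) = (a : K) • fun i => ((C i : 𝓞 K) : K) := by
        ext i
        rfl
      rw [h, Matrix.smul_vecMul]
      exact a.2.mul (hC j) }

lemma mem_integralRowsSubmodule_single {D : Matrix (Fin m) (Fin n) K} {i : Fin m} {u : 𝓞 K} :
    Pi.single i u ∈ integralRowsSubmodule D ↔ ∀ j, IsIntegral ℤ ((u : K) * D i j) := by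
  have h : (fun k => (((Pi.single i u : Fin m → 𝓞 K) k : 𝓞 K) : K)) = Pi.single i (u : K) := by
    ext k
    by_cases hk : k = i
    · subst hk; simp
    · simp [hk]
  change (∀ j, IsIntegral ℤ (((fun k => (((Pi.single i u : Fin m → 𝓞 K) k : 𝓞 K) : K)) ᵥ* D) j)) ↔ _
  rw [h]
  simp [Matrix.single_vecMul]

lemma addSubgroup_index_ne_zero_of_zsmul_mem {G : Type*} [AddCommGroup G] [Module.Finite ℤ G]
    (L : AddSubgroup G) {c : ℤ} (hc : c ≠ 0) (h : ∀ x, c • x ∈ L) : L.index ≠ 0 := by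
  have htor : Module.IsTorsion ℤ (G ⧸ L) := by
    intro x
    refine ⟨⟨c, mem_nonZeroDivisors_of_ne_zero hc⟩, ?_⟩
    obtain ⟨y, rfl⟩ := QuotientAddGroup.mk_surjective x
    change c • (y : G ⧸ L) = 0
    rw [← QuotientAddGroup.mk_zsmul, QuotientAddGroup.eq_zero_iff]
    exact h y
  have : Module.Finite ℤ (G ⧸ L) :=
    Module.Finite.of_surjective (QuotientAddGroup.mk' L).toIntLinearMap
      (QuotientAddGroup.mk'_surjective L)
  have : Finite (G ⧸ L) := Module.finite_of_fg_torsion _ htor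
  exact Nat.card_pos.ne'

lemma denominatorIndex_ne_zero (D : Matrix (Fin m) (Fin n) K) : denominatorIndex D ≠ 0 := by
  classical
  obtain ⟨c, hc, h⟩ := exists_integral_multiples ℤ ℚ
    (Finset.univ.image fun p : Fin m × Fin n => D p.1 p.2)
  refine addSubgroup_index_ne_zero_of_zsmul_mem _ hc fun C j => ?_
  have h3 : ((fun i => (((c • C) i : 𝓞 K) : K)) ᵥ* D) j = ∑ i, (C i : K) * (c • D i j) := by
    change ∑ i, (((c • C) i : 𝓞 K) : K) * D i j = _
    refine Finset.sum_congr rfl fun i _ => ?_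
    rw [mul_smul_comm, ← smul_mul_assoc]
    rfl
  rw [h3]
  exact IsIntegral.sum _ fun i _ => (RingOfIntegers.isIntegral_coe (C i)).mul
    (h (D i j) (Finset.mem_image.mpr ⟨(i, j), Finset.mem_univ _, rfl⟩))

lemma denominatorIndex_eq_card (D : Matrix (Fin m) (Fin n) K) :
    denominatorIndex D = Nat.card ((Fin m → 𝓞 K) ⧸ integralRowsSubmodule D) := rfl

/-- The ideal that annihilates `(𝓞 K)^m / integralRows D` consists of common denominators of the
entries. -/
lemma absNorm_le_denominatorIndex (D : Matrix (Fin m) (Fin n) K) {P : Ideal (𝓞 K)}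
    (hP : ∀ u : 𝓞 K, (∀ i j, IsIntegral ℤ ((u : K) * D i j)) → u ∈ P) :
    Ideal.absNorm P ≤ denominatorIndex D := by
  have : Finite ((Fin m → 𝓞 K) ⧸ integralRowsSubmodule D) :=
    Nat.finite_of_card_ne_zero (denominatorIndex_ne_zero D)
  refine Nat.le_of_dvd (Nat.pos_of_ne_zero (denominatorIndex_ne_zero D)) ?_
  rw [denominatorIndex_eq_card]
  refine (Ideal.absNorm_dvd_absNorm_of_le fun u hu => hP u fun i => ?_).trans
    (absNorm_annihilator_dvd_card (R := 𝓞 K) _ _ le_rfl)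
  rw [← mem_integralRowsSubmodule_single]
  have h := Module.mem_annihilator.mp hu (Submodule.Quotient.mk (Pi.single i 1))
  rw [← Submodule.Quotient.mk_smul, Submodule.Quotient.mk_eq_zero, ← Pi.single_smul', smul_eq_mul,
    mul_one] at h
  exact h

end Index


end NFMoment

/-! ### Counting elements of bounded height -/

namespace NFMoment

open NumberField MeasureTheory
open scoped ENNReal

section Packing

/-- Disjoint balls of radius `δ / 2` around the points fit into the ball of radius `R + δ / 2`. -/
lemma card_le_of_separated_of_norm_le {E : Type*} [NormedAddCommGroup E] [NormedSpace ℝ E]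
    [FiniteDimensional ℝ E] (S : Finset E) {R δ : ℝ} (hR : 0 ≤ R) (hδ : 0 < δ)
    (hS : ∀ x ∈ S, ‖x‖ ≤ R) (hsep : ∀ x ∈ S, ∀ y ∈ S, x ≠ y → δ ≤ ‖x - y‖) :
    (S.card : ℝ) ≤ (1 + 2 * R / δ) ^ Module.finrank ℝ E := by
  borelize E
  let μ : Measure E := Measure.addHaar
  have hδ2 : 0 < δ / 2 := by positivity
  have hdisj : Set.Pairwise (S : Set E) (Function.onFun Disjoint fun c => Metric.ball c (δ / 2)) := by
    intro x hx y hy hxy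
    refine Metric.ball_disjoint_ball ?_
    rw [dist_eq_norm, add_halves]
    exact hsep x hx y hy hxy
  have hsub : (⋃ c ∈ S, Metric.ball c (δ / 2)) ⊆ Metric.ball (0 : E) (R + δ / 2) := by
    refine Set.iUnion₂_subset fun x hx => Metric.ball_subset_ball' ?_
    rw [dist_zero_right]
    linarith [hS x hx]
  have h1 : (S.card : ℝ≥0∞) * ENNReal.ofReal ((δ / 2) ^ Module.finrank ℝ E) * μ (Metric.ball 0 1) ≤
      ENNReal.ofReal ((R + δ / 2) ^ Module.finrank ℝ E) * μ (Metric.ball 0 1) := by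
    calc _ = μ (⋃ c ∈ S, Metric.ball c (δ / 2)) := by
          rw [measure_biUnion_finset hdisj fun c _ => Metric.isOpen_ball.measurableSet]
          simp only [μ.addHaar_ball_of_pos _ hδ2, Finset.sum_const, nsmul_eq_mul, mul_assoc]
      _ ≤ μ (Metric.ball (0 : E) (R + δ / 2)) := measure_mono hsub
      _ = _ := by rw [μ.addHaar_ball_of_pos _ (by positivity)]
  have h2 : (S.card : ℝ≥0∞) * ENNReal.ofReal ((δ / 2) ^ Module.finrank ℝ E) ≤
      ENNReal.ofReal ((R + δ / 2) ^ Module.finrank ℝ E) :=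
    (ENNReal.mul_le_mul_iff_left (Metric.measure_ball_pos _ _ zero_lt_one).ne'
      measure_ball_lt_top.ne).mp h1
  rw [← ENNReal.ofReal_natCast, ← ENNReal.ofReal_mul (Nat.cast_nonneg _),
    ENNReal.ofReal_le_ofReal_iff (by positivity)] at h2
  rw [show 1 + 2 * R / δ = (R + δ / 2) / (δ / 2) by field_simp; ring, div_pow,
    le_div_iff₀ (by positivity)]
  exact h2

end Packing

section Counting

variable {K : Type*} [Field K] [NumberField K]

variable (K) in
/-- The hyperplane of the vectors with coordinate sum zero, in the space of all vectors indexed by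
the infinite places with the `ℓ¹` norm. -/
def sumZero : Submodule ℝ (PiLp 1 fun _ : InfinitePlace K => ℝ) where
  carrier := {x | ∑ w, x w = 0}
  zero_mem' := by simp
  add_mem' := by
    intro x y hx hy
    simp only [Set.mem_ofPred_eq, PiLp.add_apply, Finset.sum_add_distrib] at *
    rw [hx, hy, add_zero]
  smul_mem' := by
    intro c x hx
    simp only [Set.mem_ofPred_eq, PiLp.smul_apply, smul_eq_mul, ← Finset.mul_sum] at *
    rw [hx, mul_zero]

lemma finrank_sumZero : Module.finrank ℝ (sumZero K) = Units.rank K := by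
  classical
  let φ : (PiLp 1 fun _ : InfinitePlace K => ℝ) →ₗ[ℝ] ℝ :=
    { toFun := fun x => ∑ w, x w
      map_add' := fun x y => by simp [Finset.sum_add_distrib]
      map_smul' := fun c x => by simp [Finset.mul_sum] }
  have hker : LinearMap.ker φ = sumZero K := by
    ext x
    rfl
  have hsurj : LinearMap.range φ = ⊤ := by
    rw [LinearMap.range_eq_top]
    intro y
    obtain ⟨w₀⟩ := (inferInstance : Nonempty (InfinitePlace K))
    refine ⟨WithLp.toLp 1 (Pi.single w₀ y), ?_⟩
    change ∑ w, (Pi.single w₀ y : InfinitePlace K → ℝ) w = y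
    simp
  have h := φ.finrank_range_add_finrank_ker
  rw [hker, hsurj, finrank_top, Module.finrank_self] at h
  have h2 : Module.finrank ℝ (PiLp 1 fun _ : InfinitePlace K => ℝ) =
      Fintype.card (InfinitePlace K) := by
    rw [LinearEquiv.finrank_eq (WithLp.linearEquiv 1 ℝ (InfinitePlace K → ℝ)),
      Module.finrank_fintype_fun_eq_card]
  rw [h2] at h
  rw [Units.rank]
  omega

lemma norm_sumZero_eq (x : sumZero K) : ‖x‖ = 2 * ∑ w, max (x.1 w) 0 := by
  have h1 : ‖x‖ = ∑ w, |x.1 w| := by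
    rw [Submodule.coe_norm, PiLp.norm_eq_of_nat 1 (by simp)]
    simp
  have h2 : ∑ w, x.1 w = 0 := x.2
  have h3 : ∀ w, |x.1 w| = 2 * max (x.1 w) 0 - x.1 w := fun w => by
    rcases le_total 0 (x.1 w) with h | h
    · rw [abs_of_nonneg h, max_eq_left h]; ring
    · rw [abs_of_nonpos h, max_eq_right h]; ring
  rw [h1, Finset.sum_congr rfl fun w _ => h3 w, Finset.sum_sub_distrib, h2, sub_zero,
    Finset.mul_sum]

/-- The logarithmic embedding of `α ≠ 0`, shifted into the hyperplane `sumZero K`. -/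
noncomputable def shiftedLog (α : K) : PiLp 1 fun _ : InfinitePlace K => ℝ :=
  WithLp.toLp 1 fun w => (w.mult : ℝ) * (Real.log (w α) -
    (∑ v : InfinitePlace K, (v.mult : ℝ) * Real.log (v α)) / Module.finrank ℚ K)

lemma shiftedLog_mem (α : K) : shiftedLog α ∈ sumZero K := by
  have hd : (0 : ℝ) < Module.finrank ℚ K := Nat.cast_pos.mpr Module.finrank_pos
  change ∑ w : InfinitePlace K, (w.mult : ℝ) * (Real.log (w α) -
    (∑ v : InfinitePlace K, (v.mult : ℝ) * Real.log (v α)) / Module.finrank ℚ K) = 0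
  simp only [mul_sub, Finset.sum_sub_distrib]
  rw [← Finset.sum_mul, ← Nat.cast_sum, InfinitePlace.sum_mult_eq, mul_div_cancel₀ _ hd.ne',
    sub_self]

lemma shiftedLog_unit_mul_sub (u : (𝓞 K)ˣ) {α : K} (hα : α ≠ 0) (w : InfinitePlace K) :
    (shiftedLog ((u : K) * α) - shiftedLog α) w = (w.mult : ℝ) * Real.log (w (u : K)) := by
  have hu : (u : K) ≠ 0 := Units.coe_ne_zero u
  have h0 : ∀ v : InfinitePlace K, Real.log (v ((u : K) * α)) = Real.log (v (u : K)) +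
      Real.log (v α) := fun v => by
    rw [map_mul, Real.log_mul ((map_ne_zero v).mpr hu) ((map_ne_zero v).mpr hα)]
  rw [PiLp.sub_apply]
  change (w.mult : ℝ) * _ - (w.mult : ℝ) * _ = _
  simp only [h0, mul_add, Finset.sum_add_distrib]
  rw [Units.sum_mult_mul_log, zero_add]
  ring

lemma norm_shiftedLog_le {α : K} (hα : α ≠ 0) {P A : Ideal (𝓞 K)} (h : HasIdeals α P A)
    (hP : P ≠ ⊥) : ‖(⟨shiftedLog α, shiftedLog_mem α⟩ : sumZero K)‖ ≤
      2 * (Module.finrank ℚ K * idealHeight P α) := by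
  have hd : (0 : ℝ) < Module.finrank ℚ K := Nat.cast_pos.mpr Module.finrank_pos
  have hA : A ≠ ⊥ := fun h0 => hα ((h.eq_bot_iff hP).mp h0)
  rw [norm_sumZero_eq, idealHeight, mul_div_cancel₀ _ hd.ne']
  refine mul_le_mul_of_nonneg_left ?_ zero_le_two
  have hs := h.sum_mult_mul_log hP hα
  have hPl := Real.log_nonneg (one_le_absNorm hP)
  have hAl := Real.log_nonneg (one_le_absNorm hA)
  have h1 : ∀ w : InfinitePlace K, max (shiftedLog α w) 0 ≤
      (w.mult : ℝ) * (Real.posLog (w α) + Real.log (Ideal.absNorm P) / Module.finrank ℚ K) := by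
    intro w
    have h2 : 0 ≤ Real.log (Ideal.absNorm P) / Module.finrank ℚ K := by positivity
    have h3 : 0 ≤ Real.posLog (w α) := Real.posLog_nonneg
    refine max_le ?_ (by positivity)
    change (w.mult : ℝ) * _ ≤ _
    refine mul_le_mul_of_nonneg_left ?_ (Nat.cast_nonneg _)
    rw [hs, sub_div]
    have h4 : Real.log (w α) ≤ Real.posLog (w α) := le_max_right _ _
    have h5 : 0 ≤ Real.log (Ideal.absNorm A) / Module.finrank ℚ K := by positivity
    linarith
  refine (Finset.sum_le_sum fun w _ => h1 w).trans ?_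
  simp only [mul_add, Finset.sum_add_distrib]
  rw [← Finset.sum_mul, ← Nat.cast_sum, InfinitePlace.sum_mult_eq, mul_div_cancel₀ _ hd.ne',
    add_comm]

/-- Elements with the same fractional ideal differ by units, so their logarithms differ by points of
the unit lattice, whose nonzero points have `ℓ¹` norm more than `2 d c₀`. -/
lemma card_le_of_idealHeight_le {c₀ Y : ℝ} (hc₀ : 0 < c₀) (hY : 0 ≤ Y)
    (hK : ∀ α : 𝓞 K, α ≠ 0 → ¬ IsOfFinOrder α → c₀ < weilHeight (α : K)) {P A : Ideal (𝓞 K)}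
    (hP : P ≠ ⊥) (hA : A ≠ ⊥) (T : Finset K)
    (hT : ∀ α ∈ T, HasIdeals α P A ∧ idealHeight P α ≤ Y) :
    (T.card : ℝ) ≤ Units.torsionOrder K * (1 + 2 * Y / c₀) ^ Units.rank K := by
  classical
  have := Fintype.ofFinite (Units.torsion K)
  have hd : (0 : ℝ) < Module.finrank ℚ K := Nat.cast_pos.mpr Module.finrank_pos
  have hT0 : ∀ α ∈ T, α ≠ 0 := fun α hα h0 => hA (((hT α hα).1.eq_bot_iff hP).mpr h0)
  let f : K → sumZero K := fun α => ⟨shiftedLog α, shiftedLog_mem α⟩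
  have hsep : ∀ α ∈ T, ∀ u : (𝓞 K)ˣ, u ∉ Units.torsion K →
      2 * (Module.finrank ℚ K * c₀) ≤ ‖f ((u : K) * α) - f α‖ := by
    intro α hα u hu
    have hu' : ¬ IsOfFinOrder (u : 𝓞 K) := by
      rwa [Units.isOfFinOrder_val]
    have h1 := (hK u u.ne_zero hu').le.trans (weilHeight_integer_le (u : 𝓞 K))
    rw [le_div_iff₀ hd] at h1
    rw [norm_sumZero_eq]
    refine mul_le_mul_of_nonneg_left ?_ zero_le_two
    rw [mul_comm]
    refine h1.trans (Finset.sum_le_sum fun w _ => ?_)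
    have h2 : (f ((u : K) * α) - f α).1 w = (w.mult : ℝ) * Real.log (w (u : K)) :=
      shiftedLog_unit_mul_sub u (hT0 α hα) w
    rw [h2, Real.posLog_apply, max_comm, mul_max_of_nonneg _ _ (Nat.cast_nonneg _), mul_zero]
  have himg : ((T.image f).card : ℝ) ≤ (1 + 2 * Y / c₀) ^ Units.rank K := by
    have h := card_le_of_separated_of_norm_le (T.image f) (R := 2 * (Module.finrank ℚ K * Y))
      (δ := 2 * (Module.finrank ℚ K * c₀)) (by positivity) (by positivity) ?_ ?_
    · rw [finrank_sumZero] at h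
      refine h.trans_eq ?_
      congr 2
      field_simp
    · intro x hx
      obtain ⟨α, hα, rfl⟩ := Finset.mem_image.mp hx
      refine (norm_shiftedLog_le (hT0 α hα) (hT α hα).1 hP).trans ?_
      gcongr
      exact (hT α hα).2
    · intro x hx y hy hxy
      obtain ⟨α, hα, rfl⟩ := Finset.mem_image.mp hx
      obtain ⟨β, hβ, rfl⟩ := Finset.mem_image.mp hy
      obtain ⟨u, rfl⟩ := (hT β hβ).1.exists_unit_mul (hT α hα).1 hP
      refine hsep β hβ u fun hu => hxy ?_
      refine Subtype.ext (sub_eq_zero.mp ?_)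
      ext w
      refine (shiftedLog_unit_mul_sub u (hT0 β hβ) w).trans ?_
      rw [(Units.mem_torsion K).mp hu w, Real.log_one, mul_zero]
      rfl
  have hfib : ∀ y ∈ T.image f, (T.filter fun α => f α = y).card ≤ Units.torsionOrder K := by
    intro y hy
    obtain ⟨β, hβ, rfl⟩ := Finset.mem_image.mp hy
    let g : Units.torsion K → K := fun u => ((u : (𝓞 K)ˣ) : K) * β
    have hsub : (T.filter fun α => f α = f β) ⊆ Finset.univ.image g := by
      intro α hα
      obtain ⟨hα, hαβ⟩ := Finset.mem_filter.mp hα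
      obtain ⟨u, rfl⟩ := (hT β hβ).1.exists_unit_mul (hT α hα).1 hP
      have hu : u ∈ Units.torsion K := by
        by_contra hu
        have := hsep β hβ u hu
        rw [hαβ, sub_self, norm_zero] at this
        have h2 : 0 < 2 * (Module.finrank ℚ K * c₀) := by positivity
        linarith
      exact Finset.mem_image.mpr ⟨⟨u, hu⟩, Finset.mem_univ _, rfl⟩
    refine (Finset.card_le_card hsub).trans (Finset.card_image_le.trans_eq ?_)
    rw [Finset.card_univ, Units.torsionOrder, Nat.card_eq_fintype_card]
  have h := Finset.card_le_mul_card_image T _ hfib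
  calc (T.card : ℝ) ≤ Units.torsionOrder K * (T.image f).card := by exact_mod_cast h
    _ ≤ _ := by gcongr

end Counting

end NFMoment

/-! ### The function `log ∘ cosh` and the rate of decay -/

namespace NFMoment

section LogCosh

open Real

/-- The graph of `log ∘ cosh` lies above its tangents: `cosh (b + s) = cosh b (cosh s + τ sinh s)`
with `τ = tanh b`, and `cosh s + τ sinh s` is the mean of `e^s` and `e^{-s}` with weights
`(1 ± τ) / 2`. -/
lemma log_cosh_add_tanh_mul_le (b x : ℝ) :
    log (cosh b) + tanh b * (x - b) ≤ log (cosh x) := by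
  have hb := cosh_pos b
  rw [← log_exp (tanh b * (x - b)), ← log_mul hb.ne' (exp_ne_zero _)]
  refine log_le_log (by positivity) ?_
  obtain ⟨s, rfl⟩ : ∃ s, x = b + s := ⟨x - b, by ring⟩
  have hτ : tanh b * cosh b = sinh b := by rw [tanh_eq_sinh_div_cosh]; field_simp
  have hτ1 : 0 ≤ 1 + tanh b := by
    have : 0 ≤ (1 + tanh b) * cosh b := by
      rw [add_mul, one_mul, hτ, cosh_add_sinh]; positivity
    exact nonneg_of_mul_nonneg_left this hb
  have hτ2 : 0 ≤ 1 - tanh b := by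
    have : 0 ≤ (1 - tanh b) * cosh b := by
      rw [sub_mul, one_mul, hτ, cosh_sub_sinh]; positivity
    exact nonneg_of_mul_nonneg_left this hb
  have h := convexOn_exp.2 (Set.mem_univ s) (Set.mem_univ (-s))
    (div_nonneg hτ1 zero_le_two) (div_nonneg hτ2 zero_le_two) (by ring)
  simp only [smul_eq_mul] at h
  rw [show (1 + tanh b) / 2 * s + (1 - tanh b) / 2 * -s = tanh b * (b + s - b) by ring] at h
  calc cosh b * exp (tanh b * (b + s - b))
      ≤ cosh b * ((1 + tanh b) / 2 * exp s + (1 - tanh b) / 2 * exp (-s)) := by gcongr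
    _ = cosh b * cosh s + tanh b * cosh b * sinh s := by
        rw [cosh_eq s, sinh_eq s]; ring
    _ = cosh (b + s) := by rw [hτ, cosh_add]

lemma log_cosh_pos {x : ℝ} (hx : 0 < x) : 0 < log (cosh x) :=
  log_pos (one_lt_cosh.mpr hx.ne')

lemma log_cosh_mono {x y : ℝ} (hx : 0 ≤ x) (hxy : x ≤ y) : log (cosh x) ≤ log (cosh y) :=
  log_le_log (cosh_pos x) (cosh_le_cosh.mpr (by
    rwa [abs_of_nonneg hx, abs_of_nonneg (hx.trans hxy)]))

lemma log_cosh_add_le {x : ℝ} (hx : 0 ≤ x) (y : ℝ) : log (cosh (x + y)) ≤ x + log (cosh y) := by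
  rw [← log_exp x, ← log_mul (exp_ne_zero _) (cosh_pos y).ne', log_exp]
  refine log_le_log (cosh_pos _) ?_
  rw [cosh_eq, cosh_eq, neg_add, exp_add, exp_add]
  have : exp (-x) ≤ exp x := exp_le_exp.mpr (by linarith)
  have := mul_le_mul_of_nonneg_right this (exp_pos (-y)).le
  linarith

lemma log_cosh_le {x : ℝ} (hx : 0 ≤ x) : log (cosh x) ≤ x := by
  simpa using log_cosh_add_le hx 0

lemma log_cosh_mul_le {θ : ℝ} (h0 : 0 ≤ θ) (h1 : θ ≤ 1) (x : ℝ) :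
    log (cosh (θ * x)) ≤ θ * log (cosh x) := by
  have e1 := mul_le_mul_of_nonneg_left (log_cosh_add_tanh_mul_le (θ * x) x) h0
  have e2 := mul_le_mul_of_nonneg_left (log_cosh_add_tanh_mul_le (θ * x) 0) (sub_nonneg.mpr h1)
  rw [cosh_zero, log_one, mul_zero] at e2
  nlinarith

/-- As `2 C ^ 2 - 1 ≥ C ^ 3` for `1 ≤ C ≤ 5 / 4 = cosh (log 2)`. -/
lemma three_mul_log_cosh_le {c : ℝ} (h0 : 0 ≤ c) (h1 : c ≤ log 2) :
    3 * log (cosh c) ≤ log (cosh (2 * c)) := by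
  have hC1 := one_le_cosh c
  have hC2 : cosh c ≤ 5 / 4 := by
    have : cosh c ≤ cosh (log 2) := cosh_le_cosh.mpr (by
      rwa [abs_of_nonneg h0, abs_of_nonneg (h0.trans h1)])
    refine this.trans_eq ?_
    rw [cosh_log zero_lt_two]
    norm_num
  rw [show (3 : ℝ) * log (cosh c) = log (cosh c ^ 3) by rw [log_pow]; norm_num]
  refine log_le_log (by positivity) ?_
  rw [cosh_two_mul, sinh_sq]
  nlinarith [mul_nonneg (sub_nonneg.mpr hC1) (sub_nonneg.mpr hC2)]

lemma log_three_le_log_one_add_sq_add_sq {x y : ℝ} (hx : 0 < x) (hy : 0 < y) :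
    log 3 + 2 / 3 * (log x + log y) ≤ log (1 + x ^ 2 + y ^ 2) := by
  have hS : 0 < 1 + x ^ 2 + y ^ 2 := by positivity
  have key : ∀ z : ℝ, 0 < z → log z ≤ log ((1 + x ^ 2 + y ^ 2) / 3) +
      (z * (3 / (1 + x ^ 2 + y ^ 2)) - 1) := by
    intro z hz
    have h := log_le_sub_one_of_pos (x := z * (3 / (1 + x ^ 2 + y ^ 2))) (by positivity)
    rw [log_mul hz.ne' (by positivity), ← inv_div, log_inv] at h
    rw [← inv_div (1 + x ^ 2 + y ^ 2) 3]
    linarith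
  have e1 := key 1 one_pos
  have e2 := key (x ^ 2) (by positivity)
  have e3 := key (y ^ 2) (by positivity)
  have e4 : (1 + x ^ 2 + y ^ 2) * (3 / (1 + x ^ 2 + y ^ 2)) = 3 := by field_simp
  rw [log_div hS.ne' (by norm_num)] at e1 e2 e3
  rw [log_pow] at e2 e3
  rw [log_one] at e1
  push_cast at e2 e3
  linarith

end LogCosh

section Rates

open Real

/-- Jensen's inequality at `-x / N`, a convex combination of `x` and `-x`. -/
lemma fAux_le_cosh {N x : ℝ} (hN : 1 ≤ N) : fAux N x ≤ cosh x := by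
  have hN0 : 0 < N := by linarith
  have h := convexOn_exp.2 (Set.mem_univ x) (Set.mem_univ (-x))
    (div_nonneg (sub_nonneg.mpr hN) (show (0 : ℝ) ≤ 2 * N by positivity))
    (div_nonneg (show 0 ≤ N + 1 by linarith) (show (0 : ℝ) ≤ 2 * N by positivity))
    (by field_simp; ring)
  simp only [smul_eq_mul] at h
  rw [show (N - 1) / (2 * N) * x + (N + 1) / (2 * N) * -x = -(x / N) by field_simp; ring] at h
  rw [fAux, div_le_iff₀ (by linarith)]
  calc exp x + N * exp (-(x / N))
      ≤ exp x + N * ((N - 1) / (2 * N) * exp x + (N + 1) / (2 * N) * exp (-x)) := by gcongr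
    _ = cosh x * (1 + N) := by rw [cosh_eq]; field_simp; ring

lemma one_add_le_fAux {N x : ℝ} (hN : 1 ≤ N) (hx : 0 ≤ x) :
    1 + x ^ 2 / 2 / (1 + N) ≤ fAux N x := by
  have hN0 : 0 < N := by linarith
  have h1 := quadratic_le_exp_of_nonneg hx
  have h2 := add_one_le_exp (-(x / N))
  have h3 := mul_le_mul_of_nonneg_left h2 hN0.le
  rw [show N * (-(x / N) + 1) = -x + N by field_simp] at h3
  rw [fAux, le_div_iff₀ (by linarith), add_mul, div_mul_cancel₀ _ (by linarith)]
  linarith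

lemma one_lt_fAux {N x : ℝ} (hN : 1 ≤ N) (hx : 0 < x) : 1 < fAux N x := by
  have h := one_add_le_fAux hN hx.le
  have : 0 < x ^ 2 / 2 / (1 + N) := by positivity
  linarith

variable {c₁ : ℝ} {n m : ℕ}

lemma one_le_natCast_sub (hmn : m < n) : (1 : ℝ) ≤ (n : ℝ) - m := by
  have : (m : ℝ) + 1 ≤ n := by exact_mod_cast hmn
  linarith

lemma decayRate_pos (hc₁ : 0 < c₁) (hmn : m < n) : 0 < decayRate c₁ n m := by
  refine mul_pos (by norm_num) (log_pos ?_)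
  refine lt_min (by norm_num) (lt_min ?_ ?_)
  · exact one_lt_exp_iff.mpr (by positivity)
  · exact one_lt_fAux (one_le_natCast_sub hmn) (by positivity)

lemma decayRate_le_div (hc₁ : 0 < c₁) (hm : 2 ≤ m) (hmn : m < n) :
    decayRate c₁ n m ≤ c₁ / 18 := by
  have hm' : (2 : ℝ) ≤ m := by exact_mod_cast hm
  have hf := one_lt_fAux (N := (n : ℝ) - m) (one_le_natCast_sub hmn)
    (show 0 < 3 * c₁ / 4 by positivity)
  have h : log (min (4 / 3) (min (exp (c₁ / (3 * ((m : ℝ) + 1))))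
      (fAux ((n : ℝ) - m) (3 * c₁ / 4)))) ≤ c₁ / (3 * ((m : ℝ) + 1)) := by
    exact (log_le_log (by positivity) ((min_le_right _ _).trans (min_le_left _ _))).trans_eq
      (log_exp _)
  have h2 : c₁ / (3 * ((m : ℝ) + 1)) ≤ c₁ / 9 := by
    gcongr
    linarith
  rw [decayRate]
  linarith

lemma decayRate_le_log_cosh (hc₁ : 0 < c₁) (hmn : m < n) :
    decayRate c₁ n m ≤ 3 / 8 * log (cosh c₁) := by
  have hf := one_lt_fAux (N := (n : ℝ) - m) (one_le_natCast_sub hmn)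
    (show 0 < 3 * c₁ / 4 by positivity)
  have h : log (min (4 / 3) (min (exp (c₁ / (3 * ((m : ℝ) + 1))))
      (fAux ((n : ℝ) - m) (3 * c₁ / 4)))) ≤ log (cosh (3 / 4 * c₁)) := by
    refine log_le_log (by positivity) (((min_le_right _ _).trans (min_le_right _ _)).trans ?_)
    rw [show 3 / 4 * c₁ = 3 * c₁ / 4 by ring]
    exact fAux_le_cosh (one_le_natCast_sub hmn)
  have h2 := log_cosh_mul_le (θ := 3 / 4) (by norm_num) (by norm_num) c₁
  rw [decayRate]
  linarith

end Rates

end NFMoment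

/-! ### The decay provided by single entries and by pairs of entries -/

namespace NFMoment

open NumberField Matrix
open scoped ENNReal

section Exponents

open Real

variable {K : Type*} [Field K] [NumberField K]

lemma sum_mult_mul_const (c : ℝ) :
    ∑ v : InfinitePlace K, (v.mult : ℝ) * c = Module.finrank ℚ K * c := by
  rw [← Finset.sum_mul, ← Nat.cast_sum, InfinitePlace.sum_mult_eq]

lemma finrank_pos_real : (0 : ℝ) < Module.finrank ℚ K := Nat.cast_pos.mpr Module.finrank_pos

/-- The exponent of decay, per unit of `t d`, that the entry `α` of a matrix with denominator
ideal `P` provides. -/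
noncomputable def entryExponent (P : Ideal (𝓞 K)) (α : K) : ℝ :=
  (log (Ideal.absNorm P) + 1 / 2 * ∑ v : InfinitePlace K, v.mult * log ((1 + v α ^ 2) / 2)) /
    Module.finrank ℚ K

lemma idealHeight_sub_le_entryExponent (P : Ideal (𝓞 K)) (α : K) :
    idealHeight P α - log 2 / 2 ≤ entryExponent P α := by
  have hd := finrank_pos_real (K := K)
  have h : ∑ v : InfinitePlace K, (v.mult : ℝ) * log⁺ (v α) - Module.finrank ℚ K * (log 2 / 2) ≤
      1 / 2 * ∑ v : InfinitePlace K, (v.mult : ℝ) * log ((1 + v α ^ 2) / 2) := by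
    rw [← sum_mult_mul_const, ← Finset.sum_sub_distrib, Finset.mul_sum]
    refine Finset.sum_le_sum fun v _ => ?_
    rw [← mul_sub, mul_left_comm]
    refine mul_le_mul_of_nonneg_left ?_ (Nat.cast_nonneg _)
    have h0 : 0 ≤ v α := apply_nonneg v α
    have h1 : 2 * log⁺ (v α) ≤ log (1 + v α ^ 2) := by
      rw [posLog_eq_log_max_one h0, ← Nat.cast_two, ← log_pow]
      refine log_le_log (by positivity) ?_
      rcases max_cases 1 (v α) with ⟨h, _⟩ | ⟨h, _⟩ <;> rw [h] <;> nlinarith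
    rw [log_div (by positivity) two_ne_zero]
    linarith
  rw [entryExponent, idealHeight, sub_le_iff_le_add, div_le_iff₀ hd, add_mul,
    div_mul_cancel₀ _ hd.ne']
  linarith

/-- Jensen's inequality for `log ∘ cosh` over the infinite places, together with the product
formula. -/
lemma half_log_cosh_le_entryExponent {P A : Ideal (𝓞 K)} {α : K} (h : HasIdeals α P A)
    (hP : P ≠ ⊥) (hα : α ≠ 0) :
    1 / 2 * log (cosh (2 * idealHeight P α)) ≤ entryExponent P α := by
  have hd := finrank_pos_real (K := K)
  have hA : A ≠ ⊥ := fun h0 => hα ((h.eq_bot_iff hP).mp h0)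
  have hs := h.sum_mult_mul_log hP hα
  have hPl := log_nonneg (one_le_absNorm hP)
  have hAl := log_nonneg (one_le_absNorm hA)
  rw [idealHeight, entryExponent]
  set d : ℝ := (Module.finrank ℚ K : ℝ)
  set b := (∑ v : InfinitePlace K, (v.mult : ℝ) * |log (v α)|) / d with hb
  set y := (log (Ideal.absNorm P) + log (Ideal.absNorm A)) / d with hy
  have h1 : 2 * ((log (Ideal.absNorm P) + ∑ v : InfinitePlace K, v.mult * log⁺ (v α)) / d) =
      y + b := by
    have h2 : ∀ v : InfinitePlace K, (v.mult : ℝ) * log⁺ (v α) =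
        1 / 2 * ((v.mult : ℝ) * log (v α)) + 1 / 2 * ((v.mult : ℝ) * |log (v α)|) := fun v => by
      rw [← half_mul_log_add_log_abs]; ring
    rw [Finset.sum_congr rfl fun v _ => h2 v, Finset.sum_add_distrib, ← Finset.mul_sum,
      ← Finset.mul_sum, hs, hy, hb]
    field_simp
    ring
  have h2 : ∀ v : InfinitePlace K, (v.mult : ℝ) * log ((1 + v α ^ 2) / 2) =
      (v.mult : ℝ) * log (v α) + (v.mult : ℝ) * log (cosh |log (v α)|) := fun v => by
    have h0 : 0 < v α := InfinitePlace.pos_iff.mpr hα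
    -- `(1 + x²) / 2 = x cosh (log x)`
    rw [cosh_abs, cosh_log h0, ← mul_add, ← log_mul h0.ne' (by positivity)]
    congr 2
    field_simp
    ring
  have h3 : d * log (cosh b) ≤ ∑ v : InfinitePlace K, (v.mult : ℝ) * log (cosh |log (v α)|) := by
    have h4 : d * log (cosh b) = ∑ v : InfinitePlace K,
        (v.mult : ℝ) * (log (cosh b) + tanh b * (|log (v α)| - b)) := by
      have h5 : ∀ v : InfinitePlace K, (v.mult : ℝ) * (log (cosh b) + tanh b * (|log (v α)| - b)) =
          (v.mult : ℝ) * (log (cosh b) - tanh b * b) + tanh b * ((v.mult : ℝ) * |log (v α)|) :=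
        fun v => by ring
      rw [Finset.sum_congr rfl fun v _ => h5 v, Finset.sum_add_distrib, sum_mult_mul_const,
        ← Finset.mul_sum, show ∑ v : InfinitePlace K, (v.mult : ℝ) * |log (v α)| = d * b by
          rw [hb, mul_div_cancel₀ _ hd.ne']]
      ring
    rw [h4]
    exact Finset.sum_le_sum fun v _ => mul_le_mul_of_nonneg_left
      (log_cosh_add_tanh_mul_le _ _) (Nat.cast_nonneg _)
  have hy0 : 0 ≤ y := by positivity
  have h6 := log_cosh_add_le hy0 b
  rw [h1, Finset.sum_congr rfl fun v _ => h2 v, Finset.sum_add_distrib, hs,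
    le_div_iff₀ hd]
  have h7 : d * y = log (Ideal.absNorm P) + log (Ideal.absNorm A) := by
    rw [hy, mul_div_cancel₀ _ hd.ne']
  nlinarith

/-- This exponent, which grows with `N(P)` and `N(A)`, makes the sum over the ideals converge. -/
lemma log_add_log_div_le_entryExponent {P A : Ideal (𝓞 K)} {α : K} (h : HasIdeals α P A)
    (hP : P ≠ ⊥) (hα : α ≠ 0) :
    (log (Ideal.absNorm P) + log (Ideal.absNorm A)) / (2 * Module.finrank ℚ K) ≤
      entryExponent P α := by
  have hd := finrank_pos_real (K := K)
  have hs := h.sum_mult_mul_log hP hα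
  have h1 : ∑ v : InfinitePlace K, (v.mult : ℝ) * log (v α) ≤
      ∑ v : InfinitePlace K, (v.mult : ℝ) * log ((1 + v α ^ 2) / 2) := by
    refine Finset.sum_le_sum fun v _ => mul_le_mul_of_nonneg_left ?_ (Nat.cast_nonneg _)
    have h0 : 0 < v α := InfinitePlace.pos_iff.mpr hα
    refine log_le_log h0 ?_
    nlinarith [sq_nonneg (v α - 1)]
  rw [entryExponent, mul_comm, ← div_div, div_right_comm]
  refine div_le_div_of_nonneg_right ?_ hd.le
  linarith

/-- The arithmetic-geometric mean inequality for `1, |α|², |β|²` at each place; the product formula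
leaves a multiple of `log N(P)`, which the index outweighs. -/
lemma log_four_thirds_le_of_two_entries {P A B : Ideal (𝓞 K)} {α β : K} (hα : HasIdeals α P A)
    (hβ : HasIdeals β P B) (hP : P ≠ ⊥) (hα0 : α ≠ 0) (hβ0 : β ≠ 0) :
    Module.finrank ℚ K * (1 / 2 * log (4 / 3)) ≤ log (Ideal.absNorm P) +
      1 / 2 * ∑ v : InfinitePlace K, v.mult * log (4 / 9 * (1 + v α ^ 2 + v β ^ 2)) := by
  have hA : A ≠ ⊥ := fun h0 => hα0 ((hα.eq_bot_iff hP).mp h0)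
  have hB : B ≠ ⊥ := fun h0 => hβ0 ((hβ.eq_bot_iff hP).mp h0)
  have h1 := hα.sum_mult_mul_log hP hα0
  have h2 := hβ.sum_mult_mul_log hP hβ0
  have hPl := log_nonneg (one_le_absNorm hP)
  have hAl := log_nonneg (one_le_absNorm hA)
  have hBl := log_nonneg (one_le_absNorm hB)
  have h3 : ∑ v : InfinitePlace K, ((v.mult : ℝ) * log (4 / 3) +
      (2 / 3 * ((v.mult : ℝ) * log (v α)) + 2 / 3 * ((v.mult : ℝ) * log (v β)))) ≤
      ∑ v : InfinitePlace K, (v.mult : ℝ) * log (4 / 9 * (1 + v α ^ 2 + v β ^ 2)) := by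
    refine Finset.sum_le_sum fun v _ => ?_
    have hv1 : 0 < v α := InfinitePlace.pos_iff.mpr hα0
    have hv2 : 0 < v β := InfinitePlace.pos_iff.mpr hβ0
    have h4 := log_three_le_log_one_add_sq_add_sq hv1 hv2
    rw [log_mul (by norm_num) (by positivity), show (4 / 3 : ℝ) = 4 / 9 * 3 by norm_num,
      log_mul (by norm_num) (by norm_num)]
    have h5 := mul_le_mul_of_nonneg_left h4 (Nat.cast_nonneg (α := ℝ) v.mult)
    linarith
  rw [Finset.sum_add_distrib, Finset.sum_add_distrib, sum_mult_mul_const, ← Finset.mul_sum,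
    ← Finset.mul_sum, h1, h2] at h3
  linarith

end Exponents

section Contribution

variable {K : Type*} [Field K] [NumberField K] {m n : ℕ}

/-- The term of a single matrix `D` in `normalizedContribution`. -/
noncomputable def contribution (t : ℕ) (R : ℝ) (D : Matrix (Fin m) (Fin n) K) : ℝ≥0∞ :=
  ((denominatorIndex D : ℝ≥0∞) ^ t)⁻¹ * ballIntegral t R D /
    (unitBallVolume (t * Module.finrank ℚ K) ^ m *
      ENNReal.ofReal R ^ (m * t * Module.finrank ℚ K))

lemma normalizedContribution_eq_tsum (t : ℕ) (R : ℝ) :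
    normalizedContribution K n m t R = ∑' D : setA2 K m n, contribution t R D.1 := by
  simp only [normalizedContribution, contribution, div_eq_mul_inv]
  rw [ENNReal.tsum_mul_right]

lemma contribution_le_of_ballIntegral_le {t : ℕ} {R : ℝ} {D : Matrix (Fin m) (Fin n) K}
    {P : Ideal (𝓞 K)} (hP : P ≠ ⊥) (hPD : Ideal.absNorm P ≤ denominatorIndex D) {B : ℝ}
    (hB : ballIntegral t R D ≤ ENNReal.ofReal B * (unitBallVolume (t * Module.finrank ℚ K) ^ m *
      ENNReal.ofReal R ^ (m * t * Module.finrank ℚ K))) :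
    contribution t R D ≤ ENNReal.ofReal (B * Real.exp (-(t * Real.log (Ideal.absNorm P)))) := by
  have h1 := one_le_absNorm hP
  have h2 : ((denominatorIndex D : ℝ≥0∞) ^ t)⁻¹ ≤
      ENNReal.ofReal (Real.exp (-(t * Real.log (Ideal.absNorm P)))) := by
    rw [Real.exp_neg, ENNReal.ofReal_inv_of_pos (Real.exp_pos _), ENNReal.inv_le_inv, mul_comm,
      Real.exp_mul, Real.exp_log (by positivity), Real.rpow_natCast, ENNReal.ofReal_pow (by positivity),
      ENNReal.ofReal_natCast]
    gcongr
  rw [contribution]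
  refine ENNReal.div_le_of_le_mul ?_
  refine (mul_le_mul' h2 hB).trans_eq ?_
  rw [ENNReal.ofReal_mul' (Real.exp_nonneg _)]
  ring

variable {t : ℕ} {R : ℝ} {D : Matrix (Fin m) (Fin n) K} {p : Fin m → Fin n} {P : Ideal (𝓞 K)}

lemma HasPivots.contribution_le (h : HasPivots D p) (ht : 0 < t) (hR : 0 < R) (hP : P ≠ ⊥)
    (hPD : Ideal.absNorm P ≤ denominatorIndex D) :
    contribution t R D ≤ ENNReal.ofReal (Real.exp (-(t * Real.log (Ideal.absNorm P)))) := by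
  have := contribution_le_of_ballIntegral_le hP hPD (B := 1) (t := t) (R := R)
    (by simpa using h.ballIntegral_le ht hR)
  rwa [one_mul] at this

lemma HasPivots.contribution_le_entry (h : HasPivots D p) (ht : 0 < t) (hR : 0 < R) (hP : P ≠ ⊥)
    (hPD : Ideal.absNorm P ≤ denominatorIndex D) (i : Fin m) (j : Fin n) :
    contribution t R D ≤ ENNReal.ofReal (Real.exp (-(t * Module.finrank ℚ K *
      entryExponent P (D i j)))) := by
  have hd := finrank_pos_real (K := K)
  refine (contribution_le_of_ballIntegral_le hP hPD (h.ballIntegral_le_entry ht hR j i)).trans_eq ?_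
  rw [← Real.exp_add, entryExponent, mul_assoc, mul_div_cancel₀ _ hd.ne']
  congr 2
  ring

lemma HasPivots.contribution_le_two_entries (h : HasPivots D p) (ht : 0 < t) (hR : 0 < R)
    (hP : P ≠ ⊥) (hPD : Ideal.absNorm P ≤ denominatorIndex D) {j : Fin n} {i₁ i₂ : Fin m}
    (hi : i₁ ≠ i₂) {A B : Ideal (𝓞 K)} (hA : HasIdeals (D i₁ j) P A) (hB : HasIdeals (D i₂ j) P B)
    (h1 : D i₁ j ≠ 0) (h2 : D i₂ j ≠ 0) :
    contribution t R D ≤ ENNReal.ofReal (5 * (t * Module.finrank ℚ K) *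
      Real.exp (-(t * Module.finrank ℚ K * (1 / 2 * Real.log (4 / 3))))) := by
  refine (contribution_le_of_ballIntegral_le hP hPD
    (h.ballIntegral_le_two_entries ht hR j hi)).trans (ENNReal.ofReal_le_ofReal ?_)
  rw [mul_assoc, ← Real.exp_add]
  push_cast
  gcongr
  have h3 := mul_le_mul_of_nonneg_left (log_four_thirds_le_of_two_entries hA hB hP h1 h2)
    (Nat.cast_nonneg (α := ℝ) t)
  linarith

/-- The exponential form also covers the zero ideal, as `log 0 = 0`. -/
lemma idealWeight_eq (b : ℝ) (A : Ideal (𝓞 K)) :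
    idealWeight b A = ENNReal.ofReal (Real.exp (-(b * Real.log (Ideal.absNorm A)))) := by
  classical
  unfold idealWeight
  split_ifs with h
  · simp [h]
  · have := one_le_absNorm h
    rw [Real.rpow_def_of_pos (by positivity)]
    congr 2
    ring

/-- The maximum of two exponents of decay is at least their mean; the half of the exponents
`(log N(P) + log N(A_e)) / 2` pays for the convergence of the sum over the ideals. -/
lemma le_mul_prod_idealWeight_of_le {ι : Type*} [Fintype ι] [Nonempty ι] {A : ι → Ideal (𝓞 K)}
    (hP : P ≠ ⊥) (ht : 0 < t) {a b E : ℝ} (ha : a ≤ t / 4) (hb : b = t / (4 * Fintype.card ι))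
    {c : ℝ≥0∞}
    (h1 : ∀ e, c ≤ ENNReal.ofReal (Real.exp (-(t *
      ((Real.log (Ideal.absNorm P) + Real.log (Ideal.absNorm (A e))) / 2)))))
    (h2 : c ≤ ENNReal.ofReal (5 * (t * Module.finrank ℚ K) *
      Real.exp (-(t * Module.finrank ℚ K * E)))) :
    c ≤ ENNReal.ofReal (5 * (t * Module.finrank ℚ K) *
      Real.exp (-(t * Module.finrank ℚ K * (E / 2)))) *
      (ENNReal.ofReal ((Ideal.absNorm P : ℝ) ^ (-a)) * ∏ e, idealWeight b (A e)) := by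
  have hP1 := one_le_absNorm hP
  have hPl := Real.log_nonneg hP1
  have ht' : (0 : ℝ) < t := by exact_mod_cast ht
  have hT : (1 : ℝ) ≤ t * Module.finrank ℚ K := by
    exact_mod_cast Nat.mul_pos ht Module.finrank_pos
  set T : ℝ := t * Module.finrank ℚ K
  -- The entry with the largest numerator dominates the average over all entries.
  obtain ⟨e, -, he⟩ := Finset.exists_max_image Finset.univ
    (fun e => Real.log (Ideal.absNorm (A e))) Finset.univ_nonempty
  set y := Real.log (Ideal.absNorm (A e))
  set s := ∑ e, Real.log (Ideal.absNorm (A e)) with hs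
  have hcard : (0 : ℝ) < Fintype.card ι := by exact_mod_cast Fintype.card_pos
  have hsum : b * s ≤ t / 4 * y := by
    have h3 : s ≤ Fintype.card ι * y := by
      rw [hs, ← nsmul_eq_mul, ← Finset.card_univ]
      exact Finset.sum_le_card_nsmul _ _ _ fun e' _ => he e' (Finset.mem_univ _)
    calc b * s ≤ b * (Fintype.card ι * y) := by
          refine mul_le_mul_of_nonneg_left h3 ?_
          rw [hb]; positivity
      _ = t / 4 * y := by rw [hb]; field_simp
  have hrhs : ENNReal.ofReal (5 * T * Real.exp (-(T * (E / 2)))) *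
      (ENNReal.ofReal ((Ideal.absNorm P : ℝ) ^ (-a)) * ∏ e, idealWeight b (A e)) =
      ENNReal.ofReal (5 * T * Real.exp (-(T * (E / 2) + a * Real.log (Ideal.absNorm P) + b * s))) := by
    rw [Finset.prod_congr rfl fun e _ => idealWeight_eq b (A e),
      ← ENNReal.ofReal_prod_of_nonneg fun e _ => (Real.exp_nonneg _), ← Real.exp_sum,
      Real.rpow_def_of_pos (by positivity), ← ENNReal.ofReal_mul (Real.exp_nonneg _),
      ← ENNReal.ofReal_mul (by positivity), ← Real.exp_add, mul_assoc (5 * T),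
      ← Real.exp_add, hs, Finset.mul_sum, Finset.sum_neg_distrib]
    congr 3
    ring
  rw [hrhs]
  have haP := mul_le_mul_of_nonneg_right ha hPl
  -- Whichever exponent is larger is at least the mean of the two.
  rcases le_total (T * E) (t * ((Real.log (Ideal.absNorm P) + y) / 2)) with hle | hle
  · refine (h1 e).trans (ENNReal.ofReal_le_ofReal ?_)
    have h4 : Real.exp (-(t * ((Real.log (Ideal.absNorm P) + y) / 2))) ≤
        Real.exp (-(T * (E / 2) + a * Real.log (Ideal.absNorm P) + b * s)) := by
      apply Real.exp_le_exp.mpr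
      linarith
    refine h4.trans (le_mul_of_one_le_left (Real.exp_nonneg _) (by linarith))
  · refine h2.trans (ENNReal.ofReal_le_ofReal ?_)
    gcongr
    linarith

end Contribution

end NFMoment

/-! ### The threshold and the height levels -/

namespace NFMoment

open NumberField

section Threshold

open Real

/-- The denominator `log min {64/27, e^{c₁/3}, cosh³ c₁}` in the threshold. -/
noncomputable def thresholdRate (c₁ : ℝ) : ℝ :=
  log (min (64 / 27) (min (exp (1 / 3 * c₁)) (cosh c₁ ^ 3)))

variable {c₀ c₁ : ℝ} {n m : ℕ}

lemma thresholdRate_pos (hc₁ : 0 < c₁) : 0 < thresholdRate c₁ := by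
  refine log_pos (lt_min (by norm_num) (lt_min ?_ ?_))
  · exact one_lt_exp_iff.mpr (by positivity)
  · exact one_lt_pow₀ (one_lt_cosh.mpr hc₁.ne') (by norm_num)

lemma thresholdRate_le_div (c₁ : ℝ) : thresholdRate c₁ ≤ c₁ / 3 := by
  refine (log_le_log ?_ ((min_le_right _ _).trans (min_le_left _ _))).trans_eq ?_
  · have := cosh_pos c₁
    positivity
  · rw [log_exp]; ring

lemma thresholdRate_le_log_cosh (c₁ : ℝ) : thresholdRate c₁ ≤ 3 * log (cosh c₁) := by
  have := cosh_pos c₁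
  refine (log_le_log ?_ ((min_le_right _ _).trans (min_le_right _ _))).trans_eq ?_
  · positivity
  · rw [log_pow]; norm_num

lemma rank_le_finrank (K : Type*) [Field K] [NumberField K] :
    (Units.rank K : ℝ) ≤ Module.finrank ℚ K := by
  have h : Units.rank K ≤ Module.finrank ℚ K := by
    rw [← InfinitePlace.sum_mult_eq, Units.rank]
    refine (Nat.sub_le _ _).trans ?_
    rw [← Finset.card_univ, Finset.card_eq_sum_ones]
    exact Finset.sum_le_sum fun v _ => InfinitePlace.mult_pos
  exact_mod_cast h

lemma rank_div_finrank_le_one (K : Type*) [Field K] [NumberField K] :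
    (Units.rank K : ℝ) / Module.finrank ℚ K ≤ 1 :=
  div_le_one_of_le₀ (rank_le_finrank K) (Nat.cast_nonneg _)

variable (c₀ c₁ n m) in
/-- The quotient of logarithms in the threshold. -/
noncomputable def thresholdQuotient : ℝ :=
  log (2 + 12 * c₀⁻¹ + 2 * log ((n : ℝ) - m) * c₀⁻¹) / thresholdRate c₁

lemma two_le_thresholdArg (hc₀ : 0 < c₀) (hmn : m < n) :
    2 + 12 * c₀⁻¹ ≤ 2 + 12 * c₀⁻¹ + 2 * log ((n : ℝ) - m) * c₀⁻¹ := by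
  have := log_nonneg (one_le_natCast_sub hmn)
  have : 0 ≤ 2 * log ((n : ℝ) - m) * c₀⁻¹ := by positivity
  linarith

lemma thresholdQuotient_nonneg (hc₀ : 0 < c₀) (hc₁ : 0 < c₁) (hmn : m < n) :
    0 ≤ thresholdQuotient c₀ c₁ n m := by
  have := two_le_thresholdArg hc₀ hmn
  have h2 : 0 < 12 * c₀⁻¹ := by positivity
  exact div_nonneg (log_nonneg (by linarith)) (thresholdRate_pos hc₁).le

lemma logb_fAux_inv_nonneg (hc₀ : 0 < c₀) (hmn : m < n) :
    0 ≤ (logb 2 (fAux ((n : ℝ) - m) (3 / 4 * c₀)))⁻¹ :=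
  inv_nonneg.mpr (logb_nonneg (by norm_num)
    (one_lt_fAux (one_le_natCast_sub hmn) (by positivity)).le)

variable {ι : Type*} (K : ι → Type*) [∀ i, Field (K i)] [∀ i, NumberField (K i)]

/-- The terms of the supremum in the threshold stay bounded, as `r_K ≤ d`. -/
lemma thresholdTerm_le (hc₀ : 0 < c₀) (hc₁ : 0 < c₁) (hmn : m < n) {B : ℝ}
    (h1 : (m : ℝ) ^ 2 + m ≤ B) (h2 : ((m : ℝ) ^ 2 + m) * thresholdQuotient c₀ c₁ n m ≤ B)
    (h3 : (logb 2 (fAux ((n : ℝ) - m) (3 / 4 * c₀)))⁻¹ ≤ B) (i : ι) :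
    max ((m : ℝ) ^ 2 + m)
      (max
        ((Units.rank (K i) : ℝ) * ((m : ℝ) ^ 2 + m) / (Module.finrank ℚ (K i) : ℝ) *
          (log (2 + 12 * c₀⁻¹ + 2 * log ((n : ℝ) - m) * c₀⁻¹) /
            log (min (64 / 27) (min (exp (1 / 3 * c₁)) (cosh c₁ ^ 3)))))
        ((Units.rank (K i) : ℝ) / (Module.finrank ℚ (K i) : ℝ) *
          (logb 2 (fAux ((n : ℝ) - m) (3 / 4 * c₀)))⁻¹)) ≤ B := by
  have hr := rank_div_finrank_le_one (K i)
  have hQ := thresholdQuotient_nonneg (n := n) (m := m) hc₀ hc₁ hmn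
  have hf := logb_fAux_inv_nonneg (n := n) (m := m) hc₀ hmn
  refine max_le h1 (max_le ?_ ?_)
  · refine le_trans ?_ h2
    rw [mul_div_right_comm, mul_assoc]
    exact mul_le_of_le_one_left (mul_nonneg (by positivity) hQ) hr
  · exact (mul_le_of_le_one_left hf hr).trans h3

lemma le_threshold (hc₀ : 0 < c₀) (hc₁ : 0 < c₁) (hmn : m < n) (i : ι) {x : ℝ}
    (hx : x ≤ max ((m : ℝ) ^ 2 + m)
      (max
        ((Units.rank (K i) : ℝ) * ((m : ℝ) ^ 2 + m) / (Module.finrank ℚ (K i) : ℝ) *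
          (log (2 + 12 * c₀⁻¹ + 2 * log ((n : ℝ) - m) * c₀⁻¹) /
            log (min (64 / 27) (min (exp (1 / 3 * c₁)) (cosh c₁ ^ 3)))))
        ((Units.rank (K i) : ℝ) / (Module.finrank ℚ (K i) : ℝ) *
          (logb 2 (fAux ((n : ℝ) - m) (3 / 4 * c₀)))⁻¹))) :
    2 * ((n : ℝ) - m) * x ≤ threshold K c₀ c₁ n m := by
  have hN := one_le_natCast_sub hmn
  refine mul_le_mul_of_nonneg_left (le_ciSup_of_le ⟨max ((m : ℝ) ^ 2 + m)
    (max (((m : ℝ) ^ 2 + m) * thresholdQuotient c₀ c₁ n m)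
      (logb 2 (fAux ((n : ℝ) - m) (3 / 4 * c₀)))⁻¹), ?_⟩ i hx) (by linarith)
  rintro _ ⟨i, rfl⟩
  exact thresholdTerm_le K hc₀ hc₁ hmn (le_max_left _ _)
    ((le_max_left _ _).trans (le_max_right _ _)) ((le_max_right _ _).trans (le_max_right _ _)) i

lemma le_threshold_first (hc₀ : 0 < c₀) (hc₁ : 0 < c₁) (hmn : m < n) (i : ι) :
    2 * ((n : ℝ) - m) * ((m : ℝ) ^ 2 + m) ≤ threshold K c₀ c₁ n m :=
  le_threshold K hc₀ hc₁ hmn i (le_max_left _ _)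

lemma rank_mul_log_le_of_threshold_lt (hc₀ : 0 < c₀) (hc₁ : 0 < c₁) (hmn : m < n) (i : ι) {t : ℝ}
    (ht : threshold K c₀ c₁ n m < t) :
    (Units.rank (K i) : ℝ) * (2 * ((n : ℝ) - m) * ((m : ℝ) ^ 2 + m)) * log (2 + 12 * c₀⁻¹) ≤
      t * Module.finrank ℚ (K i) * thresholdRate c₁ := by
  have hd : (0 : ℝ) < Module.finrank ℚ (K i) := Nat.cast_pos.mpr Module.finrank_pos
  have hκ := thresholdRate_pos hc₁
  have hN := one_le_natCast_sub hmn
  have h := (le_threshold K hc₀ hc₁ hmn i ((le_max_left _ _).trans (le_max_right _ _))).trans ht.le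
  change 2 * ((n : ℝ) - m) * (_ * (_ / thresholdRate c₁)) ≤ t at h
  have hL : log (2 + 12 * c₀⁻¹) ≤ log (2 + 12 * c₀⁻¹ + 2 * log ((n : ℝ) - m) * c₀⁻¹) :=
    log_le_log (by positivity) (two_le_thresholdArg hc₀ hmn)
  refine (mul_le_mul_of_nonneg_left hL ?_).trans ?_
  · have : 0 ≤ (n : ℝ) - m := by linarith
    positivity
  · rw [div_mul_div_comm, ← mul_div_assoc, div_le_iff₀ (by positivity)] at h
    linarith

end Threshold

section ThresholdGrowth

open Real

lemma log_log_three_pos : 0 < log (log 3) := by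
  refine log_pos ?_
  rw [lt_log_iff_exp_lt (by norm_num)]
  exact exp_one_lt_three

/-- The growth of the threshold; the function `f_N` only enters through
`f_N(x) ≥ 1 + x² / (2 (1 + N))`. -/
lemma exists_threshold_le {c₀ c₁ : ℝ} (hc₀ : 0 < c₀) (hc₁ : 0 < c₁) :
    ∃ A : ℝ, 0 < A ∧ ∀ (ι : Type*) (K : ι → Type*) [∀ i, Field (K i)] [∀ i, NumberField (K i)],
      ∀ n m : ℕ, 2 ≤ m → m < n →
        threshold K c₀ c₁ n m ≤ A * (n : ℝ) ^ 3 * log (log n) := by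
  have hκ := thresholdRate_pos hc₁
  have hl3 := log_log_three_pos
  set κ := thresholdRate c₁ with hκdef
  set q := log (log 3) with hq
  have hlog14 : 0 < log (2 + 14 * c₀⁻¹) := log_pos (by
    have : 0 < 14 * c₀⁻¹ := by positivity
    linarith)
  set x : ℝ := 3 / 4 * c₀ with hx
  have hx0 : 0 < x := by positivity
  refine ⟨2 * (1 / q + ((log (2 + 14 * c₀⁻¹) / q + 1) / κ + (1 + 2 / (x ^ 2 / 2)) / q)),
    by positivity, ?_⟩
  intro ι K _ _ n m hm hmn
  have hn3 : (3 : ℝ) ≤ n := by exact_mod_cast (by omega : 3 ≤ n)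
  have hN := one_le_natCast_sub hmn
  have hlog3 : 1 ≤ log 3 := by
    rw [le_log_iff_exp_le (by norm_num)]
    exact exp_one_lt_three.le
  have hlogn : 1 ≤ log n := hlog3.trans (log_le_log (by norm_num) hn3)
  have hll : q ≤ log (log n) :=
    log_le_log (by linarith) (log_le_log (by norm_num) hn3)
  have hll0 : 0 < log (log n) := hl3.trans_le hll
  have hll1 : 1 ≤ log (log n) / q := by rwa [one_le_div hl3]
  have hm2 : (m : ℝ) ^ 2 + m ≤ n ^ 2 := by
    have : m ^ 2 + m ≤ n ^ 2 := by nlinarith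
    exact_mod_cast this
  set S := 1 / q + ((log (2 + 14 * c₀⁻¹) / q + 1) / κ + (1 + 2 / (x ^ 2 / 2)) / q) with hS
  have hSpos : 0 < S := by positivity
  have hsup : (⨆ i, max ((m : ℝ) ^ 2 + m)
      (max
        ((Units.rank (K i) : ℝ) * ((m : ℝ) ^ 2 + m) / (Module.finrank ℚ (K i) : ℝ) *
          (log (2 + 12 * c₀⁻¹ + 2 * log ((n : ℝ) - m) * c₀⁻¹) /
            log (min (64 / 27) (min (exp (1 / 3 * c₁)) (cosh c₁ ^ 3)))))
        ((Units.rank (K i) : ℝ) / (Module.finrank ℚ (K i) : ℝ) *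
          (logb 2 (fAux ((n : ℝ) - m) (3 / 4 * c₀)))⁻¹))) ≤ S * (n ^ 2 * log (log n)) := by
    refine Real.iSup_le (fun i => thresholdTerm_le K hc₀ hc₁ hmn ?_ ?_ ?_ i) (by positivity)
    · calc (m : ℝ) ^ 2 + m ≤ n ^ 2 * (log (log n) / q) :=
            hm2.trans (le_mul_of_one_le_right (by positivity) hll1)
        _ = 1 / q * (n ^ 2 * log (log n)) := by ring
        _ ≤ _ := by
            gcongr
            exact le_add_of_nonneg_right (by positivity)
    · have hL : log (2 + 12 * c₀⁻¹ + 2 * log ((n : ℝ) - m) * c₀⁻¹) ≤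
          (log (2 + 14 * c₀⁻¹) / q + 1) * log (log n) := by
        have h1 : 2 + 12 * c₀⁻¹ + 2 * log ((n : ℝ) - m) * c₀⁻¹ ≤ (2 + 14 * c₀⁻¹) * log n := by
          have h2 : log ((n : ℝ) - m) ≤ log n := log_le_log (by linarith) (by
            have : (0 : ℝ) ≤ m := Nat.cast_nonneg m
            linarith)
          have h3 : 0 < c₀⁻¹ := by positivity
          have h4 : 2 * log ((n : ℝ) - m) * c₀⁻¹ ≤ 2 * log n * c₀⁻¹ := by gcongr
          nlinarith
        have h0 := two_le_thresholdArg (n := n) (m := m) hc₀ hmn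
        have h3 : 0 < 12 * c₀⁻¹ := by positivity
        refine (log_le_log (by linarith) h1).trans ?_
        rw [log_mul (by positivity) (by linarith), add_mul, one_mul]
        refine add_le_add_left ?_ _
        rw [div_mul_eq_mul_div, mul_div_assoc]
        exact le_mul_of_one_le_right hlog14.le hll1
      calc ((m : ℝ) ^ 2 + m) * thresholdQuotient c₀ c₁ n m
          ≤ n ^ 2 * ((log (2 + 14 * c₀⁻¹) / q + 1) * log (log n) / κ) := by
            refine mul_le_mul hm2 ?_ (thresholdQuotient_nonneg hc₀ hc₁ hmn) (by positivity)
            exact div_le_div_of_nonneg_right hL hκ.le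
        _ = (log (2 + 14 * c₀⁻¹) / q + 1) / κ * (n ^ 2 * log (log n)) := by ring
        _ ≤ _ := by
            gcongr
            rw [hS]
            have e1 : 0 ≤ 1 / q := by positivity
            have e2 : 0 ≤ (1 + 2 / (x ^ 2 / 2)) / q := by positivity
            linarith
    · have hf := one_add_le_fAux hN hx0.le
      set u := x ^ 2 / 2 / (1 + ((n : ℝ) - m)) with hu
      have hu0 : 0 < u := by positivity
      have h1 : u / (1 + u) ≤ log (fAux ((n : ℝ) - m) x) := by
        refine le_trans ?_ (log_le_log (by positivity) hf)
        have := one_sub_inv_le_log_of_pos (show 0 < 1 + u by positivity)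
        refine le_trans (le_of_eq ?_) this
        field_simp
        ring
      have h2 : (logb 2 (fAux ((n : ℝ) - m) x))⁻¹ ≤ 1 + 1 / u := by
        rw [logb, inv_div]
        have hlog2 : log 2 ≤ 1 := by linarith [log_two_lt_d9]
        calc log 2 / log (fAux ((n : ℝ) - m) x) ≤ 1 / (u / (1 + u)) := by gcongr
          _ = 1 + 1 / u := by field_simp; ring
      have h3 : 1 / u ≤ 2 / (x ^ 2 / 2) * n := by
        have : 1 + ((n : ℝ) - m) ≤ 2 * n := by
          have : (0 : ℝ) ≤ m := Nat.cast_nonneg m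
          linarith
        calc 1 / u = 1 / (x ^ 2 / 2) * (1 + ((n : ℝ) - m)) := by rw [hu]; field_simp
          _ ≤ 1 / (x ^ 2 / 2) * (2 * n) := by gcongr
          _ = _ := by ring
      have h4 : (logb 2 (fAux ((n : ℝ) - m) x))⁻¹ ≤ (1 + 2 / (x ^ 2 / 2)) * n ^ 2 := by
        have h5 : 0 < 2 / (x ^ 2 / 2) := by positivity
        have h6 : (n : ℝ) ≤ n ^ 2 := by nlinarith
        have h7 := mul_le_mul_of_nonneg_left h6 h5.le
        nlinarith
      calc (logb 2 (fAux ((n : ℝ) - m) x))⁻¹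
          ≤ (1 + 2 / (x ^ 2 / 2)) * n ^ 2 * (log (log n) / q) :=
            h4.trans (le_mul_of_one_le_right (by positivity) hll1)
        _ = (1 + 2 / (x ^ 2 / 2)) / q * (n ^ 2 * log (log n)) := by ring
        _ ≤ _ := by
            gcongr
            rw [hS]
            have e1 : 0 ≤ 1 / q := by positivity
            have e2 : 0 ≤ (log (2 + 14 * c₀⁻¹) / q + 1) / κ := by positivity
            linarith
  calc threshold K c₀ c₁ n m ≤ 2 * ((n : ℝ) - m) * (S * (n ^ 2 * log (log n))) :=
        mul_le_mul_of_nonneg_left hsup (by linarith)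
    _ ≤ 2 * n * (S * (n ^ 2 * log (log n))) := by
        gcongr
        have : (0 : ℝ) ≤ m := Nat.cast_nonneg m
        linarith
    _ = 2 * S * n ^ 3 * log (log n) := by ring

end ThresholdGrowth

section Levels

open Real

/-- The exponent of decay, per unit of `t d`, of the matrices of height level `l`. The proposition
`two` says that some column has two nonzero entries. At level zero the decay comes from those two
entries, or else from an entry that is not a root of unity, whose height exceeds `c₁`; at the other
levels it comes from an entry of height at least `l`. -/
noncomputable def levelExponent (c₁ : ℝ) (two : Prop) [Decidable two] (l : ℕ) : ℝ :=
  if l = 0 then (if two then 1 / 4 * log (4 / 3) else 1 / 4 * log (cosh (2 * c₁)))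
  else 1 / 2 * (l - 1 / 2 * log 2)

variable {c₀ c₁ : ℝ}

/-- The tangent of the logarithm at `4`. -/
lemma mul_log_one_add_two_div_le (hc₀ : 0 < c₀) (hc : c₀ ≤ log 2) :
    c₀ * log (1 + 2 / c₀) ≤ 19 / 20 := by
  have h := log_le_sub_one_of_pos (x := (1 + 2 / c₀) / 4) (by positivity)
  rw [log_div (by positivity) (by norm_num), show (4 : ℝ) = 2 ^ 2 by norm_num, log_pow] at h
  push_cast at h
  have h2 := mul_le_mul_of_nonneg_left h hc₀.le
  have h3 : c₀ * ((1 + 2 / c₀) / 2 ^ 2 - 1) = 1 / 2 - 3 / 4 * c₀ := by field_simp; ring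
  rw [h3] at h2
  have h4 := log_two_lt_d9
  nlinarith

lemma log_one_add_two_mul_div_le (hc₀ : 0 < c₀) (l : ℕ) :
    log (1 + 2 * (l + 1) / c₀) ≤ log (1 + 2 / c₀) + l := by
  have hl : (0 : ℝ) ≤ l := Nat.cast_nonneg l
  have h1 : 1 + 2 * (l + 1) / c₀ ≤ (1 + 2 / c₀) * (l + 1) := by
    have : 2 * ((l : ℝ) + 1) / c₀ = 2 / c₀ * (l + 1) := by ring
    rw [this]
    linarith
  refine (log_le_log (by positivity) h1).trans ?_
  rw [log_mul (by positivity) (by positivity)]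
  have := log_le_sub_one_of_pos (show (0 : ℝ) < l + 1 by positivity)
  linarith

/-- At every level the decay beats the number of matrices. The constants leave little room at level
zero: `19 / 720 + (log 2) / 18 < (log (4 / 3)) / 4`. -/
lemma level_bound (hc₁ : 0 < c₁) (hc : c₁ ≤ c₀) (hc₀ : c₀ ≤ log 2) {κ ε T x : ℝ} (hT : 0 ≤ T)
    (hx : 0 ≤ x) (hκ₁ : κ ≤ c₁ / 3) (hκ₂ : κ ≤ 3 * log (cosh c₁)) (hε₁ : ε ≤ c₁ / 18)
    (hε₂ : ε ≤ 3 / 8 * log (cosh c₁)) (two : Prop) [Decidable two]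
    (h1 : x * log (2 + 12 * c₀⁻¹) ≤ T * κ / 6)
    (h2 : ¬ two → x * log (2 + 12 * c₀⁻¹) ≤ T * κ / 12) (l : ℕ) :
    x * log (1 + 2 * (l + 1) / c₀) + ε * T + log (cosh c₁) / 1000 * T * (l + 1) ≤
      T * levelExponent c₁ two l := by
  have hc₀' : 0 < c₀ := hc₁.trans_le hc
  have hlog2 := log_two_lt_d9
  have hl : (0 : ℝ) ≤ l := Nat.cast_nonneg l
  have hlam := log_cosh_le hc₁.le
  have hlam0 := log_cosh_pos hc₁
  set lam := log (cosh c₁)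
  -- As `c₀ ≤ log 2`, the logarithm in the threshold is at least `2`.
  have hL2 : 2 ≤ log (2 + 12 * c₀⁻¹) := by
    rw [le_log_iff_exp_le (by positivity)]
    have e1 : exp 2 ≤ 9 := by
      have := exp_one_lt_three
      rw [show (2 : ℝ) = 1 + 1 by norm_num, exp_add]
      nlinarith [exp_pos 1]
    have e2 : 1 ≤ c₀⁻¹ := (one_le_inv₀ hc₀').mpr (by linarith)
    linarith
  have hxc : x ≤ T * c₀ / 36 := by
    have e1 := mul_le_mul_of_nonneg_left hL2 hx
    have e2 : T * κ ≤ T * (c₀ / 3) := mul_le_mul_of_nonneg_left (by linarith) hT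
    linarith
  have hlog0 : 0 ≤ log (1 + 2 / c₀) := log_nonneg (by
    have : 0 < 2 / c₀ := by positivity
    linarith)
  have hx1 : x * log (1 + 2 / c₀) ≤ T * (19 / 720) := by
    have e1 := mul_le_mul_of_nonneg_right hxc hlog0
    have e2 := mul_le_mul_of_nonneg_left (mul_log_one_add_two_div_le hc₀' hc₀) hT
    linarith
  have hεT : ε * T ≤ T * (7 / 180) := by
    rw [mul_comm]
    exact mul_le_mul_of_nonneg_left (by linarith) hT
  have hδT : lam / 1000 * T * (l + 1) ≤ T * (7 / 10000) * (l + 1) := by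
    refine mul_le_mul_of_nonneg_right ?_ (by positivity)
    rw [mul_comm]
    exact mul_le_mul_of_nonneg_left (by linarith) hT
  rcases Nat.eq_zero_or_pos l with rfl | hl1
  · rw [levelExponent, if_pos rfl]
    simp only [CharP.cast_eq_zero, zero_add, mul_one] at hδT ⊢
    by_cases htwo : two
    · rw [if_pos htwo]
      -- from `(11 / 10) ^ 3 < 4 / 3`
      have h43 : 27 / 100 ≤ log (4 / 3) := by
        have e1 := one_sub_inv_le_log_of_pos (show (0 : ℝ) < 11 / 10 by norm_num)
        have e2 : log ((11 / 10 : ℝ) ^ 3) ≤ log (4 / 3) :=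
          log_le_log (by norm_num) (by norm_num)
        rw [log_pow] at e2
        push_cast at e2
        norm_num at e1 e2 ⊢
        linarith
      have := mul_le_mul_of_nonneg_left h43 hT
      linarith
    · -- `1 / 4 + 3 / 8 + 1 / 1000 < 3 / 4` in units of `log (cosh c₁)`
      rw [if_neg htwo]
      have e1 : log (1 + 2 / c₀) ≤ log (2 + 12 * c₀⁻¹) := by
        refine log_le_log (by positivity) ?_
        rw [div_eq_mul_inv]
        have : 0 < c₀⁻¹ := by positivity
        linarith
      have e2 := mul_le_mul_of_nonneg_left e1 hx
      have e3 := h2 htwo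
      have e4 := mul_le_mul_of_nonneg_left hκ₂ hT
      have e5 := mul_le_mul_of_nonneg_left hε₂ hT
      have e6 := mul_le_mul_of_nonneg_left (three_mul_log_cosh_le hc₁.le (hc.trans hc₀)) hT
      have e7 : 0 ≤ T * lam := mul_nonneg hT hlam0.le
      linarith
  · rw [levelExponent, if_neg hl1.ne']
    have hl1' : (1 : ℝ) ≤ l := by exact_mod_cast hl1
    have e1 := mul_le_mul_of_nonneg_left (log_one_add_two_mul_div_le hc₀' l) hx
    have e2 : x * l ≤ T * (7 / 360) * l := by
      refine mul_le_mul_of_nonneg_right (hxc.trans ?_) hl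
      have := mul_le_mul_of_nonneg_left (show c₀ ≤ 7 / 10 by linarith) hT
      linarith
    have e3 : T * (1 / 2 * (l - 1 / 2 * (7 / 10))) ≤ T * (1 / 2 * (l - 1 / 2 * log 2)) :=
      mul_le_mul_of_nonneg_left (by linarith) hT
    have e4 := mul_le_mul_of_nonneg_left hl1' hT
    linarith

end Levels

end NFMoment

/-! ### Pivots and height levels of matrices -/

namespace NFMoment

open NumberField Matrix
open scoped ENNReal

section Pivots

variable {K : Type*} [Field K] [NumberField K] {m n : ℕ}

omit [NumberField K] in
/-- A reduced row echelon matrix of full row rank has a pivot in every row. -/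
lemma exists_hasPivots {D : Matrix (Fin m) (Fin n) K} (h : D.IsReducedRowEchelon)
    (hr : D.rank = m) : ∃ p : Fin m → Fin n, HasPivots D p := by
  have hli : LinearIndependent K D.row := by
    rw [linearIndependent_iff_card_eq_finrank_span, Fintype.card_fin, Set.finrank,
      ← Matrix.rank_eq_finrank_span_row, hr]
  have hlead : ∀ i, ∃ c, D.IsLeadingEntry i c := fun i =>
    Matrix.row_ne_zero_iff_exists_isLeadingEntry.mp (hli.ne_zero i)
  choose p hp using hlead
  refine ⟨p, fun i k => ?_⟩
  split_ifs with hik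
  · subst hik
    exact h.eq_one (hp i)
  · exact h.eq_zero_of_ne_of_isLeadingEntry hik (hp k)

/-- The positions of a matrix that do not lie in one of the columns numbered by `p`. -/
abbrev FreeEntry (p : Fin m → Fin n) : Type := Fin m × {j : Fin n // ∀ i, p i ≠ j}

lemma card_freeEntry {p : Fin m → Fin n} (hp : Function.Injective p) :
    Fintype.card (FreeEntry p) = m * (n - m) := by
  have h : Fintype.card {j : Fin n // ∀ i, p i ≠ j} = n - m := by
    rw [Fintype.card_subtype, show (Finset.univ.filter fun j => ∀ i, p i ≠ j) =
      (Finset.univ.image p)ᶜ by ext j; simp, Finset.card_compl,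
      Finset.card_image_of_injective _ hp]
    simp
  rw [Fintype.card_prod, h, Fintype.card_fin]

/-- The entries of `D` outside the columns numbered by `p`. -/
def freeEntries (p : Fin m → Fin n) (D : Matrix (Fin m) (Fin n) K) : FreeEntry p → K :=
  fun e => D e.1 e.2.1

omit [NumberField K] in
lemma HasPivots.eq_of_freeEntries_eq {p : Fin m → Fin n} {D D' : Matrix (Fin m) (Fin n) K}
    (h : HasPivots D p) (h' : HasPivots D' p) (he : freeEntries p D = freeEntries p D') :
    D = D' := by
  ext i j
  by_cases hj : ∀ k, p k ≠ j
  · exact congrFun he (i, ⟨j, hj⟩)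
  · push Not at hj
    obtain ⟨k, rfl⟩ := hj
    rw [h, h']

omit [NumberField K] in
lemma HasPivots.exists_freeEntries {p : Fin m → Fin n} {D : Matrix (Fin m) (Fin n) K}
    (h : HasPivots D p) (hD : ∃ i j, D i j ≠ 0 ∧ ¬ IsOfFinOrder (D i j)) :
    ∃ e, freeEntries p D e ≠ 0 ∧ ¬ IsOfFinOrder (freeEntries p D e) := by
  obtain ⟨i, j, h0, h1⟩ := hD
  by_cases hj : ∀ k, p k ≠ j
  · exact ⟨(i, ⟨j, hj⟩), h0, h1⟩
  · push Not at hj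
    obtain ⟨k, rfl⟩ := hj
    rw [h] at h0 h1
    split_ifs at h0 h1 with hik
    · exact absurd IsOfFinOrder.one h1
    · exact absurd rfl h0

variable (K) in
/-- The matrices whose columns numbered by `p` are the standard basis vectors and which have an entry
that is neither zero nor a root of unity. -/
def pivotMatrices (p : Fin m → Fin n) : Set (Matrix (Fin m) (Fin n) K) :=
  {D | HasPivots D p ∧ ∃ i j, D i j ≠ 0 ∧ ¬ IsOfFinOrder (D i j)}

lemma tsum_setA2_le (f : Matrix (Fin m) (Fin n) K → ℝ≥0∞) :
    ∑' D : setA2 K m n, f D.1 ≤ ∑ p : Fin m → Fin n, ∑' D : pivotMatrices K p, f D.1 := by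
  have hp : ∀ D : setA2 K m n, ∃ p : Fin m → Fin n, D.1 ∈ pivotMatrices K p := fun D => by
    obtain ⟨p, hp⟩ := exists_hasPivots D.2.1 D.2.2.1
    exact ⟨p, hp, D.2.2.2⟩
  choose p hp using hp
  let g : setA2 K m n → Σ p : Fin m → Fin n, pivotMatrices K p := fun D => ⟨p D, ⟨D.1, hp D⟩⟩
  have hg : Function.Injective g := fun D D' h => by
    have := congrArg (fun x : Σ p : Fin m → Fin n, pivotMatrices K p => x.2.1) h
    exact Subtype.ext this
  calc ∑' D : setA2 K m n, f D.1 = ∑' D, (fun x : Σ p : Fin m → Fin n, pivotMatrices K p =>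
        f x.2.1) (g D) := rfl
    _ ≤ ∑' x : Σ p : Fin m → Fin n, pivotMatrices K p, f x.2.1 :=
        ENNReal.tsum_comp_le_tsum_of_injective hg _
    _ = _ := by rw [ENNReal.tsum_sigma', tsum_fintype]

end Pivots

section HeightLevel

variable {K : Type*} [Field K] [NumberField K] {ι : Type*} [Fintype ι]

open scoped Classical in
/-- The integer part of the largest height of a nonzero entry; it is `0` if all entries are zero. -/
noncomputable def heightLevel (P : Ideal (𝓞 K)) (α : ι → K) : ℕ :=
  Finset.univ.sup fun e => if α e = 0 then 0 else ⌊idealHeight P (α e)⌋₊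

lemma idealHeight_le_heightLevel {P : Ideal (𝓞 K)} {α : ι → K} {e : ι} (he : α e ≠ 0) :
    idealHeight P (α e) ≤ heightLevel P α + 1 := by
  classical
  have h : ⌊idealHeight P (α e)⌋₊ ≤ heightLevel P α := by
    have := Finset.le_sup (f := fun e => if α e = 0 then 0 else ⌊idealHeight P (α e)⌋₊)
      (Finset.mem_univ e)
    simp only [if_neg he] at this
    exact this
  refine (Nat.lt_floor_add_one _).le.trans ?_
  gcongr

lemma exists_heightLevel_le {P : Ideal (𝓞 K)} {α : ι → K} (h : heightLevel P α ≠ 0) :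
    ∃ e, α e ≠ 0 ∧ (heightLevel P α : ℝ) ≤ idealHeight P (α e) := by
  classical
  have hne : (Finset.univ : Finset ι).Nonempty := by
    by_contra hne
    rw [Finset.not_nonempty_iff_eq_empty] at hne
    exact h (by rw [heightLevel, hne, Finset.sup_empty]; rfl)
  obtain ⟨e, -, he⟩ := Finset.exists_mem_eq_sup _ hne
    (fun e => if α e = 0 then 0 else ⌊idealHeight P (α e)⌋₊)
  change heightLevel P α = _ at he
  rw [he] at h
  split_ifs at h he with h0
  · exact absurd rfl h
  · refine ⟨e, h0, ?_⟩
    rw [he]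
    exact Nat.floor_le (Nat.pos_of_floor_pos (Nat.pos_of_ne_zero h)).le

open scoped Classical in
/-- The number of families with given ideals and given height level. -/
lemma card_le_of_heightLevel_eq {c₀ : ℝ} (hc₀ : 0 < c₀)
    (hK : ∀ α : 𝓞 K, α ≠ 0 → ¬ IsOfFinOrder α → c₀ < weilHeight (α : K)) {P : Ideal (𝓞 K)}
    (hP : P ≠ ⊥) (A : ι → Ideal (𝓞 K)) (l : ℕ) (S : Finset (ι → K))
    (hS : ∀ α ∈ S, (∀ e, HasIdeals (α e) P (A e)) ∧ heightLevel P α = l) :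
    (S.card : ℝ) ≤ Units.torsionOrder K ^ Fintype.card ι *
      (1 + 2 * (l + 1) / c₀) ^ (Units.rank K * (Finset.univ.filter fun e => A e ≠ ⊥).card) := by
  set q : ℝ := 1 + 2 * (l + 1) / c₀
  have hq : 1 ≤ q := by
    have : 0 ≤ 2 * ((l : ℝ) + 1) / c₀ := by positivity
    simp only [q]
    linarith
  have hω : (1 : ℝ) ≤ Units.torsionOrder K := by exact_mod_cast Units.torsionOrder_pos K
  have hsub : S ⊆ Fintype.piFinset fun e => S.image fun α => α e := by
    intro α hα
    rw [Fintype.mem_piFinset]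
    exact fun e => Finset.mem_image_of_mem _ hα
  have hcard : ∀ e, ((S.image fun α => α e).card : ℝ) ≤
      Units.torsionOrder K * (if A e ≠ ⊥ then q ^ Units.rank K else 1) := by
    intro e
    split_ifs with hA
    · refine card_le_of_idealHeight_le hc₀ (Y := l + 1) (by positivity) hK hP hA _ ?_
      intro x hx
      obtain ⟨α, hα, rfl⟩ := Finset.mem_image.mp hx
      refine ⟨(hS α hα).1 e, ?_⟩
      rw [← (hS α hα).2]
      exact idealHeight_le_heightLevel fun h0 =>
        hA ((((hS α hα).1 e).eq_bot_iff hP).mpr h0)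
    · push Not at hA
      have h1 : (S.image fun α => α e) ⊆ {0} := by
        intro x hx
        obtain ⟨α, hα, rfl⟩ := Finset.mem_image.mp hx
        rw [Finset.mem_singleton]
        exact (((hS α hα).1 e).eq_bot_iff hP).mp hA
      have h2 : ((S.image fun α => α e).card : ℝ) ≤ 1 := by
        exact_mod_cast (Finset.card_le_card h1).trans_eq (Finset.card_singleton _)
      linarith
  calc (S.card : ℝ) ≤ ∏ e, ((S.image fun α => α e).card : ℝ) := by
        rw [← Nat.cast_prod, ← Fintype.card_piFinset]
        exact_mod_cast Finset.card_le_card hsub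
    _ ≤ ∏ e, (Units.torsionOrder K * (if A e ≠ ⊥ then q ^ Units.rank K else 1) : ℝ) :=
        Finset.prod_le_prod (fun _ _ => Nat.cast_nonneg _) fun e _ => hcard e
    _ = _ := by
        rw [Finset.prod_mul_distrib, Finset.prod_const, Finset.card_univ, ← Finset.prod_filter,
          Finset.prod_const, pow_mul]

end HeightLevel

section SumLemmas

lemma ENNReal_tsum_const_le {F : Type*} {B : ℝ} (c : ℝ≥0∞) (h : ∀ S : Finset F, (S.card : ℝ) ≤ B) :
    ∑' _ : F, c ≤ ENNReal.ofReal B * c := by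
  rw [ENNReal.tsum_eq_iSup_sum]
  refine iSup_le fun S => ?_
  rw [Finset.sum_const, nsmul_eq_mul]
  gcongr
  rw [← ENNReal.ofReal_natCast]
  exact ENNReal.ofReal_le_ofReal (h S)

/-- A geometric series; `x / (e^x - 1) ≤ 1` makes the bound independent of `T`. -/
lemma tsum_mul_exp_le {δ T : ℝ} (hδ : 0 < δ) (hT : 0 < T) :
    ∑' l : ℕ, ENNReal.ofReal (5 * T * Real.exp (-(δ * T * (l + 1)))) ≤ ENNReal.ofReal (5 / δ) := by
  set x := Real.exp (-(δ * T)) with hx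
  have hx0 : 0 < x := Real.exp_pos _
  have hx1 : x < 1 := by
    rw [hx, ← Real.exp_zero, Real.exp_lt_exp]
    linarith [mul_pos hδ hT]
  have hterm : ∀ l : ℕ, 5 * T * Real.exp (-(δ * T * (l + 1))) = 5 * T * x * x ^ l := fun l => by
    rw [mul_assoc (5 * T), ← pow_succ', hx, ← Real.exp_nat_mul]
    congr 2
    push_cast
    ring
  have hsum : HasSum (fun l : ℕ => 5 * T * x * x ^ l) (5 * T * x * (1 - x)⁻¹) :=
    (hasSum_geometric_of_lt_one hx0.le hx1).mul_left _
  simp only [hterm]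
  rw [← ENNReal.ofReal_tsum_of_nonneg (fun l => by positivity) hsum.summable, hsum.tsum_eq]
  refine ENNReal.ofReal_le_ofReal ?_
  have h1 : δ * T * x ≤ 1 - x := by
    have h2 : (δ * T + 1) * x ≤ 1 := by
      have := mul_le_mul_of_nonneg_right (Real.add_one_le_exp (δ * T)) hx0.le
      rwa [hx, ← Real.exp_add, add_neg_cancel, Real.exp_zero] at this
    linarith
  rw [← div_eq_mul_inv, div_le_div_iff₀ (by linarith) hδ]
  linarith

end SumLemmas

end NFMoment

/-! ### The sum over the matrices with given pivots -/

namespace NFMoment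

open NumberField Matrix
open scoped ENNReal

section PivotSum

variable {K : Type*} [Field K] [NumberField K] {m n : ℕ} {p : Fin m → Fin n}

/-- Two of the ideals in one column are nonzero. -/
def TwoInColumn (A : FreeEntry p → Ideal (𝓞 K)) : Prop :=
  ∃ j i₁ i₂, i₁ ≠ i₂ ∧ A (i₁, j) ≠ ⊥ ∧ A (i₂, j) ≠ ⊥

open scoped Classical in
omit [NumberField K] in
lemma card_support_le_of_not_twoInColumn (hp : Function.Injective p)
    {A : FreeEntry p → Ideal (𝓞 K)} (hA : ¬ TwoInColumn A) :
    (Finset.univ.filter fun e => A e ≠ ⊥).card ≤ n - m := by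
  have h : Fintype.card {j : Fin n // ∀ i, p i ≠ j} = n - m := by
    rw [Fintype.card_subtype, show (Finset.univ.filter fun j => ∀ i, p i ≠ j) =
      (Finset.univ.image p)ᶜ by ext j; simp, Finset.card_compl,
      Finset.card_image_of_injective _ hp]
    simp
  rw [← h, ← Finset.card_univ]
  refine Finset.card_le_card_of_injOn Prod.snd (fun _ _ => Finset.mem_coe.mpr (Finset.mem_univ _)) ?_
  rintro ⟨i₁, j⟩ h1 ⟨i₂, j'⟩ h2 hj
  simp only [Finset.coe_filter, Finset.mem_univ, true_and, Set.mem_ofPred_eq] at h1 h2 hj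
  subst hj
  by_contra hne
  exact hA ⟨j, i₁, i₂, fun h => hne (by rw [h]), h1, h2⟩

open scoped Classical in
/-- Every matrix satisfies the estimate that belongs to its ideals and its height level. -/
lemma contribution_le_levelExponent {c₀ c₁ R : ℝ} {t : ℕ} (hc₁ : 0 < c₁)
    (hK : HeightBounds K c₀ c₁) (ht : 0 < t) (hR : 0 < R) {D : Matrix (Fin m) (Fin n) K}
    (hD : D ∈ pivotMatrices K p) {P : Ideal (𝓞 K)} (hP : P ≠ ⊥) {A : FreeEntry p → Ideal (𝓞 K)}
    (hA : ∀ e, HasIdeals (freeEntries p D e) P (A e))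
    (hPD : Ideal.absNorm P ≤ denominatorIndex D) {a b : ℝ} (ha : a ≤ t / 4)
    (hb : b = t / (4 * Fintype.card (FreeEntry p))) :
    contribution t R D ≤ ENNReal.ofReal (5 * (t * Module.finrank ℚ K) *
      Real.exp (-(t * Module.finrank ℚ K *
        levelExponent c₁ (TwoInColumn A) (heightLevel P (freeEntries p D))))) *
      (ENNReal.ofReal ((Ideal.absNorm P : ℝ) ^ (-a)) * ∏ e, idealWeight b (A e)) := by
  obtain ⟨hpiv, hex⟩ := hD
  have hd := finrank_pos_real (K := K)
  have ht' : (0 : ℝ) < t := by exact_mod_cast ht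
  have hT : (1 : ℝ) ≤ t * Module.finrank ℚ K := by
    exact_mod_cast Nat.mul_pos ht Module.finrank_pos
  have hP1 := one_le_absNorm hP
  have hPl := Real.log_nonneg hP1
  obtain ⟨e₀, he₀, he₀'⟩ := hpiv.exists_freeEntries hex
  have : Nonempty (FreeEntry p) := ⟨e₀⟩
  have hentry : ∀ e E, E ≤ entryExponent P (freeEntries p D e) →
      contribution t R D ≤ ENNReal.ofReal (5 * (t * Module.finrank ℚ K) *
        Real.exp (-(t * Module.finrank ℚ K * E))) := by
    intro e E hE
    refine (hpiv.contribution_le_entry ht hR hP hPD e.1 e.2.1).trans (ENNReal.ofReal_le_ofReal ?_)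
    calc Real.exp (-(t * Module.finrank ℚ K * entryExponent P (D e.1 e.2.1)))
        ≤ Real.exp (-(t * Module.finrank ℚ K * E)) := by
          refine Real.exp_le_exp.mpr (neg_le_neg (mul_le_mul_of_nonneg_left hE (by positivity)))
      _ ≤ _ := le_mul_of_one_le_left (Real.exp_nonneg _) (by linarith)
  have key := le_mul_prod_idealWeight_of_le (c := contribution t R D) (A := A)
    (E := 2 * levelExponent c₁ (TwoInColumn A) (heightLevel P (freeEntries p D))) hP ht ha hb ?_ ?_
  · rwa [mul_div_cancel_left₀ _ two_ne_zero] at key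
  · intro e
    by_cases h0 : freeEntries p D e = 0
    · refine (hpiv.contribution_le ht hR hP hPD).trans (ENNReal.ofReal_le_ofReal ?_)
      rw [((hA e).eq_bot_iff hP).mpr h0, Ideal.absNorm_bot, Nat.cast_zero, Real.log_zero, add_zero]
      refine Real.exp_le_exp.mpr (neg_le_neg (mul_le_mul_of_nonneg_left ?_ ht'.le))
      linarith
    · refine (hpiv.contribution_le_entry ht hR hP hPD e.1 e.2.1).trans
        (ENNReal.ofReal_le_ofReal (Real.exp_le_exp.mpr (neg_le_neg ?_)))
      rw [mul_assoc]
      refine mul_le_mul_of_nonneg_left ?_ ht'.le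
      have := mul_le_mul_of_nonneg_left (log_add_log_div_le_entryExponent (hA e) hP h0) hd.le
      refine le_trans (le_of_eq ?_) this
      field_simp
  · rw [levelExponent]
    split_ifs with hl htwo
    · obtain ⟨j, i₁, i₂, hi, h1, h2⟩ := htwo
      have := hpiv.contribution_le_two_entries (j := j.1) ht hR hP hPD hi (hA (i₁, j)) (hA (i₂, j))
        (fun h => h1 (((hA (i₁, j)).eq_bot_iff hP).mpr h))
        (fun h => h2 (((hA (i₂, j)).eq_bot_iff hP).mpr h))
      rwa [show 2 * (1 / 4 * Real.log (4 / 3)) = 1 / 2 * Real.log (4 / 3) by ring]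
    · refine hentry e₀ _ (le_trans ?_ (half_log_cosh_le_entryExponent (hA e₀) hP he₀))
      have h1 := (hK.1 _ he₀ he₀').le.trans (weilHeight_le_idealHeight (hA e₀) hP)
      have := log_cosh_mono (x := 2 * c₁) (by positivity) (mul_le_mul_of_nonneg_left h1 zero_le_two)
      linarith
    · obtain ⟨e, -, he⟩ := exists_heightLevel_le hl
      refine hentry e _ (le_trans ?_ (idealHeight_sub_le_entryExponent P _))
      linarith

/-- The hypotheses on `t` that the threshold provides: `t` is large, and the number of units of
bounded height is small against `e^{td}`. -/
structure IsLarge (K : Type*) [Field K] [NumberField K] (c₀ c₁ : ℝ) (n m t : ℕ) : Prop where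
  lt : 2 * ((n : ℝ) - m) * ((m : ℝ) ^ 2 + m) < t
  rank_le : (Units.rank K : ℝ) * (2 * ((n : ℝ) - m) * ((m : ℝ) ^ 2 + m)) *
    Real.log (2 + 12 * c₀⁻¹) ≤ t * Module.finrank ℚ K * thresholdRate c₁

open scoped Classical in
/-- The number of matrices at level `l`, up to roots of unity, times their size. The exponent `k` of
the number of units is at most `m (n - m)`, and at most `n - m` if no column has two nonzero
entries, which gains a factor `m`. -/
lemma level_sum_le {c₀ c₁ : ℝ} {t : ℕ} (hc₁ : 0 < c₁) (hc : c₁ ≤ c₀) (hK : HeightBounds K c₀ c₁)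
    (hm : 2 ≤ m) (hmn : m < n) (ht : IsLarge K c₀ c₁ n m t) (hp : Function.Injective p)
    (A : FreeEntry p → Ideal (𝓞 K)) (l : ℕ) :
    (1 + 2 * (l + 1) / c₀) ^ (Units.rank K * (Finset.univ.filter fun e => A e ≠ ⊥).card) *
      Real.exp (-(t * Module.finrank ℚ K * levelExponent c₁ (TwoInColumn A) l)) ≤
    Real.exp (-(decayRate c₁ n m * (t * Module.finrank ℚ K))) *
      Real.exp (-(Real.log (Real.cosh c₁) / 1000 * (t * Module.finrank ℚ K) * (l + 1))) := by
  have hc₀ : 0 < c₀ := hc₁.trans_le hc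
  have hq : 0 < 1 + 2 * ((l : ℝ) + 1) / c₀ := by positivity
  set k := (Finset.univ.filter fun e => A e ≠ ⊥).card
  set T : ℝ := t * Module.finrank ℚ K with hT
  set L := Real.log (2 + 12 * c₀⁻¹)
  have hN := one_le_natCast_sub hmn
  have hm' : (2 : ℝ) ≤ m := by exact_mod_cast hm
  have hL : 0 ≤ L := Real.log_nonneg (by
    have : 0 < 12 * c₀⁻¹ := by positivity
    linarith)
  have hr : (0 : ℝ) ≤ Units.rank K := Nat.cast_nonneg _
  have hrL : 0 ≤ (Units.rank K : ℝ) * L := mul_nonneg hr hL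
  have hmain : (Units.rank K : ℝ) * L * (2 * ((n : ℝ) - m) * ((m : ℝ) ^ 2 + m)) ≤
      T * thresholdRate c₁ := by
    have := ht.rank_le
    linarith
  have hcast : ((n - m : ℕ) : ℝ) = (n : ℝ) - m := Nat.cast_sub hmn.le
  have hk1 : (k : ℝ) ≤ m * ((n : ℝ) - m) := by
    rw [← hcast]
    have : k ≤ m * (n - m) := by
      rw [← card_freeEntry hp]
      exact Finset.card_le_univ _
    exact_mod_cast this
  have h1 : (Units.rank K : ℝ) * k * L ≤ T * thresholdRate c₁ / 6 := by
    have e1 := mul_le_mul_of_nonneg_left hk1 hrL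
    have e2 : m * ((n : ℝ) - m) * 6 ≤ 2 * ((n : ℝ) - m) * ((m : ℝ) ^ 2 + m) := by
      have : 0 ≤ (m : ℝ) * ((n : ℝ) - m) * (m - 2) :=
        mul_nonneg (mul_nonneg (by linarith) (by linarith)) (by linarith)
      linarith
    have e3 := mul_le_mul_of_nonneg_left e2 hrL
    linarith
  have h2 : ¬ TwoInColumn A → (Units.rank K : ℝ) * k * L ≤ T * thresholdRate c₁ / 12 := by
    intro hA
    have hk2 : (k : ℝ) ≤ (n : ℝ) - m := by
      rw [← hcast]
      exact_mod_cast card_support_le_of_not_twoInColumn hp hA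
    have e1 := mul_le_mul_of_nonneg_left hk2 hrL
    have e2 : ((n : ℝ) - m) * 12 ≤ 2 * ((n : ℝ) - m) * ((m : ℝ) ^ 2 + m) := by
      have : 0 ≤ ((n : ℝ) - m) * ((m - 2) * (m + 3)) :=
        mul_nonneg (by linarith) (mul_nonneg (by linarith) (by linarith))
      linarith
    have e3 := mul_le_mul_of_nonneg_left e2 hrL
    linarith
  have h := level_bound hc₁ hc hK.lt_log_two.le (T := T) (x := Units.rank K * k) (by positivity)
    (by positivity) (thresholdRate_le_div c₁) (thresholdRate_le_log_cosh c₁)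
    (decayRate_le_div hc₁ hm hmn) (decayRate_le_log_cosh hc₁ hmn) (TwoInColumn A) h1 h2 l
  rw [← Real.rpow_natCast, Real.rpow_def_of_pos hq, ← Real.exp_add, ← Real.exp_add]
  refine Real.exp_le_exp.mpr ?_
  push_cast
  linarith

/-- The sum over the matrices with given pivots is bounded by a sum over coprime tuples of ideals. -/
lemma tsum_pivotMatrices_le {c₀ c₁ R : ℝ} {t : ℕ} (hc₁ : 0 < c₁) (hc : c₁ ≤ c₀)
    (hK : HeightBounds K c₀ c₁) (hm : 2 ≤ m) (hmn : m < n) (ht : IsLarge K c₀ c₁ n m t)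
    (hR : 0 < R) {a b : ℝ} (ha : a ≤ t / 4) (hb : b = t / (4 * Fintype.card (FreeEntry p))) :
    ∑' D : pivotMatrices K p, contribution t R D.1 ≤
      ENNReal.ofReal (Units.torsionOrder K ^ (m * (n - m)) *
        Real.exp (-(decayRate c₁ n m * (t * Module.finrank ℚ K))) *
        (5000 / Real.log (Real.cosh c₁))) *
      ∑' τ : CoprimeTuples K (FreeEntry p), ENNReal.ofReal ((Ideal.absNorm τ.1.1.1 : ℝ) ^ (-a)) *
        ∏ e, idealWeight b (τ.1.2 e) := by
  classical
  rcases isEmpty_or_nonempty (pivotMatrices K p) with hemp | ⟨⟨D₀, hD₀⟩⟩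
  · simp
  have hp : Function.Injective p := hD₀.1.injective
  have hc₀ : 0 < c₀ := hc₁.trans_le hc
  have hlam := log_cosh_pos hc₁
  have ht0 : 0 < t := by
    have h1 := ht.lt
    have h2 := one_le_natCast_sub hmn
    have h3 : 0 ≤ 2 * ((n : ℝ) - m) * ((m : ℝ) ^ 2 + m) :=
      mul_nonneg (by linarith) (by positivity)
    exact_mod_cast h3.trans_lt h1
  have hT : (0 : ℝ) < t * Module.finrank ℚ K := by
    exact_mod_cast Nat.mul_pos ht0 Module.finrank_pos
  choose τ hτ hτu using fun D : pivotMatrices K p => exists_coprimeTuple (freeEntries p D.1)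
  let lev : pivotMatrices K p → ℕ := fun D => heightLevel (τ D).1.1.1 (freeEntries p D.1)
  let W : CoprimeTuples K (FreeEntry p) → ℝ≥0∞ := fun σ =>
    ENNReal.ofReal ((Ideal.absNorm σ.1.1.1 : ℝ) ^ (-a)) * ∏ e, idealWeight b (σ.1.2 e)
  set T : ℝ := t * Module.finrank ℚ K with hTdef
  set δ := Real.log (Real.cosh c₁) / 1000 with hδ
  set Ω : ℝ := Units.torsionOrder K ^ (m * (n - m)) * Real.exp (-(decayRate c₁ n m * T)) with hΩ
  have hΩ0 : 0 ≤ Ω := by positivity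
  have hfib : ∀ x : CoprimeTuples K (FreeEntry p) × ℕ,
      ∑' D : ((fun D => (τ D, lev D)) ⁻¹' {x}), contribution t R D.1.1 ≤
        ENNReal.ofReal (Ω * (5 * T * Real.exp (-(δ * T * (x.2 + 1))))) * W x.1 := by
    rintro ⟨σ, l⟩
    set c : ℝ≥0∞ := ENNReal.ofReal (5 * T * Real.exp (-(T *
      levelExponent c₁ (TwoInColumn σ.1.2) l))) * W σ with hcdef
    have h1 : ∀ D : ((fun D => (τ D, lev D)) ⁻¹' {((σ, l) : CoprimeTuples K (FreeEntry p) × ℕ)}),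
        contribution t R D.1.1 ≤ c := by
      rintro ⟨D, hD⟩
      have hD' : τ D = σ ∧ lev D = l := Prod.mk.injEq _ _ _ _ ▸ hD
      obtain ⟨rfl, rfl⟩ := hD'
      exact contribution_le_levelExponent hc₁ hK ht0 hR D.2 (τ D).1.1.2 (hτ D)
        (absNorm_le_denominatorIndex D.1 fun u hu => hτu D u fun e => hu e.1 e.2.1) ha hb
    refine (ENNReal.tsum_le_tsum h1).trans ((ENNReal_tsum_const_le (B :=
      Units.torsionOrder K ^ (m * (n - m)) * (1 + 2 * (l + 1) / c₀) ^
        (Units.rank K * (Finset.univ.filter fun e => σ.1.2 e ≠ ⊥).card)) c ?_).trans ?_)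
    · intro S
      let g : ((fun D => (τ D, lev D)) ⁻¹' {((σ, l) : CoprimeTuples K (FreeEntry p) × ℕ)}) →
          FreeEntry p → K := fun D => freeEntries p D.1.1
      have hg : Function.Injective g := fun D D' h =>
        Subtype.ext (Subtype.ext (D.1.2.1.eq_of_freeEntries_eq D'.1.2.1 h))
      rw [← Finset.card_image_of_injective S hg, ← card_freeEntry hp]
      refine card_le_of_heightLevel_eq hc₀ hK.2 σ.1.1.2 σ.1.2 l _ ?_
      intro α hα
      obtain ⟨⟨D, hD⟩, -, rfl⟩ := Finset.mem_image.mp hα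
      have hD' : τ D = σ ∧ lev D = l := Prod.mk.injEq _ _ _ _ ▸ hD
      obtain ⟨rfl, rfl⟩ := hD'
      exact ⟨hτ D, rfl⟩
    · rw [hcdef, ← mul_assoc, ← ENNReal.ofReal_mul (by positivity)]
      gcongr ENNReal.ofReal ?_ * _
      have h2 := level_sum_le hc₁ hc hK hm hmn ht hp σ.1.2 l
      have h3 := mul_le_mul_of_nonneg_left h2
        (show (0 : ℝ) ≤ Units.torsionOrder K ^ (m * (n - m)) * (5 * T) by positivity)
      rw [hΩ, hδ]
      refine le_trans (le_of_eq ?_) (h3.trans (le_of_eq ?_)) <;> ring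
  calc ∑' D : pivotMatrices K p, contribution t R D.1
      = ∑' x : CoprimeTuples K (FreeEntry p) × ℕ,
          ∑' D : ((fun D => (τ D, lev D)) ⁻¹' {x}), contribution t R D.1.1 :=
        (ENNReal.tsum_fiberwise _ _).symm
    _ ≤ ∑' x : CoprimeTuples K (FreeEntry p) × ℕ,
          ENNReal.ofReal (Ω * (5 * T * Real.exp (-(δ * T * (x.2 + 1))))) * W x.1 :=
        ENNReal.tsum_le_tsum hfib
    _ = ENNReal.ofReal Ω * (∑' l : ℕ, ENNReal.ofReal (5 * T * Real.exp (-(δ * T * (l + 1))))) *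
          ∑' σ, W σ := by
        rw [ENNReal.tsum_prod']
        simp only [ENNReal.ofReal_mul hΩ0]
        simp_rw [ENNReal.tsum_mul_right, ENNReal.tsum_mul_left]
    _ ≤ ENNReal.ofReal Ω * ENNReal.ofReal (5 / δ) * ∑' σ, W σ := by
        gcongr
        exact tsum_mul_exp_le (by positivity) hT
    _ = _ := by
        rw [← ENNReal.ofReal_mul hΩ0, hδ, show 5 / (Real.log (Real.cosh c₁) / 1000) =
          5000 / Real.log (Real.cosh c₁) by field_simp; norm_num]

end PivotSum

end NFMoment

/-! ### Conclusion -/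

namespace NFMoment

open NumberField Matrix
open scoped ENNReal

section Final

variable {K : Type*} [Field K] [NumberField K] {m n : ℕ}

/-- The sum over the coprime tuples in terms of the zeta factor; all arguments of the zeta function
that occur exceed `1`, so that `1 + ζ ≤ 2 ζ`. -/
lemma tsum_coprimeTuples_le_zetaFactor {t : ℕ} (hm : 2 ≤ m) (hmn : m < n)
    (ht : 2 * ((n : ℝ) - m) * ((m : ℝ) ^ 2 + m) < t) {ι : Type*} [Fintype ι]
    (hι : Fintype.card ι = m * (n - m)) :
    ∑' τ : CoprimeTuples K ι, ENNReal.ofReal ((Ideal.absNorm τ.1.1.1 : ℝ) ^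
        (-(1 / (2 * ((m : ℝ) + 1)) * t - 1 / Real.exp 1 * (m * ((n : ℝ) - m))))) *
        ∏ e, idealWeight ((t : ℝ) / (4 * m * ((n : ℝ) - m))) (τ.1.2 e) ≤
      ENNReal.ofReal (2 ^ (m * (n - m)) * zetaFactor K t n m) ∧ 0 ≤ zetaFactor K t n m := by
  have hN := one_le_natCast_sub hmn
  have hm' : (2 : ℝ) ≤ m := by exact_mod_cast hm
  have hmN : 2 ≤ (m : ℝ) * ((n : ℝ) - m) := by nlinarith
  have hmm : (6 : ℝ) ≤ (m : ℝ) ^ 2 + m := by nlinarith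
  have ht12 : (12 : ℝ) < t := by nlinarith
  have he : 1 / Real.exp 1 ≤ 1 / 2 :=
    one_div_le_one_div_of_le two_pos (by linarith [Real.exp_one_gt_d9])
  set a : ℝ := 1 / (2 * ((m : ℝ) + 1)) * t - 1 / Real.exp 1 * (m * ((n : ℝ) - m)) with ha
  set b : ℝ := (t : ℝ) / (4 * m * ((n : ℝ) - m)) with hb
  have h0e : 0 ≤ 1 / Real.exp 1 * (m * ((n : ℝ) - m)) :=
    mul_nonneg (by positivity) (by linarith)
  have ha1 : 1 < a := by
    have h1 : m * ((n : ℝ) - m) < 1 / (2 * ((m : ℝ) + 1)) * t := by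
      rw [one_div_mul_eq_div, lt_div_iff₀ (by positivity)]
      linarith
    have h2 : 1 / Real.exp 1 * (m * ((n : ℝ) - m)) ≤ 1 / 2 * (m * ((n : ℝ) - m)) :=
      mul_le_mul_of_nonneg_right he (by linarith)
    linarith
  have ha2 : a ≤ t / 6 := by
    have h1 : 1 / (2 * ((m : ℝ) + 1)) ≤ 1 / 6 :=
      one_div_le_one_div_of_le (by norm_num) (by linarith)
    have := mul_le_mul_of_nonneg_right h1 (Nat.cast_nonneg (α := ℝ) t)
    linarith
  have hb1 : 1 < b := by
    rw [hb, lt_div_iff₀ (by nlinarith)]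
    have : 0 ≤ (m : ℝ) * ((n : ℝ) - m) * (m - 2) :=
      mul_nonneg (by linarith) (by linarith)
    nlinarith
  have hcard : (Fintype.card ι : ℝ) * b = t / 4 := by
    rw [hι, hb, Nat.cast_mul, Nat.cast_sub hmn.le]
    have : (m : ℝ) ≠ 0 := by linarith
    have : (n : ℝ) - m ≠ 0 := by linarith
    field_simp
  -- `a + m (n - m) b ≤ t / 6 + t / 4 ≤ t - 1`
  have hs1 : 1 < (t : ℝ) - 1 := by linarith
  have hζs := one_le_zetaReal K hs1
  have hζa := one_le_zetaReal K ha1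
  have hζb := one_le_zetaReal K hb1
  have hZ : zetaFactor K t n m =
      zetaReal K a * zetaReal K b ^ (m * (n - m)) / zetaReal K ((t : ℝ) - 1) := rfl
  refine ⟨?_, by rw [hZ]; positivity⟩
  have key := idealZetaSum_mul_tsum_coprimeTuples_le (ι := ι) K (a := a) (b := b)
    (s := (t : ℝ) - 1) (by linarith) (by rw [hcard]; linarith)
  rw [idealZetaSum_eq K hs1, idealZetaSum_eq K ha1, idealZetaSum_eq K hb1, hι, mul_comm,
    ← ENNReal.le_div_iff_mul_le (Or.inl (by simpa using (by linarith : 0 < zetaReal K ((t : ℝ) - 1))))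
      (Or.inl ENNReal.ofReal_ne_top)] at key
  refine key.trans ?_
  have h1 : 1 + ENNReal.ofReal (zetaReal K b) ≤ ENNReal.ofReal (2 * zetaReal K b) := by
    rw [two_mul, ENNReal.ofReal_add (by linarith) (by linarith)]
    gcongr
    exact ENNReal.one_le_ofReal.mpr hζb
  calc ENNReal.ofReal (zetaReal K a) * (1 + ENNReal.ofReal (zetaReal K b)) ^ (m * (n - m)) /
        ENNReal.ofReal (zetaReal K ((t : ℝ) - 1))
      ≤ ENNReal.ofReal (zetaReal K a) * ENNReal.ofReal (2 * zetaReal K b) ^ (m * (n - m)) /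
        ENNReal.ofReal (zetaReal K ((t : ℝ) - 1)) := by gcongr
    _ = _ := by
        rw [← ENNReal.ofReal_pow (by positivity), ← ENNReal.ofReal_mul (by positivity),
          ← ENNReal.ofReal_div_of_pos (by positivity), hZ]
        congr 1
        rw [mul_pow]
        ring

/-- The estimate for one number field, with the factor `e^{-ε t d}`. -/
lemma normalizedContribution_le {c₀ c₁ R : ℝ} {t : ℕ} (hc₁ : 0 < c₁) (hc : c₁ ≤ c₀)
    (hK : HeightBounds K c₀ c₁) (hm : 2 ≤ m) (hmn : m < n) (ht : IsLarge K c₀ c₁ n m t)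
    (hR : 0 < R) :
    normalizedContribution K n m t R ≤
      ENNReal.ofReal (n ^ m * (5000 / Real.log (Real.cosh c₁) * 2 ^ (m * (n - m))) *
        Units.torsionOrder K ^ (m * (n - m)) * zetaFactor K t n m *
        Real.exp (-(decayRate c₁ n m * (t * Module.finrank ℚ K)))) := by
  have hN := one_le_natCast_sub hmn
  have hm' : (2 : ℝ) ≤ m := by exact_mod_cast hm
  have hlam := log_cosh_pos hc₁
  set a : ℝ := 1 / (2 * ((m : ℝ) + 1)) * t - 1 / Real.exp 1 * (m * ((n : ℝ) - m)) with ha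
  set b : ℝ := (t : ℝ) / (4 * m * ((n : ℝ) - m)) with hb
  have ha4 : a ≤ t / 4 := by
    have h0e : 0 ≤ 1 / Real.exp 1 * (m * ((n : ℝ) - m)) :=
      mul_nonneg (by positivity) (mul_nonneg (by linarith) (by linarith))
    have h1 : 1 / (2 * ((m : ℝ) + 1)) ≤ 1 / 4 :=
      one_div_le_one_div_of_le (by norm_num) (by linarith)
    have := mul_le_mul_of_nonneg_right h1 (Nat.cast_nonneg (α := ℝ) t)
    linarith
  set Z := zetaFactor K t n m with hZ
  have hZ0 : 0 ≤ Z := (tsum_coprimeTuples_le_zetaFactor (K := K) hm hmn ht.lt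
    (ι := Fin (m * (n - m))) (Fintype.card_fin _)).2
  set B : ℝ := Units.torsionOrder K ^ (m * (n - m)) *
        Real.exp (-(decayRate c₁ n m * (t * Module.finrank ℚ K))) *
        (5000 / Real.log (Real.cosh c₁)) with hB
  have hB0 : 0 ≤ B := by positivity
  have hsum : ∀ p : Fin m → Fin n, ∑' D : pivotMatrices K p, contribution t R D.1 ≤
      ENNReal.ofReal (B * (2 ^ (m * (n - m)) * Z)) := by
    intro p
    rcases isEmpty_or_nonempty (pivotMatrices K p) with hemp | ⟨⟨D₀, hD₀⟩⟩
    · simp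
    have hcard := card_freeEntry hD₀.1.injective
    have hb' : b = t / (4 * Fintype.card (FreeEntry p)) := by
      rw [hcard, hb, Nat.cast_mul, Nat.cast_sub hmn.le, mul_assoc]
    rw [ENNReal.ofReal_mul hB0]
    refine (tsum_pivotMatrices_le hc₁ hc hK hm hmn ht hR ha4 hb').trans ?_
    gcongr
    exact (tsum_coprimeTuples_le_zetaFactor hm hmn ht.lt hcard).1
  rw [normalizedContribution_eq_tsum]
  refine (tsum_setA2_le _).trans ((Finset.sum_le_card_nsmul _ _ _ fun p _ => hsum p).trans_eq ?_)
  rw [nsmul_eq_mul, Finset.card_univ, Fintype.card_fun, Fintype.card_fin, Fintype.card_fin,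
    ← ENNReal.ofReal_natCast, ← ENNReal.ofReal_mul (Nat.cast_nonneg _), hB]
  congr 1
  push_cast
  ring

end Final

end NFMoment

theorem mainTheorem7 (c₀ c₁ : ℝ) (hc₁ : 0 < c₁) (hc : c₁ ≤ c₀) :
    (∀ n m : ℕ, 2 ≤ m → m < n →
      ∃ C ε : ℝ, 0 < C ∧ 0 < ε ∧ ε = NFMoment.decayRate c₁ n m ∧
        ∀ (ι : Type*) (K : ι → Type*) [∀ i, Field (K i)] [∀ i, NumberField (K i)],
          (∀ i, NFMoment.HeightBounds (K i) c₀ c₁) →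
          ∀ t : ℕ, NFMoment.threshold K c₀ c₁ n m < t →
          ∀ R : ℝ, 0 < R → ∀ i : ι,
            NFMoment.normalizedContribution (K i) n m t R ≤
              ENNReal.ofReal
                (C * (NumberField.Units.torsionOrder (K i) : ℝ) ^ (m * (n - m)) *
                  ((t : ℝ) * Module.finrank ℚ (K i)) ^ (((m : ℝ) - 1) / 2) *
                  NFMoment.zetaFactor (K i) t n m *
                  Real.exp (-(ε * Module.finrank ℚ (K i) *
                    ((t : ℝ) - NFMoment.threshold K c₀ c₁ n m))))) ∧
    (∃ A : ℝ, 0 < A ∧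
      ∀ (ι : Type*) (K : ι → Type*) [∀ i, Field (K i)] [∀ i, NumberField (K i)],
        (∀ i, NFMoment.HeightBounds (K i) c₀ c₁) →
        ∀ n m : ℕ, 2 ≤ m → m < n →
          NFMoment.threshold K c₀ c₁ n m ≤ A * (n : ℝ) ^ 3 * Real.log (Real.log n)) := by
  have hc₀ : 0 < c₀ := hc₁.trans_le hc
  refine ⟨fun n m hm hmn => ?_, ?_⟩
  · have hlam := NFMoment.log_cosh_pos hc₁
    have hε := NFMoment.decayRate_pos (c₁ := c₁) (n := n) (m := m) hc₁ hmn
    have hn : (0 : ℝ) < n := by exact_mod_cast (by omega : 0 < n)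
    refine ⟨n ^ m * (5000 / Real.log (Real.cosh c₁) * 2 ^ (m * (n - m))), _, by positivity, hε, rfl,
      ?_⟩
    intro ι K _ _ hK t ht R hR i
    have hN := NFMoment.one_le_natCast_sub hmn
    have hm' : (2 : ℝ) ≤ m := by exact_mod_cast hm
    have hfirst := NFMoment.le_threshold_first K hc₀ hc₁ hmn i
    have hlarge : NFMoment.IsLarge (K i) c₀ c₁ n m t :=
      ⟨hfirst.trans_lt ht, NFMoment.rank_mul_log_le_of_threshold_lt K hc₀ hc₁ hmn i ht⟩
    have ht₀ : 0 ≤ NFMoment.threshold K c₀ c₁ n m :=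
      le_trans (mul_nonneg (by linarith) (by positivity)) hfirst
    have htpos : 0 < t := by exact_mod_cast ht₀.trans_lt ht
    have hT : (1 : ℝ) ≤ t * Module.finrank ℚ (K i) := by
      exact_mod_cast Nat.mul_pos htpos Module.finrank_pos
    have hZ := (NFMoment.tsum_coprimeTuples_le_zetaFactor (K := K i) hm hmn hlarge.lt
      (ι := Fin (m * (n - m))) (Fintype.card_fin _)).2
    refine (NFMoment.normalizedContribution_le hc₁ hc (hK i) hm hmn hlarge hR).trans
      (ENNReal.ofReal_le_ofReal ?_)
    -- The power of `t d` is at least one, and `t - t₀ ≤ t`.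
    gcongr ?_ * _ * Real.exp ?_
    · exact le_mul_of_one_le_right (by positivity)
        (Real.one_le_rpow hT (by linarith))
    · rw [neg_le_neg_iff]
      have : 0 ≤ NFMoment.decayRate c₁ n m * Module.finrank ℚ (K i) *
          NFMoment.threshold K c₀ c₁ n m := by positivity
      linarith
  · obtain ⟨A, hA, h⟩ := NFMoment.exists_threshold_le hc₀ hc₁
    exact ⟨A, hA, fun ι K _ _ _ n m hm hmn => h ι K n m hm hmn⟩
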